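/- **Rearrangement lemma.** Let $m\ge 1$, $n\ge 0$, let $\theta\in M_m(\mathbb R)$ be skew-symmetric, and let $C(\mathbb T^m_\theta)\subset B(L^2(\mathbb T^m))$ be the $C^*$-algebra generated by the unitaries $(U_sf)(x)=e^{ix_s}f(x+\pi\theta_s)$, $1\le s\le m$, where $\mathbb T^m=\mathbb R^m/(2\pi\mathbb Z)^m$ and $\theta_s$ is the $s$-th column of $\theta$. Let $C^\infty(\mathbb T^m_\theta)$ be the set of sums $\sum_{l\in\mathbb Z^m}a_lU_1^{l_1}\cdots U_m^{l_m}$ with rapidly decreasing $(a_l)$. Let $\mathbf A=(k_{st})$ be an $m\times m$ matrix over $C^\infty(\mathbb T^m_\theta)$ with $\mathbf A=\exp(h)$, where $h=(h_{st})$ is a symmetric matrix over $C^\infty(\mathbb T^m_\theta)$ with self-adjoint, mutually commuting entries. Put $p_2(\xi)=\sum_{s,t}k_{st}\xi_s\xi_t$ and $b_0(\xi,\lambda)=(p_2(\xi)-\lambda)^{-1}$; real powers of $b_0$ are taken with the principal branch. Let $\mathcal C$ be the imaginary axis $\lambda=ix$ with $x$ running from $-\infty$ to $\infty$. Let $\alpha=(\alpha_0,\dots,\alpha_n)\in\mathbb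 R_{>0}^{n+1}$ and let $\rho_1,\dots,\rho_n\in C^\infty(\mathbb T^m_\theta)[\xi]$ be polynomials in $\xi=(\xi_1,\dots,\xi_m)$. *Smooth functional calculus.* Let $\mathcal M\subset\mathbb R^{m^2}$ be the joint spectrum of the commuting tuple $a=(k_{st})$, i.e. the set of its values under the characters of the $C^*$-algebra it generates. Let $f$ be a complex function of $n+1$ variables in $\mathbb R^{m^2}$ that is smooth near $\mathcal M^{n+1}$, and let $g$ be a Schwartz function that agrees with $f$ in a neighbourhood of $\mathcal M^{n+1}$. Write $g(x)=\int \hat g(\zeta)e^{2\pi i\langle\zeta,x\rangle}d\zeta$. The operator $f(\mathbf A^{(0)},\dots,\mathbf A^{(n)})$ is $$f(\mathbf A^{(0)},\dots,\mathbf A^{(n)})(r_1\otimes\cdots\otimes r_n)=\int\hat g(\zeta)\,e^{2\pi i\zeta^{(0)}\cdot a}\,r_1\,e^{2\pi i\zeta^{(1)}\cdot a}\cdots r_n\,e^{2\pi i\zeta^{(n)}\cdot a}\,d\zeta .$$ *The operator $F_\alpha(\mathbf A)|_{\xi=0}$.* Let $\triangle^n=\{u\in\mathbb R^n: u_l\ge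 0,\ \sum_l u_l\le 1\}$ and, for $\bar A=(A_0,\dots,A_n)$, $$\omega_\alpha(u)=\Big(\prod_{l=0}^n\Gamma(\alpha_l)\Big)^{-1}\Big(1-\sum_{l=1}^n u_l\Big)^{\alpha_0-1}\prod_{l=1}^n u_l^{\alpha_l-1},\qquad B_n(u)=B_n(\bar A,u)=A_0\Big(1-\sum_{l=1}^n u_l\Big)+\sum_{l=1}^nA_lu_l .$$ Set $$F_\alpha(\bar A,\partial_\xi)=\int_{\triangle^n}\omega_\alpha(u)\,\frac{\pi^{m/2}}{\sqrt{\det B_n(u)}}\,\exp\Big(\tfrac14\sum_{i,j=1}^m (B_n(u)^{-1})_{ij}\,\partial_{\xi_i}\partial_{\xi_j}\Big)\,du ,$$ where the exponential is the power series $\sum_{N\ge0}\frac1{N!}(\cdot)^N$, a finite sum on polynomials. Then $F_\alpha(\mathbf A)|_{\xi=0}$ is obtained by substituting $A_l\to\mathbf A^{(l)}$. That is, on $\xi^\gamma\,(r_1\otimes\cdots\otimes r_n)$ it is the operator $f_\gamma(\mathbf A^{(0)},\dots,\mathbf A^{(n)})$ applied to $r_1\otimes\cdots\otimes r_n$, where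 $f_\gamma(\bar A)=\big(F_\alpha(\bar A,\partial_\xi)\,\xi^\gamma\big)\big|_{\xi=0}$, and it is extended linearly. *Claim.* For every multi-index $\gamma$ the operator $f_\gamma(\mathbf A^{(0)},\dots,\mathbf A^{(n)})$ is well defined: $f_\gamma$ has a Schwartz extension $g$ as above, and the result does not depend on the choice of $g$. For every $\xi\ne0$ the improper integral $\int_{\mathcal C}e^{-\lambda}\,b_0^{\alpha_0}\rho_1b_0^{\alpha_1}\cdots\rho_nb_0^{\alpha_n}\,d\lambda$ converges in norm, it is Bochner integrable as a function of $\xi\in\mathbb R^m$ (Lebesgue measure), and $$\frac1{2\pi i}\int_{\mathbb R^m}\int_{\mathcal C}e^{-\lambda}\,b_0^{\alpha_0}\rho_1b_0^{\alpha_1}\cdots\rho_nb_0^{\alpha_n}\,d\lambda\,d\xi =F_\alpha(\mathbf A)\big|_{\xi=0}\big(\rho_1(\xi)\otimes\cdots\otimes\rho_n(\xi)\big).$$ -/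

import Mathlib

open MeasureTheory Filter Topology Complex
open scoped FourierTransform SchwartzMap ENNReal Nat

noncomputable section

namespace NCTorus

/-! ### The noncommutative torus -/

/-- The Hilbert space `L²(𝕋^m)`; the torus `ℝ^m / (2π ℤ)^m` is parametrised by `x = 2π t` with
`t ∈ ℝ^m / ℤ^m`, with its normalised Haar measure. -/
abbrev L2Torus (m : ℕ) : Type := Lp ℂ 2 (volume : Measure (UnitAddTorus (Fin m)))

/-- The translation `(V_v f)(t) = f (t + v)` on `L²(𝕋^m)`. -/
def translation {m : ℕ} (v : UnitAddTorus (Fin m)) : L2Torus m →L[ℂ] L2Torus m :=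
  (Lp.compMeasurePreservingₗᵢ (E := ℂ) (p := 2) (μ := volume) (μb := volume) ℂ
    (fun t : UnitAddTorus (Fin m) => t + v)
    (measurePreserving_add_right volume v)).toContinuousLinearMap

/-- Multiplication by the character `e^{i x_s} = e^{2π i t_s}` on `L²(𝕋^m)`. -/
def characterMul {m : ℕ} (s : Fin m) : L2Torus m →L[ℂ] L2Torus m :=
  (ContinuousLinearMap.mul ℂ ℂ).holderL volume ∞ 2 2
    (ContinuousMap.toLp ∞ volume ℂ (UnitAddTorus.mFourier (Pi.single s 1 : Fin m → ℤ)))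

/-- The generator `U_s`: `(U_s f)(x) = e^{i x_s} f (x + π θ_s)`, where `θ_s` is the `s`-th column
of `θ`. In the coordinate `t = x / (2π)` the shift is by `θ_s / 2`. -/
def gen {m : ℕ} (θ : Matrix (Fin m) (Fin m) ℝ) (s : Fin m) : L2Torus m →L[ℂ] L2Torus m :=
  characterMul s ∘L translation (fun j => ((θ j s / 2 : ℝ) : UnitAddCircle))

end NCTorus

/-- The `C*`-algebra `C(𝕋^m_θ)`: the norm closure in `B(L²(𝕋^m))` of the unital `*`-algebra
generated by `U_1, …, U_m`. -/
abbrev NCTorus {m : ℕ} (θ : Matrix (Fin m) (Fin m) ℝ) : Type :=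
  (StarAlgebra.adjoin ℂ (Set.range (NCTorus.gen θ))).topologicalClosure

namespace NCTorus

instance instIsClosed {m : ℕ} (θ : Matrix (Fin m) (Fin m) ℝ) :
    IsClosed (((StarAlgebra.adjoin ℂ (Set.range (gen θ))).topologicalClosure :
      StarSubalgebra ℂ (L2Torus m →L[ℂ] L2Torus m)) : Set (L2Torus m →L[ℂ] L2Torus m)) :=
  StarSubalgebra.isClosed_topologicalClosure _

instance instCStarAlgebra {m : ℕ} (θ : Matrix (Fin m) (Fin m) ℝ) : CStarAlgebra (NCTorus θ) :=
  StarSubalgebra.cstarAlgebra _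

/-- The generator `U_s` as an element of `C(𝕋^m_θ)`. -/
def U {m : ℕ} (θ : Matrix (Fin m) (Fin m) ℝ) (s : Fin m) : NCTorus θ :=
  ⟨gen θ s, StarSubalgebra.le_topologicalClosure _
    (StarAlgebra.subset_adjoin ℂ _ (Set.mem_range_self s))⟩

/-- Integer powers of a unitary element `u`, with `u⁻¹ = u*`. -/
def unitaryPow {A : Type*} [Monoid A] [Star A] (u : A) : ℤ → A
  | Int.ofNat p => u ^ p
  | Int.negSucc p => star u ^ (p + 1)

/-- The monomial `U^l = U_1^{l_1} ⋯ U_m^{l_m}`, `l ∈ ℤ^m`. -/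
def monomialU {m : ℕ} (θ : Matrix (Fin m) (Fin m) ℝ) (l : Fin m → ℤ) : NCTorus θ :=
  (List.ofFn fun s => unitaryPow (U θ s) (l s)).prod

/-- The smooth noncommutative torus `C^∞(𝕋^m_θ)`: all sums `∑_l a_l U^l` with rapidly decreasing
coefficients `(a_l)`, `l ∈ ℤ^m`. -/
def Smooth {m : ℕ} (θ : Matrix (Fin m) (Fin m) ℝ) : Set (NCTorus θ) :=
  {x | ∃ a : (Fin m → ℤ) → ℂ, (∀ N : ℕ, ∃ C : ℝ, ∀ l, (1 + ‖l‖) ^ N * ‖a l‖ ≤ C) ∧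
    HasSum (fun l => a l • monomialU θ l) x}

/-- Ellipticity of the coefficient matrix `𝐀 = (k_{st})` of the leading symbol: its entries are in
`C^∞(𝕋^m_θ)` and `𝐀 = exp(log 𝐀)`, where `log 𝐀 = (h_{st})` is a symmetric matrix with
self-adjoint and mutually commuting entries in `C^∞(𝕋^m_θ)`. -/
def IsElliptic {m : ℕ} (θ : Matrix (Fin m) (Fin m) ℝ) (k : Matrix (Fin m) (Fin m) (NCTorus θ)) :
    Prop :=
  (∀ s t, k s t ∈ Smooth θ) ∧
  ∃ h : Matrix (Fin m) (Fin m) (NCTorus θ),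
    (∀ s t, h s t ∈ Smooth θ) ∧ (∀ s t, h s t = h t s) ∧ (∀ s t, IsSelfAdjoint (h s t)) ∧
    (∀ s t s' t', Commute (h s t) (h s' t')) ∧ k = NormedSpace.exp h

end NCTorus

namespace Rearrangement

/-! ### Polynomial symbols and the summands of the resolvent approximation -/

/-- Polynomials in `ξ = (ξ_1, …, ξ_m)` with coefficients in `A`, given by their coefficients. -/
abbrev PolySymbol (m : ℕ) (A : Type*) [Zero A] : Type _ := (Fin m →₀ ℕ) →₀ A

section

variable {A : Type*} [CStarAlgebra A]

/-- The value at `ξ` of the symbol `∑_β ρ_β ξ^β`. -/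
def PolySymbol.eval {m : ℕ} (ρ : PolySymbol m A) (ξ : Fin m → ℝ) : A :=
  ρ.sum fun β c => ((∏ i, ξ i ^ β i : ℝ) : ℂ) • c

/-- The contraction `(c_0 ⊗ ⋯ ⊗ c_n) · (r_1 ⊗ ⋯ ⊗ r_n) = c_0 r_1 c_1 ⋯ r_n c_n`. -/
def contraction {n : ℕ} (c : Fin (n + 1) → A) (r : Fin n → A) : A :=
  c 0 * (List.ofFn fun j : Fin n => r j * c j.succ).prod

/-- The leading symbol `p_2(ξ) = ∑ k_{st} ξ_s ξ_t`. -/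
def leadingSymbol {m : ℕ} (k : Matrix (Fin m) (Fin m) A) (ξ : Fin m → ℝ) : A :=
  ∑ s, ∑ t, ((ξ s * ξ t : ℝ) : ℂ) • k s t

/-- `b_0(ξ, z) = (p_2(ξ) - z)⁻¹`. -/
def b₀ {m : ℕ} (k : Matrix (Fin m) (Fin m) A) (ξ : Fin m → ℝ) (z : ℂ) : A :=
  Ring.inverse (leadingSymbol k ξ - algebraMap ℂ A z)

/-- The power `b^a` of a normal element by a real exponent: continuous functional calculus for the
principal branch of `w ↦ w^a`. -/
def realPow (b : A) (a : ℝ) : A := cfc (fun w : ℂ => w ^ (a : ℂ)) b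

/-- `b_0^{α_0} ρ_1 b_0^{α_1} ⋯ ρ_n b_0^{α_n}` at the point `(ξ, z)`. -/
def resolventTerm {m n : ℕ} (k : Matrix (Fin m) (Fin m) A) (α : Fin (n + 1) → ℝ)
    (ρ : Fin n → PolySymbol m A) (ξ : Fin m → ℝ) (z : ℂ) : A :=
  contraction (fun j => realPow (b₀ k ξ z) (α j)) (fun j => (ρ j).eval ξ)

/-- `v = ∫_𝒞 f(z) dz` as a norm convergent improper integral, where `𝒞` is the imaginary axis
`z = i x` with `x` running from `-∞` to `∞`. -/
def HasImaginaryAxisIntegral (f : ℂ → A) (v : A) : Prop :=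
  (∀ a b : ℝ, IntervalIntegrable (fun x : ℝ => I • f (I * x)) volume a b) ∧
  Tendsto (fun p : ℝ × ℝ => ∫ x in (-p.1)..p.2, I • f (I * x)) (atTop ×ˢ atTop) (𝓝 v)

/-! ### Smooth functional calculus for a commuting tuple, acting on `A^{⊗ n}` -/

/-- The joint spectrum `ℳ ⊆ ℝ^ι` of a tuple of commuting self-adjoint elements: the points
`(χ(a_i))_i`, where `χ` runs over the characters of the `C*`-algebra generated by `1` and the
`a_i`. -/
def jointSpectrum {ι : Type*} (a : ι → A) : Set (ι → ℝ) :=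
  {x | ∃ χ : (StarAlgebra.adjoin ℂ (Set.range a)).topologicalClosure →ₐ[ℂ] ℂ,
    ∀ i, χ ⟨a i, StarSubalgebra.le_topologicalClosure _
      (StarAlgebra.subset_adjoin ℂ _ (Set.mem_range_self i))⟩ = (x i : ℂ)}

/-- `g` agrees with `f` on a neighbourhood of `ℳ^{n+1}`. -/
def Extends {ι : Type*} [Fintype ι] {n : ℕ} (a : ι → A) (f : (Fin (n + 1) → ι → ℝ) → ℂ)
    (g : 𝓢(EuclideanSpace ℝ (Fin (n + 1) × ι), ℂ)) : Prop :=
  ∀ᶠ x in 𝓝ˢ {x : EuclideanSpace ℝ (Fin (n + 1) × ι) |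
      ∀ j, (fun i => x (j, i)) ∈ jointSpectrum a},
    g x = f fun j i => x (j, i)

/-- The Schwartz functional calculus: since `g(x) = ∫ ĝ(ζ) e^{2π i ⟨ζ, x⟩} dζ`, the value of
`g(a^{(0)}, …, a^{(n)})` on `r_1 ⊗ ⋯ ⊗ r_n` is
`∫ ĝ(ζ) e^{2π i ζ^{(0)}·a} r_1 e^{2π i ζ^{(1)}·a} ⋯ r_n e^{2π i ζ^{(n)}·a} dζ`. -/
def schwartzFunCalc {ι : Type*} [Fintype ι] {n : ℕ} (a : ι → A)
    (g : 𝓢(EuclideanSpace ℝ (Fin (n + 1) × ι), ℂ)) (r : Fin n → A) : A :=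
  ∫ ζ : EuclideanSpace ℝ (Fin (n + 1) × ι), (𝓕 g) ζ •
    contraction (fun j => NormedSpace.exp (∑ i, (2 * Real.pi * I * (ζ (j, i) : ℂ)) • a i)) r

/-- `Φ` is the operator `f(a^{(0)}, …, a^{(n)})` (on elementary tensors): `f` has a Schwartz
extension from a neighbourhood of `ℳ^{n+1}`, and `Φ` is the value of the Schwartz functional
calculus on every such extension. -/
def IsSmoothFunCalc {ι : Type*} [Fintype ι] {n : ℕ} (a : ι → A)
    (f : (Fin (n + 1) → ι → ℝ) → ℂ) (Φ : (Fin n → A) → A) : Prop :=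
  (∃ g, Extends a f g) ∧ ∀ g, Extends a f g → ∀ r, schwartzFunCalc a g r = Φ r

open Classical in
/-- The operator `f(a^{(0)}, …, a^{(n)})` on elementary tensors (zero if it is not defined). -/
def smoothFunCalc {ι : Type*} [Fintype ι] {n : ℕ} (a : ι → A)
    (f : (Fin (n + 1) → ι → ℝ) → ℂ) : (Fin n → A) → A :=
  if h : ∃ Φ, IsSmoothFunCalc a f Φ then h.choose else 0

end

/-! ### The hypergeometric family -/

/-- The standard simplex `{u ∈ ℝ^n : u_l ≥ 0, ∑ u_l ≤ 1}`. -/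
def simplex (n : ℕ) : Set (Fin n → ℝ) := {u | (∀ l, 0 ≤ u l) ∧ ∑ l, u l ≤ 1}

/-- `ω_α(u) = (∏_{l=0}^n Γ(α_l))⁻¹ (1 - ∑ u_l)^{α_0 - 1} ∏_{l=1}^n u_l^{α_l - 1}`. -/
def omega {n : ℕ} (α : Fin (n + 1) → ℝ) (u : Fin n → ℝ) : ℝ :=
  (∏ j, Real.Gamma (α j))⁻¹ * (1 - ∑ l, u l) ^ (α 0 - 1) * ∏ l, u l ^ (α l.succ - 1)

/-- `B_n(Ā, u) = A_0 (1 - ∑ u_l) + ∑ A_l u_l`. -/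
def coupledMatrix {m n : ℕ} (Abar : Fin (n + 1) → Matrix (Fin m) (Fin m) ℝ) (u : Fin n → ℝ) :
    Matrix (Fin m) (Fin m) ℝ :=
  (1 - ∑ l, u l) • Abar 0 + ∑ l, u l • Abar l.succ

/-- The differential operator `¼ ∑_{i,j} M_{ij} ∂_{ξ_i} ∂_{ξ_j}` on polynomials in `ξ`. -/
def quarterHessian {m : ℕ} (M : Matrix (Fin m) (Fin m) ℝ) (p : MvPolynomial (Fin m) ℝ) :
    MvPolynomial (Fin m) ℝ :=
  (1 / 4 : ℝ) • ∑ i, ∑ j, M i j • MvPolynomial.pderiv i (MvPolynomial.pderiv j p)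

/-- `exp(¼ ∑ M_{ij} ∂_{ξ_i} ∂_{ξ_j}) p`, as the power series of the differential operator, which
has only finitely many nonzero terms on a polynomial. -/
def expQuarterHessian {m : ℕ} (M : Matrix (Fin m) (Fin m) ℝ) (p : MvPolynomial (Fin m) ℝ) :
    MvPolynomial (Fin m) ℝ :=
  ∑ᶠ N : ℕ, ((N ! : ℝ))⁻¹ • (quarterHessian M)^[N] p

/-- The scalar function of `Ā = (A_0, …, A_n)` obtained by applying the operator
`∫_{Δ^n} ω_α(u) π^{m/2} (det B_n(u))^{-1/2} exp(¼ ∑ (B_n(u)⁻¹)_{ij} ∂_{ξ_i} ∂_{ξ_j}) du`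
to the monomial `ξ^γ` and evaluating at `ξ = 0`. -/
def scalarF {m n : ℕ} (α : Fin (n + 1) → ℝ) (γ : Fin m →₀ ℕ)
    (Abar : Fin (n + 1) → Matrix (Fin m) (Fin m) ℝ) : ℝ :=
  ∫ u in simplex n, omega α u *
    (Real.pi ^ ((m : ℝ) / 2) / Real.sqrt (coupledMatrix Abar u).det) *
    MvPolynomial.eval 0
      (expQuarterHessian (coupledMatrix Abar u)⁻¹ (MvPolynomial.monomial γ 1))

/-- `scalarF` as a function of the `n + 1` tuples of matrix entries. -/
def spectralF {m n : ℕ} (α : Fin (n + 1) → ℝ) (γ : Fin m →₀ ℕ)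
    (x : Fin (n + 1) → (Fin m × Fin m) → ℝ) : ℂ :=
  (scalarF α γ (fun j => Matrix.of fun s t => x j (s, t)) : ℝ)

/-- The tuple of the `m²` entries of the matrix `k`. -/
def entries {m : ℕ} {A : Type*} (k : Matrix (Fin m) (Fin m) A) : Fin m × Fin m → A :=
  fun p => k p.1 p.2

/-- `F_α(𝐀)|_{ξ=0} (ρ_1(ξ) ⊗ ⋯ ⊗ ρ_n(ξ))`. Expanding
`ρ_1(ξ) ⊗ ⋯ ⊗ ρ_n(ξ) = ∑_{β_1, …, β_n} ξ^{β_1 + ⋯ + β_n} ρ_{1,β_1} ⊗ ⋯ ⊗ ρ_{n,β_n}`, the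
differential operator acts on the monomials in `ξ`, and the resulting function of `A_0, …, A_n`,
evaluated on the entries of `𝐀^{(0)}, …, 𝐀^{(n)}` by the smooth functional calculus, acts on
the coefficient tensors. -/
def FAtZero {m n : ℕ} {A : Type*} [CStarAlgebra A] (α : Fin (n + 1) → ℝ)
    (k : Matrix (Fin m) (Fin m) A) (ρ : Fin n → PolySymbol m A) : A :=
  ∑ β ∈ Fintype.piFinset (fun j => (ρ j).support),
    smoothFunCalc (entries k) (spectralF α (∑ j, β j)) (fun j => ρ j (β j))

end Rearrangement

end

/-!
The idea is to reduce every identity in the noncommutative algebra to an identity between functions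
of `n + 1` points of the joint spectrum `M` of the entries of `𝐀`.

Gelfand theory for the commuting self-adjoint entries gives a `*`-homomorphism `Θ : C(M) → A` with
`Θ(coordinates) = entries of 𝐀` (`jointSpectrum_calculus`), and since `𝐀 = exp h` with `h`
symmetric, `M` consists of positive definite matrices (`exp_matrix_spec`). Both sides of the
formula are built from expressions `Θ(e_0) r_1 Θ(e_1) ⋯ r_n Θ(e_n)`, a bounded multilinear map
`L` of `(e_0, …, e_n) ∈ C(M)^{n+1}`, by integrating over parameters with `∏ ‖e_j‖` integrable.
Using partitions of unity to replace each `e_j` by a finite-rank approximation, such an integral is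
the limit of finite sums that see only the values of the scalar function
`∫ w(t) ∏ e_j(t)(y_j) dt` at points `y ∈ M^{n+1}`; this is the relation `Represents`, with
`represents_integral` and `Represents.unique`. In particular the functional calculus of a Schwartz
function depends only on its values on `M^{n+1}` (`represents_schwartzFunCalc`), which gives the
independence of the extension.

With `q_ξ(x) = ∑ x_{st} ξ_s ξ_t`, what remains is scalar analysis.
* Put `u_0 = 1 - ∑ u_l` and `|α| = ∑ α_j`. The Gamma integrals of the factors, in the coordinates
  `t (u_0, …, u_n)` on the orthant, give
  `∏ w_j^{-α_j} = ∫_0^∞ t^{|α| - 1} ∫ ω_α(u) e^{-t ∑ u_j w_j} du dt` (`prod_cpow_eq_integral`). For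
  `w_j = q_ξ(x_j) - i x` this is a Fourier transform in `x`, and when `|α| > 1` Fourier inversion at
  `t = 1` evaluates the integral over the imaginary axis as `2πi ∫ ω_α(u) e^{-∑ u_j q_ξ(x_j)} du`
  (`integral_exp_mul_prod_cpow`). For smaller `|α|` the integral need not converge absolutely; an
  integration by parts reduces it to the exponents `α + e_i`
  (`tendsto_intervalIntegral_resPow`). The result is a Dirichlet average of heat exponentials
  (`heatAverage`), which decays like a Gaussian in `ξ`.
* Integrating `ξ^γ e^{-B ξ·ξ}` over `ξ`, with `B = B_n(u)`, produces
  `π^{m/2} (det B)^{-1/2} (exp(¼ ∑ (B⁻¹)_{ij} ∂_i ∂_j) ξ^γ)(0)` (`integral_eval_mul_exp`): both sides,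
  as functionals of a polynomial, satisfy the recursion `E(ξ_j p) = E(½ ∑_i (B⁻¹)_{ji} ∂_i p)`.
* The resulting function `spectralF` of `n + 1` matrices is smooth near `M^{n+1}`
  (`contDiffAt_spectralF`). Instead of differentiating under the integral over the simplex `S`, one
  observes that the integrand is a smooth map into the Banach algebra `C(S)`, built from the linear
  map `x ↦ B_n(x, ·)` by polynomials, inversion and the square root, to which a continuous linear
  functional is applied. A cutoff then gives a Schwartz extension.
-/

noncomputable section

namespace Rearrangement

/-! ### Finite-rank approximation of multilinear maps on `C(X)` -/

section Represents

/-- Continuous partitions of unity of arbitrarily small mesh. -/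
theorem exists_fine_partition (X : Type*) [PseudoMetricSpace X] [CompactSpace X] {δ : ℝ}
    (hδ : 0 < δ) :
    ∃ (s : Finset X) (ψ : X → C(X, ℝ)), (∀ y x, 0 ≤ ψ y x) ∧ (∀ x, ∑ y ∈ s, ψ y x = 1) ∧
      ∀ y x, ψ y x ≠ 0 → dist x y < δ := by
  obtain ⟨t, -, htf, ht⟩ := finite_cover_balls_of_compact (isCompact_univ (X := X)) hδ
  lift t to Finset X using htf
  let b : X → X → ℝ := fun y x => max 0 (δ - dist x y)
  have hb0 : ∀ y x, 0 ≤ b y x := fun y x => le_max_left _ _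
  have hbc : ∀ y, Continuous (b y) := fun y => by fun_prop
  have hS : ∀ x, 0 < ∑ y ∈ t, b y x := by
    intro x
    obtain ⟨y, hy, hxy⟩ := Set.mem_iUnion₂.1 (ht (Set.mem_univ x))
    refine Finset.sum_pos' (fun y _ => hb0 y x) ⟨y, hy, ?_⟩
    exact lt_max_of_lt_right (by simpa using hxy)
  refine ⟨t, fun y => ⟨fun x => b y x / ∑ z ∈ t, b z x, ?_⟩, ?_, ?_, ?_⟩
  · exact (hbc y).div (continuous_finsetSum _ fun z _ => hbc z) fun x => (hS x).ne'
  · exact fun y x => div_nonneg (hb0 y x) (hS x).le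
  · intro x
    simp only [ContinuousMap.coe_mk]
    rw [← Finset.sum_div, div_self (hS x).ne']
  · intro y x h
    by_contra! hle
    exact h (by simp [b, max_eq_left (sub_nonpos.2 hle)])

variable {X : Type*} [PseudoMetricSpace X] [CompactSpace X]

variable (X) in
/-- A finite `1 / (N + 1)`-net of the compact space `X`. -/
def netPoints (N : ℕ) : Finset X :=
  (exists_fine_partition X (Nat.one_div_pos_of_nat (α := ℝ) (n := N))).choose

/-- A partition of unity of mesh `1 / (N + 1)`, indexed by the points of `netPoints X N`. -/
def netBump (N : ℕ) (y : X) : C(X, ℂ) :=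
  (⟨Complex.ofReal, Complex.continuous_ofReal⟩ : C(ℝ, ℂ)).comp
    ((exists_fine_partition X (Nat.one_div_pos_of_nat (α := ℝ) (n := N))).choose_spec.choose y)

/-- The finite-rank operator `f ↦ ∑_y f(y) ψ_y` on `C(X)`. -/
def netApprox (N : ℕ) (f : C(X, ℂ)) : C(X, ℂ) := ∑ y ∈ netPoints X N, f y • netBump N y

/-- Averages against the partition of unity at `x` only see the net points close to `x`. -/
theorem norm_sum_smul_netBump_le (N : ℕ) (c : X → ℂ) {C : ℝ} (x : X)
    (hc : ∀ y, dist x y < 1 / ((N : ℝ) + 1) → ‖c y‖ ≤ C) :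
    ‖∑ y ∈ netPoints X N, c y * netBump N y x‖ ≤ C := by
  obtain ⟨h0, h1, h2⟩ :=
    (exists_fine_partition X (Nat.one_div_pos_of_nat (α := ℝ) (n := N))).choose_spec.choose_spec
  set ψ := (exists_fine_partition X
    (Nat.one_div_pos_of_nat (α := ℝ) (n := N))).choose_spec.choose with hψ
  have hb : ∀ y, netBump N y x = (ψ y x : ℂ) := fun y => rfl
  calc ‖∑ y ∈ netPoints X N, c y * netBump N y x‖
      ≤ ∑ y ∈ netPoints X N, C * ψ y x := by
        refine norm_sum_le_of_le _ fun y _ => ?_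
        rw [hb, norm_mul, Complex.norm_real, Real.norm_of_nonneg (h0 y x)]
        by_cases hz : ψ y x = 0
        · simp [hz]
        · exact mul_le_mul_of_nonneg_right (hc y (h2 y x hz)) (h0 y x)
    _ = C := by rw [← Finset.mul_sum]; erw [h1 x]; rw [mul_one]

theorem sum_netBump (N : ℕ) (x : X) : ∑ y ∈ netPoints X N, netBump N y x = 1 := by
  obtain ⟨h0, h1, h2⟩ :=
    (exists_fine_partition X (Nat.one_div_pos_of_nat (α := ℝ) (n := N))).choose_spec.choose_spec
  have := congrArg Complex.ofReal (h1 x)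
  rw [Complex.ofReal_sum, Complex.ofReal_one] at this
  exact this

theorem netApprox_apply (N : ℕ) (f : C(X, ℂ)) (x : X) :
    netApprox N f x = ∑ y ∈ netPoints X N, f y * netBump N y x := by
  simp [netApprox, ContinuousMap.sum_apply]

theorem norm_netApprox_le (N : ℕ) (f : C(X, ℂ)) : ‖netApprox N f‖ ≤ ‖f‖ := by
  rw [ContinuousMap.norm_le _ (norm_nonneg _)]
  intro x
  rw [netApprox_apply]
  exact norm_sum_smul_netBump_le N f x fun y _ => f.norm_coe_le_norm y

theorem tendsto_netApprox (f : C(X, ℂ)) :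
    Tendsto (fun N => netApprox N f) atTop (𝓝 f) := by
  rw [Metric.tendsto_atTop]
  intro ε hε
  obtain ⟨δ, hδ, hf⟩ := Metric.uniformContinuous_iff.1
    (CompactSpace.uniformContinuous_of_continuous f.continuous) (ε / 2) (half_pos hε)
  obtain ⟨N₀, hN₀⟩ := exists_nat_one_div_lt hδ
  refine ⟨N₀, fun N hN => ?_⟩
  rw [dist_eq_norm]
  refine lt_of_le_of_lt ?_ (half_lt_self hε)
  rw [ContinuousMap.norm_le _ (half_pos hε).le]
  intro x
  have h1 : (netApprox N f - f) x = ∑ y ∈ netPoints X N, (f y - f x) * netBump N y x := by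
    simp only [ContinuousMap.sub_apply, netApprox_apply, sub_mul, Finset.sum_sub_distrib]
    rw [← Finset.mul_sum, sum_netBump, mul_one]
  rw [h1]
  refine norm_sum_smul_netBump_le N (fun y => f y - f x) x fun y hy => ?_
  rw [← dist_eq_norm]
  refine (hf ?_).le
  rw [dist_comm]
  exact hy.trans ((Nat.one_div_le_one_div hN).trans_lt hN₀)

variable {ι : Type*} [Fintype ι] {A : Type*} [NormedAddCommGroup A] [NormedSpace ℂ A]
  (L : ContinuousMultilinearMap ℂ (fun _ : ι => C(X, ℂ)) A)

open Classical in
/-- The value on `F : X^ι → ℂ` of the `N`-th finite-rank approximation of the functional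
`e ↦ L(e)` on `C(X)^{⊗ ι}`. It only involves finitely many values of `F`, so it makes sense for
every function `F`. -/
def approxVal (N : ℕ) (F : (ι → X) → ℂ) : A :=
  ∑ y ∈ Fintype.piFinset (fun _ : ι => netPoints X N), F y • L (fun j => netBump N (y j))

/-- The vector `v` is the value on `F : X^ι → ℂ` of the extension of the multilinear map `L` from
elementary tensors, obtained as the limit of finite-rank approximations. The point is that `v` is
determined by the values of `F`. -/
def Represents (F : (ι → X) → ℂ) (v : A) : Prop :=
  Tendsto (fun N => approxVal L N F) atTop (𝓝 v)

variable {L}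

theorem Represents.unique {F : (ι → X) → ℂ} {v w : A} (hv : Represents L F v)
    (hw : Represents L F w) : v = w := tendsto_nhds_unique hv hw

theorem Represents.add {F F' : (ι → X) → ℂ} {v w : A} (hv : Represents L F v)
    (hw : Represents L F' w) : Represents L (F + F') (v + w) := by
  refine (Tendsto.add hv hw).congr fun N => ?_
  simp [approxVal, add_smul, Finset.sum_add_distrib]

theorem Represents.smul {F : (ι → X) → ℂ} {v : A} (c : ℂ) (hv : Represents L F v) :
    Represents L (c • F) (c • v) := by
  refine (Tendsto.const_smul hv c).congr fun N => ?_
  simp [approxVal, Finset.smul_sum, mul_smul]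

theorem Represents.sum {κ : Type*} {s : Finset κ} {F : κ → (ι → X) → ℂ} {v : κ → A}
    (hv : ∀ i ∈ s, Represents L (F i) (v i)) :
    Represents L (∑ i ∈ s, F i) (∑ i ∈ s, v i) := by
  refine (tendsto_finsetSum _ hv).congr fun N => ?_
  simp only [approxVal, Finset.sum_apply, Finset.sum_smul]
  rw [Finset.sum_comm]

variable (L) in
theorem approxVal_prod (N : ℕ) (e : ι → C(X, ℂ)) :
    approxVal L N (fun y => ∏ j, e j (y j)) = L (fun j => netApprox N (e j)) := by
  classical
  unfold approxVal netApprox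
  rw [ContinuousMultilinearMap.map_sum_finset]
  refine Finset.sum_congr (by congr!) fun y _ => ?_
  exact (L.toMultilinearMap.map_smul_univ (fun j => e j (y j)) (fun j => netBump N (y j))).symm

variable (L) in
/-- The extension of `L` has the expected value on elementary tensors. -/
theorem represents_prod (e : ι → C(X, ℂ)) :
    Represents L (fun y => ∏ j, e j (y j)) (L e) := by
  unfold Represents
  simp_rw [approxVal_prod]
  exact (L.cont.tendsto e).comp (tendsto_pi_nhds.2 fun j => tendsto_netApprox (e j))

theorem continuous_netApprox (N : ℕ) : Continuous (netApprox (X := X) N) := by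
  unfold netApprox
  refine continuous_finsetSum _ fun y _ => ?_
  exact (continuous_eval_const (F := C(X, ℂ)) y).smul continuous_const

/-- Integrals of elementary tensors: only the projective bound `∏ ‖e_j(t)‖` is used for dominated
convergence, while the function represented is the pointwise integral. -/
theorem represents_integral [CompleteSpace A] {T : Type*} [TopologicalSpace T] [MeasurableSpace T]
    [OpensMeasurableSpace T] [SecondCountableTopology T] {τ : Measure T} {w : T → ℂ}
    (hw : AEStronglyMeasurable w τ) {e : ι → T → C(X, ℂ)} (he : ∀ j, Continuous (e j))
    {D : T → ℝ} (hD : Integrable D τ) (hDe : ∀ᵐ t ∂τ, ‖w t‖ * ∏ j, ‖e j t‖ ≤ D t) :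
    Integrable (fun t => w t • L (fun j => e j t)) τ ∧
    Represents L (fun y => ∫ t, w t * ∏ j, e j t (y j) ∂τ)
      (∫ t, w t • L (fun j => e j t) ∂τ) := by
  have hmeas : ∀ f : ι → T → C(X, ℂ), (∀ j, Continuous (f j)) →
      AEStronglyMeasurable (fun t => w t • L (fun j => f j t)) τ := fun f hf =>
    hw.smul (L.cont.comp (continuous_pi hf)).aestronglyMeasurable
  have hbound : ∀ f : ι → T → C(X, ℂ), (∀ j t, ‖f j t‖ ≤ ‖e j t‖) →
      ∀ᵐ t ∂τ, ‖w t • L (fun j => f j t)‖ ≤ ‖L‖ * D t := by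
    intro f hf
    filter_upwards [hDe] with t ht
    rw [norm_smul]
    calc ‖w t‖ * ‖L fun j => f j t‖ ≤ ‖w t‖ * (‖L‖ * ∏ j, ‖e j t‖) := by
          gcongr
          refine (L.le_opNorm _).trans ?_
          gcongr with j
          exact hf j t
      _ = ‖L‖ * (‖w t‖ * ∏ j, ‖e j t‖) := by ring
      _ ≤ _ := by gcongr
  have hint : ∀ f : ι → T → C(X, ℂ), (∀ j, Continuous (f j)) → (∀ j t, ‖f j t‖ ≤ ‖e j t‖) →
      Integrable (fun t => w t • L (fun j => f j t)) τ := fun f hf hf' =>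
    (hD.const_mul ‖L‖).mono' (hmeas f hf) (hbound f hf')
  refine ⟨hint e he fun _ _ => le_rfl, ?_⟩
  have hlim : Tendsto (fun N => ∫ t, w t • L (fun j => netApprox N (e j t)) ∂τ) atTop
      (𝓝 (∫ t, w t • L (fun j => e j t) ∂τ)) := by
    refine tendsto_integral_of_dominated_convergence (fun t => ‖L‖ * D t)
      (fun N => hmeas _ fun j => (continuous_netApprox N).comp (he j)) (hD.const_mul _)
      (fun N => hbound _ fun j t => norm_netApprox_le N _) (ae_of_all _ fun t => ?_)
    exact Tendsto.const_smul ((L.cont.tendsto _).comp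
      (tendsto_pi_nhds.2 fun j => tendsto_netApprox (e j t))) _
  -- For fixed `N` the finite sum over net points commutes with the integral.
  refine hlim.congr fun N => ?_
  have hscal : ∀ y : ι → X, Integrable (fun t => w t * ∏ j, e j t (y j)) τ := by
    intro y
    refine hD.mono' (hw.mul (Continuous.aestronglyMeasurable ?_)) ?_
    · exact continuous_finsetProd _ fun j _ =>
        (continuous_eval_const (F := C(X, ℂ)) (y j)).comp (he j)
    · filter_upwards [hDe] with t ht
      refine le_trans ?_ ht
      rw [norm_mul, norm_prod]
      gcongr with j
      exact (e j t).norm_coe_le_norm _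
  simp_rw [← approxVal_prod, approxVal, Finset.smul_sum, ← mul_smul]
  rw [integral_finsetSum _ fun y _ => (hscal y).smul_const _]
  simp_rw [integral_smul_const]

end Represents

/-! ### Gelfand theory for a commuting self-adjoint tuple -/

section Gelfand

/-- In a commutative `C*`-algebra, continuous functions of a self-adjoint tuple are defined on the
compact set of values of the tuple under characters. -/
theorem exists_calculus_of_comm {B : Type*} [CommCStarAlgebra B] {ι : Type*} (a : ι → B)
    (ha : ∀ i, IsSelfAdjoint (a i)) :
    IsCompact {x : ι → ℝ | ∃ χ : B →ₐ[ℂ] ℂ, ∀ i, χ (a i) = (x i : ℂ)} ∧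
    ∃ Θ : C({x : ι → ℝ | ∃ χ : B →ₐ[ℂ] ℂ, ∀ i, χ (a i) = (x i : ℂ)}, ℂ) →⋆ₐ[ℂ] B,
      ∀ i, Θ ⟨fun x => ((x : ι → ℝ) i : ℂ), Complex.continuous_ofReal.comp
        ((continuous_apply i).comp continuous_subtype_val)⟩ = a i := by
  set M := {x : ι → ℝ | ∃ χ : B →ₐ[ℂ] ℂ, ∀ i, χ (a i) = (x i : ℂ)} with hM
  have hre : ∀ (χ : WeakDual.characterSpace ℂ B) i, χ (a i) = ((χ (a i)).re : ℂ) := by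
    intro χ i
    exact (Complex.conj_eq_iff_re.1 ((ha i).map χ)).symm
  let κ : WeakDual.characterSpace ℂ B → ι → ℝ := fun χ i => (χ (a i)).re
  have hκ : Continuous κ := by
    refine continuous_pi fun i => Complex.continuous_re.comp ?_
    exact map_continuous (gelfandStarTransform B (a i))
  have hr : Set.range κ = M := by
    ext x
    constructor
    · rintro ⟨χ, rfl⟩
      exact ⟨WeakDual.CharacterSpace.toAlgHom χ, fun i => hre χ i⟩
    · rintro ⟨χ, hχ⟩
      refine ⟨WeakDual.CharacterSpace.equivAlgHom.symm χ, funext fun i => ?_⟩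
      change (χ (a i)).re = x i
      rw [hχ i, Complex.ofReal_re]
  refine ⟨hr ▸ isCompact_range hκ, ?_⟩
  let κ' : C(WeakDual.characterSpace ℂ B, M) :=
    ⟨fun χ => ⟨κ χ, hr ▸ Set.mem_range_self χ⟩, by fun_prop⟩
  refine ⟨((gelfandStarTransform B).symm : _ →⋆ₐ[ℂ] B).comp
    (ContinuousMap.compStarAlgHom' ℂ ℂ κ'), fun i => ?_⟩
  change (gelfandStarTransform B).symm _ = a i
  rw [StarAlgEquiv.symm_apply_eq]
  ext χ
  exact (hre χ i).symm

variable {A : Type*} [CStarAlgebra A]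

/-- Continuous functional calculus for a commuting self-adjoint tuple on its joint spectrum, from
Gelfand theory for the commutative `C*`-algebra that the tuple generates. -/
theorem jointSpectrum_calculus {ι : Type*} (a : ι → A) (ha : ∀ i, IsSelfAdjoint (a i))
    (hc : ∀ i j, Commute (a i) (a j)) :
    IsCompact (jointSpectrum a) ∧ ∃ Θ : C(jointSpectrum a, ℂ) →⋆ₐ[ℂ] A,
      ∀ i, Θ ⟨fun x => ((x : ι → ℝ) i : ℂ), Complex.continuous_ofReal.comp
        ((continuous_apply i).comp continuous_subtype_val)⟩ = a i := by
  set S := StarAlgebra.adjoin ℂ (Set.range a) with hS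
  have hcl : IsClosed (S.topologicalClosure : Set A) := StarSubalgebra.isClosed_topologicalClosure _
  have hSc : ∀ x y : S, x * y = y * x := by
    have := StarAlgebra.isMulCommutative_adjoin ℂ (s := Set.range a)
      (by rintro _ ⟨i, rfl⟩ _ ⟨j, rfl⟩; exact hc i j)
      (by rintro _ ⟨i, rfl⟩ _ ⟨j, rfl⟩; rw [(ha j).star_eq]; exact hc i j)
    exact fun x y => this.is_comm.comm x y
  let _ : CStarAlgebra S.topologicalClosure := StarSubalgebra.cstarAlgebra _
  let _ : CommCStarAlgebra S.topologicalClosure :=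
    { (inferInstance : CStarAlgebra S.topologicalClosure) with
      mul_comm := (S.commRingTopologicalClosure hSc).mul_comm }
  let a' : ι → S.topologicalClosure := fun i => ⟨a i, StarSubalgebra.le_topologicalClosure _
      (StarAlgebra.subset_adjoin ℂ _ (Set.mem_range_self i))⟩
  obtain ⟨h1, Θ, hΘ⟩ := exists_calculus_of_comm a' fun i => Subtype.ext (ha i).star_eq
  exact ⟨h1, S.topologicalClosure.subtype.comp Θ, fun i => congrArg Subtype.val (hΘ i)⟩

/-- Characters of the generated subalgebra take values in spectra, and by spectral permanence these
may be computed in the whole algebra. -/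
theorem sum_mem_spectrum_of_mem_jointSpectrum {ι : Type*} [Fintype ι] {a : ι → A} {x : ι → ℝ}
    (hx : x ∈ jointSpectrum a) (c : ι → ℂ) : ∑ i, c i * x i ∈ spectrum ℂ (∑ i, c i • a i) := by
  obtain ⟨χ, hχ⟩ := hx
  let S := StarAlgebra.adjoin ℂ (Set.range a)
  let a' : ι → S.topologicalClosure := fun i => ⟨a i, StarSubalgebra.le_topologicalClosure _
      (StarAlgebra.subset_adjoin ℂ _ (Set.mem_range_self i))⟩
  have h := AlgHom.apply_mem_spectrum χ (∑ i, c i • a' i)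
  have h0 : ∀ i, χ (a' i) = x i := hχ
  rw [StarSubalgebra.spectrum_eq S.topologicalClosure
    (hS := StarSubalgebra.isClosed_topologicalClosure _)] at h
  have h1 : χ (∑ i, c i • a' i) = ∑ i, c i * x i := by
    rw [map_sum]
    exact Finset.sum_congr rfl fun i _ => by rw [map_smul, h0 i, smul_eq_mul]
  have h2 : ((∑ i, c i • a' i : S.topologicalClosure) : A) = ∑ i, c i • a i := by
    rw [AddSubmonoidClass.coe_finsetSum]; rfl
  rwa [h1, h2] at h

theorem eq_of_mem_jointSpectrum {ι : Type*} {a : ι → A} {x : ι → ℝ}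
    (hx : x ∈ jointSpectrum a) {i j : ι} (h : a i = a j) : x i = x j := by
  obtain ⟨χ, hχ⟩ := hx
  have := hχ i
  simp only [h] at this
  exact_mod_cast this.symm.trans (hχ j)

open scoped CStarAlgebra Matrix.Norms.Operator

/-- Ring homomorphisms between Banach algebras act entrywise on matrix exponentials. -/
theorem map_matrix_exp {m : ℕ} {B C : Type*} [NormedRing B] [NormedAlgebra ℂ B] [CompleteSpace B]
    [NormedRing C] [NormedAlgebra ℂ C] (f : B →+* C) (hf : Continuous f)
    (x : Matrix (Fin m) (Fin m) B) (s t : Fin m) :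
    f (NormedSpace.exp x s t) = NormedSpace.exp (x.map f) s t := by
  let _ : NormedAlgebra ℚ B := NormedAlgebra.restrictScalars ℚ ℂ B
  let _ : NormedAlgebra ℚ C := NormedAlgebra.restrictScalars ℚ ℂ C
  have : CompleteSpace (Matrix (Fin m) (Fin m) B) :=
    inferInstanceAs (CompleteSpace (Fin m → Fin m → B))
  have h := @NormedSpace.map_exp (Matrix (Fin m) (Fin m) B) (Matrix (Fin m) (Fin m) C)
    _ _ this _ _ _ _ _ (f.mapMatrix (m := Fin m))
    (continuous_matrix fun i j => hf.comp (continuous_id.matrix_elem i j)) x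
  exact congrFun (congrFun h s) t

/-- `exp S = exp(S/2)ᵀ exp(S/2)` with `exp(S/2)` invertible. -/
theorem posDef_exp {m : ℕ} {S : Matrix (Fin m) (Fin m) ℝ} (hS : S.IsSymm) :
    (NormedSpace.exp S).PosDef := by
  have h2 : NormedSpace.exp S = (NormedSpace.exp ((1 / 2 : ℝ) • S)).conjTranspose *
      NormedSpace.exp ((1 / 2 : ℝ) • S) := by
    rw [Matrix.conjTranspose_eq_transpose_of_trivial, ← Matrix.exp_transpose,
      Matrix.transpose_smul, hS.eq, ← Matrix.exp_add_of_commute _ _ (Commute.refl _), ← add_smul]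
    norm_num
  rw [h2]
  refine Matrix.PosDef.conjTranspose_mul_self _ ?_
  exact Matrix.mulVec_injective_of_isUnit (Matrix.isUnit_exp _)

/-- The exponential of a symmetric matrix with commuting self-adjoint entries again has such
entries, and the values of these entries under characters form positive definite matrices. -/
theorem exp_matrix_spec {m : ℕ} (h : Matrix (Fin m) (Fin m) A) (hsym : ∀ s t, h s t = h t s)
    (hsa : ∀ s t, IsSelfAdjoint (h s t)) (hc : ∀ s t s' t', Commute (h s t) (h s' t')) :
    (∀ s t, IsSelfAdjoint ((NormedSpace.exp h) s t)) ∧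
    (∀ s t s' t', Commute ((NormedSpace.exp h) s t) ((NormedSpace.exp h) s' t')) ∧
    (∀ x ∈ jointSpectrum (entries (NormedSpace.exp h)),
      (Matrix.of fun s t => x (s, t)).PosDef) := by
  obtain ⟨hM, Θ, hΘ⟩ := jointSpectrum_calculus (entries h) (fun i => hsa _ _) fun i j => hc _ _ _ _
  let M := jointSpectrum (entries h)
  have : CompactSpace M := isCompact_iff_compactSpace.1 hM
  have hΘc : Continuous Θ := map_continuous Θ
  let R : M → Matrix (Fin m) (Fin m) ℝ := fun x =>
    Matrix.of fun s t => (x : Fin m × Fin m → ℝ) (s, t)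
  have hRs : ∀ x, (R x).IsSymm := fun x => by
    ext s t
    exact eq_of_mem_jointSpectrum x.2 (hsym t s)
  let H : Matrix (Fin m) (Fin m) C(M, ℂ) := fun s t =>
    ⟨fun x => ((x : Fin m × Fin m → ℝ) (s, t) : ℂ), Complex.continuous_ofReal.comp
      ((continuous_apply (s, t)).comp continuous_subtype_val)⟩
  have hE : ∀ s t, NormedSpace.exp h s t = Θ (NormedSpace.exp H s t) := by
    intro s t
    have h1 := map_matrix_exp (Θ : C(M, ℂ) →+* A) hΘc H s t
    have h2 : H.map (Θ : C(M, ℂ) →+* A) = h := by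
      ext s t
      exact hΘ (s, t)
    rw [h2] at h1
    exact h1.symm
  have hEx : ∀ s t x, NormedSpace.exp H s t x = ((NormedSpace.exp (R x) s t : ℝ) : ℂ) := by
    intro s t x
    have h1 := map_matrix_exp (ContinuousMap.evalStarAlgHom ℂ ℂ x : C(M, ℂ) →+* ℂ)
      (continuous_eval_const x) H s t
    let _ : NormedAlgebra ℚ ℝ := NormedAlgebra.restrictScalars ℚ ℝ ℝ
    have h2 := NormedSpace.map_exp (Complex.ofRealHom.mapMatrix (m := Fin m))
      (continuous_matrix fun i j => Complex.continuous_ofReal.comp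
        (continuous_id.matrix_elem i j)) (R x)
    exact h1.trans (congrFun (congrFun h2 s) t).symm
  have hstar : ∀ s t, star (NormedSpace.exp H s t) = NormedSpace.exp H s t := by
    intro s t
    ext x
    rw [ContinuousMap.star_apply, hEx]
    exact Complex.conj_ofReal _
  refine ⟨fun s t => ?_, fun s t s' t' => ?_, fun x hx => ?_⟩
  · rw [hE, IsSelfAdjoint, ← map_star, hstar]
  · rw [hE, hE]
    exact (Commute.all _ _).map Θ
  -- The element `∑ v_s v_t (exp h)_{st}` is `Θ` of the function `y ↦ v ⬝ exp(y) v`, so that the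
  -- numbers in its spectrum are values of this function.
  · have hpos : ∀ v : Fin m → ℝ, v ≠ 0 → 0 < ∑ p : Fin m × Fin m, v p.1 * v p.2 * x p := by
      intro v hv
      have h1 := sum_mem_spectrum_of_mem_jointSpectrum hx
        (fun p : Fin m × Fin m => ((v p.1 * v p.2 : ℝ) : ℂ))
      have h2 : ∑ p : Fin m × Fin m, ((v p.1 * v p.2 : ℝ) : ℂ) • entries (NormedSpace.exp h) p =
          Θ (∑ p : Fin m × Fin m, ((v p.1 * v p.2 : ℝ) : ℂ) • NormedSpace.exp H p.1 p.2) := by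
        rw [map_sum]
        exact Finset.sum_congr rfl fun p _ => by rw [map_smul, entries, hE]
      rw [h2] at h1
      have h3 := AlgHom.spectrum_apply_subset Θ _ h1
      rw [ContinuousMap.spectrum_eq_range] at h3
      obtain ⟨y, hy⟩ := h3
      have h4 := (posDef_exp (hRs y)).dotProduct_mulVec_pos hv
      have h5 : ∑ p : Fin m × Fin m, v p.1 * v p.2 * x p =
          dotProduct (star v) (Matrix.mulVec (NormedSpace.exp (R y)) v) := by
        simp only [ContinuousMap.sum_apply, ContinuousMap.smul_apply, hEx, smul_eq_mul] at hy
        have hy' : ∑ p : Fin m × Fin m, v p.1 * v p.2 * NormedSpace.exp (R y) p.1 p.2 =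
          ∑ p : Fin m × Fin m, v p.1 * v p.2 * x p := by exact_mod_cast hy
        rw [← hy', Fintype.sum_prod_type]
        simp only [dotProduct, Matrix.mulVec, Finset.mul_sum, star_trivial]
        exact Finset.sum_congr rfl fun s _ => Finset.sum_congr rfl fun t _ => by ring
      rw [h5]
      exact h4
    refine Matrix.PosDef.of_dotProduct_mulVec_pos ?_ fun v hv => ?_
    · ext s t
      refine eq_of_mem_jointSpectrum hx ?_
      simp only [entries]
      rw [hE, hE]
      congr 1
      ext y
      rw [hEx, hEx]
      congr 1
      exact congrFun (congrFun (hRs y).exp s) t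
    · refine lt_of_lt_of_eq (hpos v hv) ?_
      rw [Fintype.sum_prod_type]
      simp only [dotProduct, Matrix.mulVec, Finset.mul_sum, star_trivial, Matrix.of_apply]
      exact Finset.sum_congr rfl fun s _ => Finset.sum_congr rfl fun t _ => by ring

end Gelfand

/-! ### Dirichlet integrals over the simplex -/

section Simplex

theorem integrableOn_rpow_mul_cexp {a : ℝ} (ha : 0 < a) {w : ℂ} (hw : 0 < w.re) :
    IntegrableOn (fun t : ℝ => ((t ^ (a - 1) : ℝ) : ℂ) * Complex.exp (-(w * t))) (Set.Ioi 0) := by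
  have h := integrableOn_rpow_mul_exp_neg_mul_rpow (s := a - 1) (p := 1) (b := w.re) (by linarith)
    zero_lt_one hw
  refine Integrable.mono' h ?_ ?_
  · refine ContinuousOn.aestronglyMeasurable (fun t ht => ContinuousAt.continuousWithinAt ?_)
      measurableSet_Ioi
    have : ContinuousAt (fun t : ℝ => t ^ (a - 1)) t :=
      Real.continuousAt_rpow_const _ _ (Or.inl (ne_of_gt ht))
    fun_prop
  · refine (ae_restrict_mem measurableSet_Ioi).mono fun t ht => ?_
    rw [norm_mul, Complex.norm_real, Complex.norm_exp, Real.norm_of_nonneg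
      (Real.rpow_nonneg (le_of_lt ht) _), Real.rpow_one]
    simp

/-- The Gamma integral with a complex rate, by analytic continuation from positive rates. -/
theorem integral_rpow_mul_cexp {a : ℝ} (ha : 0 < a) {w : ℂ} (hw : 0 < w.re) :
    ∫ t in Set.Ioi (0 : ℝ), ((t ^ (a - 1) : ℝ) : ℂ) * Complex.exp (-(w * t)) =
      Real.Gamma a * w ^ (-a : ℂ) := by
  set f : ℂ → ℂ := fun w =>
    ∫ t in Set.Ioi (0 : ℝ), ((t ^ (a - 1) : ℝ) : ℂ) * Complex.exp (-(w * t)) with hf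
  set U : Set ℂ := {w | 0 < w.re} with hU
  have hUo : IsOpen U := isOpen_lt continuous_const Complex.continuous_re
  have hfd : DifferentiableOn ℂ f U := by
    intro w₀ hw₀
    have hw₀' : 0 < w₀.re := hw₀
    set s : Set ℂ := {w | w₀.re / 2 < w.re} with hs
    have hso : s ∈ 𝓝 w₀ := (isOpen_lt continuous_const Complex.continuous_re).mem_nhds
      (show w₀.re / 2 < w₀.re by linarith)
    have hd := hasDerivAt_integral_of_dominated_loc_of_deriv_le (𝕜 := ℂ)
      (μ := volume.restrict (Set.Ioi (0 : ℝ)))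
      (F := fun w t => ((t ^ (a - 1) : ℝ) : ℂ) * Complex.exp (-(w * t)))
      (F' := fun w t => ((t ^ (a - 1) : ℝ) : ℂ) * (Complex.exp (-(w * t)) * -(t : ℂ)))
      (bound := fun t => t ^ a * Real.exp (-(w₀.re / 2) * t ^ (1 : ℝ))) (x₀ := w₀) hso
      ?_ (integrableOn_rpow_mul_cexp ha hw₀) ?_ ?_ ?_ ?_
    · exact hd.2.differentiableAt.differentiableWithinAt
    · filter_upwards [hUo.mem_nhds hw₀] with w hw
      exact (integrableOn_rpow_mul_cexp ha hw).aestronglyMeasurable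
    · refine ((integrableOn_rpow_mul_cexp ha hw₀).aestronglyMeasurable.mul
        (Complex.continuous_ofReal.neg.aestronglyMeasurable)).congr (ae_of_all _ fun t => ?_)
      simp [mul_assoc]
    · refine (ae_restrict_mem measurableSet_Ioi).mono fun t ht w hw => ?_
      have ht' : 0 < t := ht
      have hw' : w₀.re / 2 < w.re := hw
      rw [norm_mul, norm_mul, Complex.norm_real, Complex.norm_exp, norm_neg, Complex.norm_real,
        Real.norm_of_nonneg (Real.rpow_nonneg ht'.le _), Real.norm_of_nonneg ht'.le, Real.rpow_one,
        mul_comm (Real.exp _), ← mul_assoc, Real.rpow_sub_one ht'.ne', div_mul_cancel₀ _ ht'.ne']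
      gcongr
      simp
      nlinarith
    · exact integrableOn_rpow_mul_exp_neg_mul_rpow (by linarith) zero_lt_one (half_pos hw₀')
    · refine ae_of_all _ fun t w _ => ?_
      refine HasDerivAt.const_mul _ ((HasDerivAt.cexp ?_))
      simpa only [one_mul] using! ((hasDerivAt_id w).mul_const (t : ℂ)).neg
  have hgd : DifferentiableOn ℂ (fun w : ℂ => Real.Gamma a * w ^ (-a : ℂ)) U := by
    intro w hw
    exact (DifferentiableAt.const_mul (differentiableAt_id.cpow_const (Or.inl hw))
      _).differentiableWithinAt
  have hUc : IsPreconnected U := (convex_halfSpace_re_gt 0).isPreconnected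
  have key := (hfd.analyticOnNhd hUo).eqOn_of_preconnected_of_frequently_eq
    (hgd.analyticOnNhd hUo) hUc (z₀ := 1) (by simp [U]) ?_
  · exact key hw
  · have hreal : ∀ r : ℝ, 0 < r → f r = Real.Gamma a * (r : ℂ) ^ (-a : ℂ) := by
      intro r hr
      have h := Complex.integral_cpow_mul_exp_neg_mul_Ioi (a := a) (r := r) (by simpa) hr
      rw [Complex.Gamma_ofReal, one_div, Complex.inv_cpow _ _ (by
        rw [Complex.arg_ofReal_of_nonneg hr.le]; exact Real.pi_pos.ne), ← Complex.cpow_neg,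
        mul_comm] at h
      rw [← h]
      refine setIntegral_congr_fun measurableSet_Ioi fun t ht => ?_
      rw [Complex.ofReal_cpow (le_of_lt ht)]
      push_cast
      rfl
    have hseq : Tendsto (fun k : ℕ => ((1 + 1 / ((k : ℝ) + 1) : ℝ) : ℂ)) atTop (𝓝[≠] 1) := by
      refine tendsto_nhdsWithin_iff.2 ⟨?_, Eventually.of_forall fun k => ?_⟩
      · have := (tendsto_one_div_add_atTop_nhds_zero_nat (𝕜 := ℝ)).const_add 1
        rw [add_zero] at this
        exact_mod_cast (Complex.continuous_ofReal.tendsto _).comp this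
      · intro h
        have h1 : (1 + 1 / ((k : ℝ) + 1) : ℝ) = 1 := Complex.ofReal_injective (h.trans Complex.ofReal_one.symm)
        have : (0 : ℝ) < 1 / ((k : ℝ) + 1) := by positivity
        linarith
    exact hseq.frequently (Eventually.of_forall fun k => hreal _ (by positivity)).frequently

/-- Barycentric coordinates `(1 - ∑ u_l, u_1, …, u_n)`. -/
def bary {n : ℕ} (u : Fin n → ℝ) : Fin (n + 1) → ℝ := Fin.cons (1 - ∑ l, u l) u

theorem continuous_bary {n : ℕ} : Continuous (bary (n := n)) := by
  refine continuous_pi fun j => ?_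
  refine Fin.cases ?_ (fun l => ?_) j <;> simp only [bary, Fin.cons_zero, Fin.cons_succ] <;> fun_prop

theorem mem_simplex_iff {n : ℕ} {u : Fin n → ℝ} : u ∈ simplex n ↔ ∀ j, 0 ≤ bary u j := by
  rw [Fin.forall_fin_succ]
  simp [simplex, bary, and_comm]

theorem sum_bary {n : ℕ} (u : Fin n → ℝ) : ∑ j, bary u j = 1 := by
  simp [bary, Fin.sum_univ_succ]

theorem isClosed_simplex (n : ℕ) : IsClosed (simplex n) := by
  have : simplex n = ⋂ j, {u | 0 ≤ bary u j} := by
    ext u; simp [mem_simplex_iff]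
  rw [this]
  exact isClosed_iInter fun j =>
    isClosed_le continuous_const ((continuous_apply j).comp continuous_bary)

theorem isCompact_simplex (n : ℕ) : IsCompact (simplex n) := by
  refine (isCompact_Icc (a := (0 : Fin n → ℝ)) (b := 1)).of_isClosed_subset (isClosed_simplex n) ?_
  rintro u ⟨h0, h1⟩
  exact ⟨h0, fun l => (Finset.single_le_sum (fun i _ => h0 i) (Finset.mem_univ l)).trans h1⟩

theorem omega_eq {n : ℕ} (α : Fin (n + 1) → ℝ) (u : Fin n → ℝ) :
    omega α u = (∏ j, Real.Gamma (α j))⁻¹ * ∏ j, bary u j ^ (α j - 1) := by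
  rw [omega, Fin.prod_univ_succ (fun j => bary u j ^ (α j - 1)), ← mul_assoc]
  rfl

/-- Sum-and-tail coordinates on `ℝ^{n+1}`: the map `(s, t) ↦ (t - ∑ s_l, s_1, …, s_n)` preserves
Lebesgue measure. -/
theorem measurePreserving_cons_sub_sum (n : ℕ) :
    MeasurePreserving (fun p : (Fin n → ℝ) × ℝ =>
      (Fin.cons (p.2 - ∑ l, p.1 l) p.1 : Fin (n + 1) → ℝ)) := by
  have h1 : MeasurePreserving (fun p : (Fin n → ℝ) × ℝ => (p.1, p.2 - ∑ l, p.1 l)) := by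
    refine MeasurePreserving.skew_product (μa := volume) (μc := volume) (μd := volume)
      (MeasurePreserving.id _) (g := fun (s : Fin n → ℝ) (x : ℝ) => x - ∑ l, s l) ?_ ?_
    · change Measurable fun p : (Fin n → ℝ) × ℝ => p.2 - ∑ l, p.1 l
      fun_prop
    · exact ae_of_all _ fun s => (measurePreserving_sub_right volume _).map_eq
  have h2 := (volume_preserving_piFinSuccAbove (fun _ : Fin (n + 1) => ℝ) 0).symm
  have h3 := h2.comp (Measure.measurePreserving_swap.comp h1)
  convert h3 using 1
  funext p
  simp [Fin.insertNthEquiv]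

/-- Integration over the positive orthant in the coordinates `s = t (1 - ∑ u_l, u)`. -/
theorem integral_eq_integral_simplex {n : ℕ} {F : (Fin (n + 1) → ℝ) → ℂ} (hF : Integrable F)
    (h0 : ∀ s, (∃ j, s j < 0) → F s = 0) :
    (∀ᵐ t : ℝ, 0 < t → Integrable fun u : Fin n → ℝ => F (fun j => t * bary u j)) ∧
    ∫ s, F s = ∫ t in Set.Ioi (0 : ℝ), (t : ℂ) ^ n * ∫ u : Fin n → ℝ, F (fun j => t * bary u j) := by
  have hT := measurePreserving_cons_sub_sum n
  have hcoord : ∀ (t : ℝ) (u : Fin n → ℝ),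
      (Fin.cons (t - ∑ l, (t • u) l) (t • u) : Fin (n + 1) → ℝ) = fun j => t * bary u j := by
    intro t u
    funext j
    refine Fin.cases ?_ (fun l => ?_) j
    · simp [bary, ← Finset.mul_sum, mul_sub]
    · simp [bary]
  have hi := (hT.integrable_comp hF.aestronglyMeasurable).2 hF
  have hi' := hi.swap
  constructor
  · filter_upwards [hi'.prod_right_ae] with t ht h0t
    have := (integrable_comp_smul_iff volume _ h0t.ne').2 ht
    refine this.congr (ae_of_all _ fun u => ?_)
    simp only [Function.comp, Prod.swap_prod_mk]
    rw [hcoord]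
  · rw [← hT.map_eq, integral_map hT.measurable.aemeasurable
      (hT.map_eq.symm ▸ hF.aestronglyMeasurable)]
    rw [Measure.volume_eq_prod]
    refine (integral_prod_symm _ hi).trans ?_
    rw [← integral_indicator measurableSet_Ioi]
    refine integral_congr_ae ?_
    have hne : ∀ᵐ t : ℝ, t ≠ 0 := by simp [ae_iff, measure_singleton]
    filter_upwards [hne] with t ht
    rcases lt_or_gt_of_ne ht with hneg | hpos
    · rw [Set.indicator_of_notMem (by simpa using hneg.le)]
      refine integral_eq_zero_of_ae (ae_of_all _ fun s => h0 _ ?_)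
      by_contra! hall
      have h1 := Finset.sum_nonneg fun j (_ : j ∈ Finset.univ) => hall j
      rw [Fin.sum_univ_succ] at h1
      simp at h1
      linarith
    · rw [Set.indicator_of_mem (by simpa using hpos)]
      have h1 := Measure.integral_comp_smul_of_nonneg (volume : Measure (Fin n → ℝ))
        (fun s => F (Fin.cons (t - ∑ l, s l) s)) t (hR := hpos.le)
      simp only [hcoord] at h1
      rw [h1]
      simp only [Module.finrank_fintype_fun_eq_card, Fintype.card_fin, Complex.real_smul]
      push_cast
      exact (mul_inv_cancel_left₀ (pow_ne_zero _ (by exact_mod_cast ht)) _).symm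

/-- The integrand of the Gamma integral with rate `w`, extended by zero to negative `t`. -/
def gammaIntegrand (a : ℝ) (w : ℂ) : ℝ → ℂ :=
  (Set.Ici 0).indicator fun t => ((t ^ (a - 1) : ℝ) : ℂ) * Complex.exp (-(w * t))

theorem integrable_gammaIntegrand {a : ℝ} (ha : 0 < a) {w : ℂ} (hw : 0 < w.re) :
    Integrable (gammaIntegrand a w) := by
  unfold gammaIntegrand
  rw [integrable_indicator_iff measurableSet_Ici, integrableOn_Ici_iff_integrableOn_Ioi]
  exact integrableOn_rpow_mul_cexp ha hw

theorem integral_gammaIntegrand {a : ℝ} (ha : 0 < a) {w : ℂ} (hw : 0 < w.re) :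
    ∫ t, gammaIntegrand a w t = Real.Gamma a * w ^ (-a : ℂ) := by
  unfold gammaIntegrand
  rw [integral_indicator measurableSet_Ici, integral_Ici_eq_integral_Ioi]
  exact integral_rpow_mul_cexp ha hw

/-- On the ray through a point of the simplex, the product of Gamma integrands is `ω_α` times an
exponential. -/
theorem prod_gammaIntegrand {n : ℕ} {α : Fin (n + 1) → ℝ} (hα : ∀ j, 0 < α j)
    (w : Fin (n + 1) → ℂ) {t : ℝ} (ht : 0 < t) (u : Fin n → ℝ) :
    ∏ j, gammaIntegrand (α j) (w j) (t * bary u j) =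
      (simplex n).indicator (fun u => ((t ^ (∑ j, (α j - 1)) * ∏ j, Real.Gamma (α j) : ℝ) : ℂ) *
        ((omega α u : ℂ) * Complex.exp (-(t * ∑ j, bary u j * w j)))) u := by
  by_cases hu : u ∈ simplex n
  · have hu' := mem_simplex_iff.1 hu
    have hG : (∏ j, Real.Gamma (α j)) ≠ 0 :=
      Finset.prod_ne_zero_iff.2 fun j _ => (Real.Gamma_pos_of_pos (hα j)).ne'
    have h1 : ∀ j, gammaIntegrand (α j) (w j) (t * bary u j) =
        ((t ^ (α j - 1) * bary u j ^ (α j - 1) : ℝ) : ℂ) *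
          Complex.exp (-(t * (bary u j * w j))) := by
      intro j
      rw [gammaIntegrand, Set.indicator_of_mem (by exact mul_nonneg ht.le (hu' j)),
        Real.mul_rpow ht.le (hu' j)]
      congr 2
      push_cast
      ring
    rw [Set.indicator_of_mem hu, Finset.prod_congr rfl fun j _ => h1 j, Finset.prod_mul_distrib,
      ← Complex.exp_sum, Finset.sum_neg_distrib, ← Finset.mul_sum, ← mul_assoc,
      ← Complex.ofReal_mul, ← Complex.ofReal_prod, Finset.prod_mul_distrib, omega_eq]
    congr 2
    rw [Real.rpow_sum_of_pos ht]
    field_simp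
  · rw [Set.indicator_of_notMem hu]
    rw [mem_simplex_iff] at hu
    push Not at hu
    obtain ⟨j, hj⟩ := hu
    refine Finset.prod_eq_zero (Finset.mem_univ j) (Set.indicator_of_notMem ?_ _)
    simpa using mul_neg_of_pos_of_neg ht hj

theorem integrable_prod_gammaIntegrand {n : ℕ} {α : Fin (n + 1) → ℝ} (hα : ∀ j, 0 < α j)
    {w : Fin (n + 1) → ℂ} (hw : ∀ j, 0 < (w j).re) :
    Integrable (fun s : Fin (n + 1) → ℝ => ∏ j, gammaIntegrand (α j) (w j) (s j)) :=
  Integrable.fintype_prod fun j => integrable_gammaIntegrand (hα j) (hw j)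

theorem prod_gammaIntegrand_of_neg {n : ℕ} (α : Fin (n + 1) → ℝ) (w : Fin (n + 1) → ℂ)
    (s : Fin (n + 1) → ℝ) (hs : ∃ j, s j < 0) : ∏ j, gammaIntegrand (α j) (w j) (s j) = 0 := by
  obtain ⟨j, hj⟩ := hs
  exact Finset.prod_eq_zero (Finset.mem_univ j) (Set.indicator_of_notMem (by simpa using hj) _)

/-- Fubini applied to a product of Gamma integrands gives the integrability of one slice, which is a
multiple of `ω_α`. -/
theorem integrableOn_omega {n : ℕ} {α : Fin (n + 1) → ℝ} (hα : ∀ j, 0 < α j) :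
    IntegrableOn (fun u => (omega α u : ℂ)) (simplex n) := by
  have h := (integral_eq_integral_simplex
    (integrable_prod_gammaIntegrand hα (w := fun _ => 1) fun _ => by simp)
    (prod_gammaIntegrand_of_neg α _)).1
  have h2 := (ae_restrict_iff' (measurableSet_Ioi (a := (0 : ℝ)))).2 h
  have : NeBot (ae (volume.restrict (Set.Ioi (0 : ℝ)))) := by
    rw [ae_neBot, Ne, Measure.restrict_eq_zero, Real.volume_Ioi]
    simp
  obtain ⟨t, ht, ht0⟩ := (h2.and (ae_restrict_mem measurableSet_Ioi)).exists
  have ht0' : 0 < t := ht0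
  simp_rw [prod_gammaIntegrand hα _ ht0'] at ht
  rw [integrable_indicator_iff (isClosed_simplex n).measurableSet] at ht
  have hc : ((t ^ (∑ j, (α j - 1)) * ∏ j, Real.Gamma (α j) : ℝ) : ℂ) * Complex.exp (-t) ≠ 0 := by
    refine mul_ne_zero (Complex.ofReal_ne_zero.2 (mul_pos (Real.rpow_pos_of_pos ht0' _)
      (Finset.prod_pos fun j _ => Real.Gamma_pos_of_pos (hα j))).ne') (Complex.exp_ne_zero _)
  have h3 := ht.const_mul
    (((t ^ (∑ j, (α j - 1)) * ∏ j, Real.Gamma (α j) : ℝ) : ℂ) * Complex.exp (-t))⁻¹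
  refine IntegrableOn.congr_fun h3 (fun u _ => ?_) (isClosed_simplex n).measurableSet
  simp only [mul_one, ← Complex.ofReal_sum, sum_bary, Complex.ofReal_one]
  have hcancel : ∀ K o e : ℂ, K * e ≠ 0 → (K * e)⁻¹ * (K * (o * e)) = o := fun K o e h => by
    rw [mul_left_comm K, mul_left_comm, inv_mul_cancel₀ h, mul_one]
  exact hcancel _ _ _ hc

/-- A product of complex powers as a Laplace transform of a Dirichlet integral. -/
theorem prod_cpow_eq_integral {n : ℕ} {α : Fin (n + 1) → ℝ} (hα : ∀ j, 0 < α j)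
    {w : Fin (n + 1) → ℂ} (hw : ∀ j, 0 < (w j).re) :
    ∏ j, w j ^ (-α j : ℂ) = ∫ t in Set.Ioi (0 : ℝ), ((t ^ (∑ j, α j - 1) : ℝ) : ℂ) *
      ∫ u in simplex n, (omega α u : ℂ) * Complex.exp (-(t * ∑ j, bary u j * w j)) := by
  have h := (integral_eq_integral_simplex (integrable_prod_gammaIntegrand hα hw)
    (prod_gammaIntegrand_of_neg α _)).2
  have hG : ((∏ j, Real.Gamma (α j) : ℝ) : ℂ) ≠ 0 := Complex.ofReal_ne_zero.2
    (Finset.prod_ne_zero_iff.2 fun j _ => (Real.Gamma_pos_of_pos (hα j)).ne')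
  rw [integral_fintype_prod_volume_eq_prod (fun j => gammaIntegrand (α j) (w j)),
    Finset.prod_congr rfl fun j _ => integral_gammaIntegrand (hα j) (hw j),
    Finset.prod_mul_distrib, ← Complex.ofReal_prod] at h
  refine mul_left_cancel₀ hG (h.trans ?_)
  rw [← integral_const_mul]
  refine setIntegral_congr_fun measurableSet_Ioi fun t ht => ?_
  have ht' : 0 < t := ht
  simp only [prod_gammaIntegrand hα _ ht']
  rw [integral_indicator (isClosed_simplex n).measurableSet, integral_const_mul, ← mul_assoc,
    ← mul_assoc]
  congr 1
  rw [Complex.ofReal_mul, mul_comm _ (((∏ j, Real.Gamma (α j) : ℝ) : ℂ)), mul_left_comm,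
    ← Complex.ofReal_pow, ← Complex.ofReal_mul, ← Real.rpow_natCast t n, ← Real.rpow_add ht']
  congr 3
  rw [Finset.sum_sub_distrib]
  simp only [Finset.sum_const, Finset.card_univ, Fintype.card_fin, nsmul_eq_mul]
  push_cast
  ring

end Simplex

/-! ### Products of powers and their integrals along the imaginary axis -/

section AxisIntegral

theorem sub_I_mul_mem_slitPlane {q : ℝ} (hq : 0 < q) (x : ℝ) :
    (q - I * x : ℂ) ∈ Complex.slitPlane := Or.inl (by simpa using hq)

theorem norm_sub_I_mul_cpow (q a x : ℝ) :
    ‖(q - I * x : ℂ) ^ (-a : ℂ)‖ = (q ^ 2 + x ^ 2) ^ (-a / 2) := by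
  rw [← Complex.ofReal_neg, Complex.norm_cpow_real, Complex.norm_eq_sqrt_sq_add_sq,
    Real.sqrt_eq_rpow, ← Real.rpow_mul (by positivity)]
  simp
  congr 1
  ring

theorem integrable_add_sq_rpow {c a : ℝ} (hc : 0 < c) (ha : 1 < a) :
    Integrable fun x : ℝ => (c ^ 2 + x ^ 2) ^ (-a / 2) := by
  have h := (integrable_rpow_neg_one_add_norm_sq (E := ℝ) (μ := volume) (r := a)
    (by simpa using ha)).comp_mul_left' (inv_ne_zero hc.ne') |>.const_mul ((c ^ 2) ^ (-a / 2))
  refine h.congr (ae_of_all _ fun x => ?_)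
  simp only
  rw [← Real.mul_rpow (by positivity) (by positivity)]
  congr 1
  simp only [norm_mul, norm_inv, Real.norm_eq_abs, mul_pow, inv_pow, sq_abs]
  field_simp

theorem le_sum_bary_mul {n : ℕ} {q : Fin (n + 1) → ℝ} {c : ℝ} (hq : ∀ j, c ≤ q j)
    {u : Fin n → ℝ} (hu : u ∈ simplex n) : c ≤ ∑ j, bary u j * q j := by
  calc c = ∑ j, bary u j * c := by rw [← Finset.sum_mul, sum_bary, one_mul]
    _ ≤ _ := Finset.sum_le_sum fun j _ =>
      mul_le_mul_of_nonneg_left (hq j) (mem_simplex_iff.1 hu j)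

/-- Fourier inversion for the product of resolvent powers on the imaginary axis, in the absolutely
convergent range. -/
theorem integral_exp_mul_prod_cpow {n : ℕ} {α : Fin (n + 1) → ℝ} (hα : ∀ j, 0 < α j)
    (hα1 : 1 < ∑ j, α j) {q : Fin (n + 1) → ℝ} {c : ℝ} (hc : 0 < c) (hq : ∀ j, c ≤ q j) :
    ∫ x : ℝ, Complex.exp (-(I * x)) * ∏ j, (q j - I * x : ℂ) ^ (-α j : ℂ) =
      2 * Real.pi * ∫ u in simplex n, (omega α u : ℂ) *
        Complex.exp (-(∑ j, bary u j * q j : ℝ)) := by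
  have hq0 : ∀ j, 0 < q j := fun j => hc.trans_le (hq j)
  have hms := (isClosed_simplex n).measurableSet
  have hω := integrableOn_omega hα
  -- `μ(t) = t^{|α| - 1} D(t)` on `t > 0` has the product of powers as its Fourier transform, and
  -- the right-hand side is `2π μ(1)`.
  let D : ℝ → ℂ := fun t =>
    ∫ u in simplex n, (omega α u : ℂ) * Complex.exp (-(t * ∑ j, bary u j * q j : ℝ))
  have hbary : Continuous fun u : Fin n → ℝ => ∑ j, bary u j * q j :=
    continuous_finsetSum _ fun j _ => ((continuous_apply j).comp continuous_bary).mul_const _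
  have hDm : ∀ t : ℝ, AEStronglyMeasurable (fun u => (omega α u : ℂ) *
      Complex.exp (-(t * ∑ j, bary u j * q j : ℝ))) (volume.restrict (simplex n)) := fun t =>
    hω.aestronglyMeasurable.mul (Continuous.aestronglyMeasurable (by fun_prop))
  have hDb : ∀ t : ℝ, 0 ≤ t → ∀ᵐ u ∂(volume.restrict (simplex n)), ‖(omega α u : ℂ) *
      Complex.exp (-(t * ∑ j, bary u j * q j : ℝ))‖ ≤ ‖(omega α u : ℂ)‖ * Real.exp (-(t * c)) := by
    intro t ht
    refine (ae_restrict_mem hms).mono fun u hu => ?_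
    rw [norm_mul, ← Complex.ofReal_neg, ← Complex.ofReal_exp, Complex.norm_real (Real.exp _),
      Real.norm_of_nonneg (Real.exp_pos _).le]
    gcongr
    exact le_sum_bary_mul hq hu
  have hD1 : ContinuousAt D 1 := by
    refine continuousAt_of_dominated (bound := fun u => ‖(omega α u : ℂ)‖)
      (Eventually.of_forall hDm) ?_ hω.norm (ae_of_all _ fun u => ?_)
    · filter_upwards [lt_mem_nhds (zero_lt_one (α := ℝ))] with t ht
      filter_upwards [hDb t ht.le] with u hu
      refine hu.trans (mul_le_of_le_one_right (norm_nonneg _) (Real.exp_le_one_iff.2 ?_))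
      simp only [Left.neg_nonpos_iff]
      positivity
    · fun_prop
  have hDle : ∀ t : ℝ, 0 ≤ t → ‖D t‖ ≤ (∫ u in simplex n, ‖(omega α u : ℂ)‖) *
      Real.exp (-(t * c)) := fun t ht => by
    rw [← integral_mul_const]
    exact norm_integral_le_of_norm_le (hω.norm.mul_const _) (hDb t ht)
  let μ : ℝ → ℂ := (Set.Ioi 0).indicator fun t => ((t ^ (∑ j, α j - 1) : ℝ) : ℂ) * D t
  have hDmeas : AEStronglyMeasurable D (volume.restrict (Set.Ioi (0 : ℝ))) := by
    refine AEStronglyMeasurable.integral_prod_right' (f := fun p : ℝ × (Fin n → ℝ) =>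
      (omega α p.2 : ℂ) * Complex.exp (-(p.1 * ∑ j, bary p.2 j * q j : ℝ)))
      (ν := volume.restrict (simplex n)) ?_
    have hbary' : Continuous fun p : ℝ × (Fin n → ℝ) => ∑ j, bary p.2 j * q j :=
      hbary.comp continuous_snd
    refine (hω.aestronglyMeasurable.comp_snd).mul (Continuous.aestronglyMeasurable ?_)
    fun_prop
  have hμi : Integrable μ := by
    rw [integrable_indicator_iff measurableSet_Ioi]
    have h := (integrableOn_rpow_mul_exp_neg_mul_rpow (s := ∑ j, α j - 1) (p := 1) (b := c)
      (by linarith) zero_lt_one hc).const_mul (∫ u in simplex n, ‖(omega α u : ℂ)‖)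
    refine Integrable.mono' h (AEStronglyMeasurable.mul ?_ hDmeas) ?_
    · exact (Complex.continuous_ofReal.measurable.comp
        (measurable_id.pow_const _)).aestronglyMeasurable
    · refine (ae_restrict_mem measurableSet_Ioi).mono fun t ht => ?_
      have ht' : 0 < t := ht
      rw [norm_mul, Complex.norm_real, Real.norm_of_nonneg (by positivity), Real.rpow_one]
      refine (mul_le_mul_of_nonneg_left (hDle t ht'.le) (by positivity)).trans_eq ?_
      rw [neg_mul, mul_comm t c]
      ring
  have hμc : ContinuousAt μ 1 := by
    have : (fun t : ℝ => ((t ^ (∑ j, α j - 1) : ℝ) : ℂ) * D t) =ᶠ[𝓝 1] μ := by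
      filter_upwards [lt_mem_nhds (zero_lt_one (α := ℝ))] with t ht
      simp only [μ]
      rw [Set.indicator_of_mem (show t ∈ Set.Ioi 0 from ht)]
    refine ContinuousAt.congr ?_ this
    refine ContinuousAt.mul ?_ hD1
    exact Complex.continuous_ofReal.continuousAt.comp
      (Real.continuousAt_rpow_const _ _ (Or.inl one_ne_zero))
  -- In the Laplace transform, `∑ u_j (q_j - i x) = ∑ u_j q_j - i x` since `∑ u_j = 1`.
  have hF : ∀ v : ℝ, 𝓕 μ v = ∏ j, (q j - I * (-(2 * Real.pi) * v : ℝ) : ℂ) ^ (-α j : ℂ) := by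
    intro v
    rw [prod_cpow_eq_integral hα (fun j => by simpa using hq0 j),
      Real.fourier_real_eq_integral_exp_smul,
      ← integral_indicator measurableSet_Ioi]
    refine integral_congr_ae (ae_of_all _ fun t => ?_)
    by_cases ht : t ∈ Set.Ioi (0 : ℝ)
    · simp only [μ, D, Set.indicator_of_mem ht, smul_eq_mul]
      rw [mul_left_comm, ← integral_const_mul]
      congr 2
      funext u
      rw [mul_left_comm, ← Complex.exp_add]
      congr 2
      simp only [mul_sub, Finset.sum_sub_distrib, ← Finset.sum_mul, ← Complex.ofReal_sum, sum_bary]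
      push_cast
      ring
    · simp [μ, Set.indicator_of_notMem ht]
  have hprod : ∀ x : ℝ, ‖∏ j, (q j - I * x : ℂ) ^ (-α j : ℂ)‖ ≤
      (c ^ 2 + x ^ 2) ^ (-(∑ j, α j) / 2) := by
    intro x
    rw [norm_prod, ← Finset.sum_neg_distrib, Finset.sum_div, Real.rpow_sum_of_pos (by positivity)]
    refine Finset.prod_le_prod (fun j _ => norm_nonneg _) fun j _ => ?_
    rw [norm_sub_I_mul_cpow]
    refine Real.rpow_le_rpow_of_nonpos (by positivity) ?_ (by linarith [hα j])
    gcongr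
    exact hq j
  have hcont : Continuous fun x : ℝ => ∏ j, (q j - I * x : ℂ) ^ (-α j : ℂ) :=
    continuous_finsetProd _ fun j _ => continuous_iff_continuousAt.2 fun x =>
      ContinuousAt.cpow (by fun_prop) continuousAt_const (sub_I_mul_mem_slitPlane (hq0 j) x)
  have hPi : Integrable fun x : ℝ => ∏ j, (q j - I * x : ℂ) ^ (-α j : ℂ) :=
    (integrable_add_sq_rpow hc hα1).mono' hcont.aestronglyMeasurable (ae_of_all _ hprod)
  have hpi : (-(2 * Real.pi)) ≠ 0 := by simp [Real.pi_ne_zero]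
  have hFi : Integrable (𝓕 μ) := by
    refine (hPi.comp_mul_left' hpi).congr (ae_of_all _ fun v => (hF v).symm)
  have hinv := hμi.fourierInv_fourier_eq hFi hμc
  rw [Real.fourierInv_eq'] at hinv
  have hμ1 : μ 1 = ∫ u in simplex n, (omega α u : ℂ) *
      Complex.exp (-(∑ j, bary u j * q j : ℝ)) := by
    simp [μ, D]
  rw [← hμ1, ← hinv]
  have hsub := Measure.integral_comp_mul_left (fun x : ℝ => Complex.exp (-(I * x)) *
    ∏ j, (q j - I * x : ℂ) ^ (-α j : ℂ)) (-(2 * Real.pi))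
  have hL : ∫ v : ℝ, Complex.exp ((2 * Real.pi * inner ℝ v 1 : ℝ) * I) • 𝓕 μ v =
      ∫ v : ℝ, Complex.exp (-(I * (-(2 * Real.pi) * v : ℝ))) *
        ∏ j, (q j - I * (-(2 * Real.pi) * v : ℝ) : ℂ) ^ (-α j : ℂ) := by
    refine integral_congr_ae (ae_of_all _ fun v => ?_)
    simp only [hF, smul_eq_mul]
    congr 2
    simp
    ring
  rw [hL, hsub, abs_inv, abs_neg, abs_of_pos (by positivity), Complex.real_smul, ← mul_assoc]
  push_cast
  rw [mul_inv_cancel₀ (by simp [Real.pi_ne_zero]), one_mul]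

end AxisIntegral

/-! ### The contour integral along the imaginary axis -/

section Contour

variable {X : Type*} [PseudoMetricSpace X]

/-- The function `x ↦ (q(x) - i t)^{-a}` in `C(X)`, for a continuous positive function `q`. -/
def resPow (q : C(X, ℝ)) (hq : ∀ x, 0 < q x) (a t : ℝ) : C(X, ℂ) where
  toFun x := (q x - I * t : ℂ) ^ (-a : ℂ)
  continuous_toFun := continuous_iff_continuousAt.2 fun x =>
    ContinuousAt.cpow (by fun_prop) continuousAt_const (sub_I_mul_mem_slitPlane (hq x) t)

/-- The function `x ↦ e^{-s q(x)}` in `C(X)`. -/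
def heatExp (q : C(X, ℝ)) (s : ℝ) : C(X, ℂ) where
  toFun x := Complex.exp (-(s * q x : ℝ))
  continuous_toFun := by fun_prop

variable {q : C(X, ℝ)}

theorem continuous_resPow (hq : ∀ x, 0 < q x) (a : ℝ) : Continuous (resPow q hq a) := by
  refine ContinuousMap.continuous_of_continuous_uncurry _ ?_
  refine continuous_iff_continuousAt.2 fun p => ?_
  exact ContinuousAt.cpow (f := fun p : ℝ × X => (q p.2 - I * p.1 : ℂ)) (by fun_prop)
    continuousAt_const (sub_I_mul_mem_slitPlane (hq p.2) p.1)

theorem continuous_heatExp (q : C(X, ℝ)) : Continuous (heatExp q) := by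
  refine ContinuousMap.continuous_of_continuous_uncurry _ ?_
  change Continuous fun p : ℝ × X => Complex.exp (-(p.1 * q p.2 : ℝ))
  fun_prop

theorem prod_heatExp {n : ℕ} (u : Fin n → ℝ) (y : Fin (n + 1) → X) :
    ∏ j, heatExp q (bary u j) (y j) = Complex.exp (-(∑ j, bary u j * q (y j) : ℝ)) := by
  simp only [heatExp, ContinuousMap.coe_mk]
  rw [← Complex.exp_sum, Finset.sum_neg_distrib, Complex.ofReal_sum]

variable [CompactSpace X]

theorem norm_resPow_le (hq : ∀ x, 0 < q x) {c : ℝ} (hc : 0 < c) (hcq : ∀ x, c ≤ q x) {a : ℝ}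
    (ha : 0 < a) (t : ℝ) : ‖resPow q hq a t‖ ≤ (c ^ 2 + t ^ 2) ^ (-a / 2) := by
  rw [ContinuousMap.norm_le _ (by positivity)]
  intro x
  change ‖(q x - I * t : ℂ) ^ (-a : ℂ)‖ ≤ _
  rw [norm_sub_I_mul_cpow]
  refine Real.rpow_le_rpow_of_nonpos (by positivity) ?_ (by linarith)
  gcongr
  exact hcq x

theorem norm_heatExp_le {c : ℝ} (hcq : ∀ x, c ≤ q x) {s : ℝ} (hs : 0 ≤ s) :
    ‖heatExp q s‖ ≤ Real.exp (-(s * c)) := by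
  rw [ContinuousMap.norm_le _ (Real.exp_pos _).le]
  intro x
  change ‖Complex.exp (-(s * q x : ℝ))‖ ≤ _
  rw [← Complex.ofReal_neg, Complex.norm_exp_ofReal]
  gcongr
  exact hcq x

theorem prod_norm_resPow_le {n : ℕ} (hq : ∀ x, 0 < q x) {c : ℝ} (hc : 0 < c) (hcq : ∀ x, c ≤ q x)
    {α : Fin (n + 1) → ℝ} (hα : ∀ j, 0 < α j) (t : ℝ) :
    ∏ j, ‖resPow q hq (α j) t‖ ≤ (c ^ 2 + t ^ 2) ^ (-(∑ j, α j) / 2) := by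
  rw [← Finset.sum_neg_distrib, Finset.sum_div, Real.rpow_sum_of_pos (by positivity)]
  exact Finset.prod_le_prod (fun j _ => norm_nonneg _) fun j _ =>
    norm_resPow_le hq hc hcq (hα j) t

theorem prod_norm_heatExp_le {n : ℕ} {c : ℝ} (hcq : ∀ x, c ≤ q x) {u : Fin n → ℝ}
    (hu : u ∈ simplex n) : ∏ j, ‖heatExp q (bary u j)‖ ≤ Real.exp (-c) := by
  refine (Finset.prod_le_prod (fun j _ => norm_nonneg _) fun j _ =>
    norm_heatExp_le hcq (mem_simplex_iff.1 hu j)).trans_eq ?_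
  rw [← Real.exp_sum, Finset.sum_neg_distrib, ← Finset.sum_mul, sum_bary, one_mul]

variable {A : Type*} [NormedAddCommGroup A] [NormedSpace ℂ A] [CompleteSpace A] {n : ℕ}
  (L : ContinuousMultilinearMap ℂ (fun _ : Fin (n + 1) => C(X, ℂ)) A)

/-- The Dirichlet average `∫_{Δ^n} ω_α(u) L(e^{-u_0 q}, …, e^{-u_n q}) du` of heat exponentials. -/
def heatAverage (q : C(X, ℝ)) (α : Fin (n + 1) → ℝ) : A :=
  ∫ u in simplex n, (omega α u : ℂ) • L fun j => heatExp q (bary u j)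

theorem represents_heatAverage {c : ℝ} (hcq : ∀ x, c ≤ q x)
    {α : Fin (n + 1) → ℝ} (hα : ∀ j, 0 < α j) :
    IntegrableOn (fun u => (omega α u : ℂ) • L fun j => heatExp q (bary u j)) (simplex n) ∧
    Represents L (fun y => ∫ u in simplex n, (omega α u : ℂ) *
      Complex.exp (-(∑ j, bary u j * q (y j) : ℝ))) (heatAverage L q α) := by
  have hω := integrableOn_omega hα
  have h := represents_integral (L := L) (τ := volume.restrict (simplex n))
    (w := fun u => (omega α u : ℂ)) hω.aestronglyMeasurable
    (e := fun j u => heatExp q (bary u j))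
    (fun j => (continuous_heatExp q).comp ((continuous_apply j).comp continuous_bary))
    (D := fun u => ‖(omega α u : ℂ)‖ * Real.exp (-c)) (hω.norm.mul_const _)
    ((ae_restrict_mem (isClosed_simplex n).measurableSet).mono fun u hu =>
      mul_le_mul_of_nonneg_left (prod_norm_heatExp_le hcq hu) (norm_nonneg _))
  simp_rw [prod_heatExp] at h
  exact h

/-- The norm-convergent case of the contour integral. -/
theorem integral_resPow (hq : ∀ x, 0 < q x) {c : ℝ} (hc : 0 < c) (hcq : ∀ x, c ≤ q x)
    {α : Fin (n + 1) → ℝ} (hα : ∀ j, 0 < α j) (hα1 : 1 < ∑ j, α j) :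
    Integrable (fun t : ℝ => Complex.exp (-(I * t)) • L fun j => resPow q hq (α j) t) ∧
    ∫ t : ℝ, Complex.exp (-(I * t)) • (L fun j => resPow q hq (α j) t) =
      (2 * Real.pi : ℂ) • heatAverage L q α := by
  obtain ⟨h1, h2⟩ := represents_integral (L := L) (τ := (volume : Measure ℝ))
    (w := fun t : ℝ => Complex.exp (-(I * t)))
    (Continuous.aestronglyMeasurable (by fun_prop)) (e := fun j t => resPow q hq (α j) t)
    (fun j => continuous_resPow hq (α j)) (integrable_add_sq_rpow hc hα1)
    (ae_of_all _ fun t => by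
      rw [Complex.norm_exp]
      simpa using prod_norm_resPow_le hq hc hcq hα t)
  refine ⟨h1, h2.unique ?_⟩
  convert (represents_heatAverage L hcq hα).2.smul (2 * Real.pi : ℂ) using 1
  funext y
  exact integral_exp_mul_prod_cpow hα hα1 hc fun j => hcq (y j)

theorem update_add_one_pos {α : Fin (n + 1) → ℝ} (hα : ∀ j, 0 < α j) (i j : Fin (n + 1)) :
    0 < Function.update α i (α i + 1) j := by
  by_cases h : j = i
  · subst h; simp only [Function.update_self]; linarith [hα j]
  · rw [Function.update_of_ne h]; exact hα j

/-- `α_i ω_{α + e_i} = u_i ω_α`, with `u_0 = 1 - ∑ u_l`. -/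
theorem mul_omega_update {α : Fin (n + 1) → ℝ} (hα : ∀ j, 0 < α j) (i : Fin (n + 1))
    {u : Fin n → ℝ} (hu : u ∈ simplex n) :
    α i * omega (Function.update α i (α i + 1)) u = bary u i * omega α u := by
  have hx : bary u i ^ α i = bary u i * bary u i ^ (α i - 1) := by
    rcases (mem_simplex_iff.1 hu i).eq_or_lt with h | h
    · rw [← h, zero_mul, Real.zero_rpow (hα i).ne']
    · rw [Real.rpow_sub_one h.ne', mul_div_cancel₀ _ h.ne']
  have hG := Real.Gamma_add_one (hα i).ne'
  have hG0 := (Real.Gamma_pos_of_pos (hα i)).ne'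
  simp only [omega_eq]
  rw [← Finset.mul_prod_erase _ _ (Finset.mem_univ i), ← Finset.mul_prod_erase _ _ (Finset.mem_univ i),
    ← Finset.mul_prod_erase _ (fun j => Real.Gamma (α j)) (Finset.mem_univ i),
    ← Finset.mul_prod_erase _ (fun j => bary u j ^ (α j - 1)) (Finset.mem_univ i)]
  have h1 : ∏ j ∈ Finset.univ.erase i, Real.Gamma (Function.update α i (α i + 1) j) =
      ∏ j ∈ Finset.univ.erase i, Real.Gamma (α j) :=
    Finset.prod_congr rfl fun j hj => by rw [Function.update_of_ne (Finset.ne_of_mem_erase hj)]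
  have h2 : ∏ j ∈ Finset.univ.erase i, bary u j ^ (Function.update α i (α i + 1) j - 1) =
      ∏ j ∈ Finset.univ.erase i, bary u j ^ (α j - 1) :=
    Finset.prod_congr rfl fun j hj => by rw [Function.update_of_ne (Finset.ne_of_mem_erase hj)]
  rw [h1, h2]
  simp only [Function.update_self, add_sub_cancel_right]
  rw [hx, hG]
  have := (hα i).ne'
  simp only [mul_inv]
  field_simp

/-- Since the barycentric coordinates add up to one, raising each exponent in turn recovers the
average: `∑_i α_i V_{α + e_i} = V_α`. -/
theorem sum_heatAverage_update {c : ℝ} (hcq : ∀ x, c ≤ q x) {α : Fin (n + 1) → ℝ}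
    (hα : ∀ j, 0 < α j) :
    ∑ i, (α i : ℂ) • heatAverage L q (Function.update α i (α i + 1)) = heatAverage L q α := by
  simp only [heatAverage]
  simp_rw [← integral_smul]
  have hint : ∀ i, IntegrableOn (fun u => (α i : ℂ) • (omega (Function.update α i (α i + 1)) u : ℂ) •
      L fun j => heatExp q (bary u j)) (simplex n) := fun i =>
    (represents_heatAverage L hcq (update_add_one_pos hα i)).1.smul (α i : ℂ)
  rw [← integral_finsetSum _ fun i _ => hint i]
  refine setIntegral_congr_fun (isClosed_simplex n).measurableSet fun u hu => ?_
  simp only [smul_smul]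
  rw [← Finset.sum_smul]
  congr 1
  rw [Finset.sum_congr rfl fun i _ => by
    rw [← Complex.ofReal_mul, mul_omega_update hα i hu, Complex.ofReal_mul], ← Finset.sum_mul,
    ← Complex.ofReal_sum, sum_bary, Complex.ofReal_one, one_mul]

theorem hasDerivAt_sub_I_mul_cpow {q : ℝ} (hq : 0 < q) (a t : ℝ) :
    HasDerivAt (fun t : ℝ => (q - I * t : ℂ) ^ (-a : ℂ))
      (a * I * (q - I * t : ℂ) ^ (-(a + 1 : ℝ) : ℂ)) t := by
  have h1 : HasDerivAt (fun t : ℝ => (q - I * t : ℂ)) (-I) t := by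
    simpa using! ((Complex.ofRealCLM.hasDerivAt (x := t)).const_mul I).const_sub (q : ℂ)
  have h2 := (hasStrictDerivAt_cpow_const (c := (-a : ℂ))
    (sub_I_mul_mem_slitPlane hq t)).hasDerivAt.scomp t h1
  refine HasDerivAt.congr_deriv h2 ?_
  rw [smul_eq_mul, show (-(a + 1 : ℝ) : ℂ) = -a - 1 by push_cast; ring]
  ring

/-- Integration by parts for the scalar integrand. -/
theorem intervalIntegral_exp_mul_prod_cpow {α : Fin (n + 1) → ℝ} {q : Fin (n + 1) → ℝ}
    (hq : ∀ j, 0 < q j) (a b : ℝ) :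
    ∫ t in a..b, I * Complex.exp (-(I * t)) * ∏ j, (q j - I * t : ℂ) ^ (-α j : ℂ) =
      Complex.exp (-(I * a)) * ∏ j, (q j - I * a : ℂ) ^ (-α j : ℂ) -
      Complex.exp (-(I * b)) * ∏ j, (q j - I * b : ℂ) ^ (-α j : ℂ) +
      ∑ i, (α i : ℂ) * ∫ t in a..b, I * Complex.exp (-(I * t)) *
        ∏ j, (q j - I * t : ℂ) ^ (-(Function.update α i (α i + 1) j) : ℂ) := by
  have hcont : ∀ β : Fin (n + 1) → ℝ, Continuous fun t : ℝ =>
      I * Complex.exp (-(I * t)) * ∏ j, (q j - I * t : ℂ) ^ (-β j : ℂ) := fun β => by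
    refine Continuous.mul (by fun_prop) (continuous_finsetProd _ fun j _ =>
      continuous_iff_continuousAt.2 fun t => ContinuousAt.cpow (by fun_prop) continuousAt_const
        (sub_I_mul_mem_slitPlane (hq j) t))
  have hd : ∀ t : ℝ, HasDerivAt (fun t : ℝ => -(Complex.exp (-(I * t)) *
      ∏ j, (q j - I * t : ℂ) ^ (-α j : ℂ)))
      (I * Complex.exp (-(I * t)) * ∏ j, (q j - I * t : ℂ) ^ (-α j : ℂ) -
        ∑ i, (α i : ℂ) * (I * Complex.exp (-(I * t)) *
          ∏ j, (q j - I * t : ℂ) ^ (-(Function.update α i (α i + 1) j) : ℂ))) t := by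
    intro t
    have h1 : HasDerivAt (fun t : ℝ => Complex.exp (-(I * t))) (Complex.exp (-(I * t)) * -I) t := by
      refine HasDerivAt.cexp ?_
      simpa using! ((Complex.ofRealCLM.hasDerivAt (x := t)).const_mul I).neg
    have h2 := HasDerivAt.fun_finsetProd (u := Finset.univ) fun j _ =>
      hasDerivAt_sub_I_mul_cpow (hq j) (α j) t
    refine HasDerivAt.congr_deriv (h1.mul h2).neg ?_
    symm
    rw [sub_eq_add_neg, neg_add, ← Finset.sum_neg_distrib, Finset.mul_sum, ← Finset.sum_neg_distrib]
    congr 1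
    · ring
    · refine Finset.sum_congr rfl fun i _ => ?_
      rw [← Finset.mul_prod_erase _ _ (Finset.mem_univ i), Function.update_self,
        Finset.prod_congr rfl fun j hj => by
          rw [Function.update_of_ne (Finset.ne_of_mem_erase hj)]]
      simp only [smul_eq_mul]
      ring
  have hint := intervalIntegral.integral_eq_sub_of_hasDerivAt (a := a) (b := b) (fun t _ => hd t)
    (Continuous.intervalIntegrable (by
      refine (hcont α).sub (continuous_finsetSum _ fun i _ => (hcont _).const_mul _)) _ _)
  rw [intervalIntegral.integral_sub ((hcont α).intervalIntegrable _ _)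
    ((continuous_finsetSum _ fun i _ => (hcont _).const_mul _).intervalIntegrable _ _),
    intervalIntegral.integral_finsetSum fun i _ =>
      ((hcont _).const_mul _).intervalIntegrable _ _] at hint
  simp_rw [intervalIntegral.integral_const_mul] at hint
  simp_rw [mul_assoc] at hint ⊢
  linear_combination hint

end Contour

/-! ### The improper contour integral -/

section ContourLimit

variable {X : Type*} [PseudoMetricSpace X] {q : C(X, ℝ)}
  {A : Type*} [NormedAddCommGroup A] [NormedSpace ℂ A] {n : ℕ}
  (L : ContinuousMultilinearMap ℂ (fun _ : Fin (n + 1) => C(X, ℂ)) A)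

theorem continuous_smul_resPow (hq : ∀ x, 0 < q x) (α : Fin (n + 1) → ℝ) :
    Continuous fun t : ℝ => I • Complex.exp (-(I * t)) • L fun j => resPow q hq (α j) t := by
  refine Continuous.const_smul (Continuous.smul (by fun_prop) (L.cont.comp ?_)) _
  exact continuous_pi fun j => continuous_resPow hq (α j)

variable [CompactSpace X]

theorem tendsto_resPow_zero (hq : ∀ x, 0 < q x) {c : ℝ} (hc : 0 < c)
    (hcq : ∀ x, c ≤ q x) {α : Fin (n + 1) → ℝ} (hα : ∀ j, 0 < α j) {l : Filter ℝ}
    (hl : Tendsto (fun t : ℝ => t ^ 2) l atTop) :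
    Tendsto (fun t : ℝ => L fun j => resPow q hq (α j) t) l (𝓝 0) := by
  have hpos : 0 < ∑ j, α j := Finset.sum_pos (fun j _ => hα j) Finset.univ_nonempty
  refine squeeze_zero_norm (a := fun t : ℝ => ‖L‖ * (c ^ 2 + t ^ 2) ^ (-(∑ j, α j) / 2))
    (fun t => (L.le_opNorm _).trans
      (mul_le_mul_of_nonneg_left (prod_norm_resPow_le hq hc hcq hα t) (norm_nonneg _))) ?_
  rw [← mul_zero ‖L‖]
  refine Tendsto.const_mul _ ?_
  have h := (tendsto_rpow_neg_atTop (half_pos hpos)).comp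
    (tendsto_atTop_add_const_left l (c ^ 2) hl)
  refine h.congr fun t => ?_
  simp only [Function.comp, neg_div]

variable [CompleteSpace A]

theorem represents_setIntegral_resPow (hq : ∀ x, 0 < q x) {c : ℝ} (hc : 0 < c)
    (hcq : ∀ x, c ≤ q x) {α : Fin (n + 1) → ℝ} (hα : ∀ j, 0 < α j) {a b : ℝ} (hab : a ≤ b) :
    Represents L (fun y => ∫ t in a..b, I * Complex.exp (-(I * t)) *
        ∏ j, (q (y j) - I * t : ℂ) ^ (-α j : ℂ))
      (∫ t in a..b, I • Complex.exp (-(I * t)) • L fun j => resPow q hq (α j) t) := by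
  simp_rw [intervalIntegral.integral_of_le hab, smul_smul]
  refine (represents_integral (L := L) (τ := volume.restrict (Set.Ioc a b))
    (w := fun t : ℝ => I * Complex.exp (-(I * t)))
    (Continuous.aestronglyMeasurable (by fun_prop)) (e := fun j t => resPow q hq (α j) t)
    (fun j => continuous_resPow hq (α j))
    (D := fun t => (c ^ 2 + t ^ 2) ^ (-(∑ j, α j) / 2)) ?_ (ae_of_all _ fun t => ?_)).2
  · refine (Continuous.integrableOn_Icc ?_).mono_set Set.Ioc_subset_Icc_self
    exact (by fun_prop : Continuous fun t : ℝ => c ^ 2 + t ^ 2).rpow_const fun t =>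
      Or.inl (by positivity)
  · rw [norm_mul, Complex.norm_I, Complex.norm_exp]
    simpa using prod_norm_resPow_le hq hc hcq hα t

theorem sum_update_add_one (α : Fin (n + 1) → ℝ) (i : Fin (n + 1)) :
    ∑ j, Function.update α i (α i + 1) j = ∑ j, α j + 1 := by
  rw [Finset.sum_update_of_mem (Finset.mem_univ i), ← Finset.add_sum_erase _ α (Finset.mem_univ i),
    Finset.sdiff_singleton_eq_erase]
  ring

/-- Integration by parts raises the exponents by one in turn; it follows from the scalar identity, as
both sides represent the same function. -/
theorem intervalIntegral_smul_resPow (hq : ∀ x, 0 < q x) {c : ℝ} (hc : 0 < c)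
    (hcq : ∀ x, c ≤ q x) {α : Fin (n + 1) → ℝ} (hα : ∀ j, 0 < α j) {a b : ℝ} (hab : a ≤ b) :
    ∫ t in a..b, I • Complex.exp (-(I * t)) • (L fun j => resPow q hq (α j) t) =
      Complex.exp (-(I * a)) • (L fun j => resPow q hq (α j) a) +
      -Complex.exp (-(I * b)) • (L fun j => resPow q hq (α j) b) +
      ∑ i, (α i : ℂ) • ∫ t in a..b, I • Complex.exp (-(I * t)) •
        L fun j => resPow q hq (Function.update α i (α i + 1) j) t := by
  refine (represents_setIntegral_resPow L hq hc hcq hα hab).unique ?_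
  convert (((represents_prod L fun j => resPow q hq (α j) a).smul (Complex.exp (-(I * a)))).add
    ((represents_prod L fun j => resPow q hq (α j) b).smul (-Complex.exp (-(I * b))))).add
    (Represents.sum (s := Finset.univ) fun i _ => (represents_setIntegral_resPow L hq hc hcq
      (update_add_one_pos hα i) hab).smul (α i : ℂ)) using 1
  funext y
  rw [intervalIntegral_exp_mul_prod_cpow fun j => hq (y j)]
  simp only [Pi.add_apply, Finset.sum_apply, Pi.smul_apply, smul_eq_mul, resPow,
    ContinuousMap.coe_mk]
  ring

/-- The improper integral over the imaginary axis. After one integration by parts the boundary terms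
vanish in the limit and the remaining integrals converge absolutely, since `|α| + 1 > 1`. -/
theorem tendsto_intervalIntegral_resPow (hq : ∀ x, 0 < q x) {c : ℝ} (hc : 0 < c)
    (hcq : ∀ x, c ≤ q x) {α : Fin (n + 1) → ℝ} (hα : ∀ j, 0 < α j) :
    Tendsto (fun p : ℝ × ℝ => ∫ t in (-p.1)..p.2,
        I • Complex.exp (-(I * t)) • L fun j => resPow q hq (α j) t)
      (atTop ×ˢ atTop) (𝓝 ((2 * Real.pi * I : ℂ) • heatAverage L q α)) := by
  have hn : Tendsto (fun p : ℝ × ℝ => -p.1) (atTop ×ˢ atTop) atBot :=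
    tendsto_neg_atTop_atBot.comp tendsto_fst
  have hp : Tendsto (fun p : ℝ × ℝ => p.2) (atTop ×ˢ (atTop : Filter ℝ)) atTop := tendsto_snd
  have hexp : ∀ (t : ℝ) (v : A), ‖Complex.exp (-(I * t)) • v‖ = ‖v‖ := fun t v => by
    rw [norm_smul, Complex.norm_exp]; simp
  have hexp' : ∀ (t : ℝ) (v : A), ‖-Complex.exp (-(I * t)) • v‖ = ‖v‖ := fun t v => by
    rw [neg_smul, norm_neg, hexp]
  have hsqT : Tendsto (fun t : ℝ => t ^ 2) atTop atTop := tendsto_pow_atTop two_ne_zero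
  have hsqB : Tendsto (fun t : ℝ => t ^ 2) atBot atTop := by
    refine (hsqT.comp tendsto_neg_atBot_atTop).congr fun t => by simp
  have h1 : Tendsto (fun p : ℝ × ℝ => Complex.exp (-(I * (-p.1 : ℝ))) •
      L fun j => resPow q hq (α j) (-p.1)) (atTop ×ˢ atTop) (𝓝 0) := by
    have := (tendsto_resPow_zero L hq hc hcq hα hsqB).comp hn
    rw [tendsto_zero_iff_norm_tendsto_zero] at this ⊢
    exact this.congr fun p => (hexp _ _).symm
  have h2 : Tendsto (fun p : ℝ × ℝ => -Complex.exp (-(I * (p.2 : ℝ))) •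
      L fun j => resPow q hq (α j) p.2) (atTop ×ˢ atTop) (𝓝 0) := by
    have := (tendsto_resPow_zero L hq hc hcq hα hsqT).comp hp
    rw [tendsto_zero_iff_norm_tendsto_zero] at this ⊢
    exact this.congr fun p => (hexp' _ _).symm
  have hpos : 0 < ∑ j, α j := Finset.sum_pos (fun j _ => hα j) Finset.univ_nonempty
  have h3 : ∀ i, Tendsto (fun p : ℝ × ℝ => ∫ t in (-p.1)..p.2, I • Complex.exp (-(I * t)) •
        L fun j => resPow q hq (Function.update α i (α i + 1) j) t) (atTop ×ˢ atTop)
      (𝓝 ((2 * Real.pi * I : ℂ) • heatAverage L q (Function.update α i (α i + 1)))) := by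
    intro i
    obtain ⟨hi, he⟩ := integral_resPow L hq hc hcq (update_add_one_pos hα i)
      (by rw [sum_update_add_one]; linarith)
    have := intervalIntegral_tendsto_integral (hi.smul I) hn hp
    simp only [Pi.smul_apply] at this
    rwa [integral_smul, he, smul_smul, mul_comm I] at this
  have h4 := (h1.add h2).add (tendsto_finsetSum Finset.univ fun i _ => (h3 i).const_smul (α i : ℂ))
  rw [zero_add, zero_add] at h4
  have h5 : ∑ i, (α i : ℂ) • (2 * Real.pi * I : ℂ) •
      heatAverage L q (Function.update α i (α i + 1)) =
      (2 * Real.pi * I : ℂ) • heatAverage L q α := by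
    rw [← sum_heatAverage_update L hcq hα, Finset.smul_sum]
    exact Finset.sum_congr rfl fun i _ => smul_comm _ _ _
  rw [h5] at h4
  refine h4.congr' ?_
  filter_upwards [prod_mem_prod (Ici_mem_atTop (0 : ℝ)) (Ici_mem_atTop (0 : ℝ))] with p hp
  refine (intervalIntegral_smul_resPow L hq hc hcq hα ?_).symm
  have h01 : 0 ≤ p.1 := hp.1
  have h02 : 0 ≤ p.2 := hp.2
  linarith

end ContourLimit

/-! ### Exponentials of second-order differential operators on polynomials -/

section Hessian

open MvPolynomial

variable {m : ℕ}

theorem pderiv_comm (i j : Fin m) (p : MvPolynomial (Fin m) ℝ) :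
    pderiv i (pderiv j p) = pderiv j (pderiv i p) := by
  ext d
  simp only [coeff_pderiv, Finsupp.add_apply]
  rw [add_right_comm]
  by_cases h : i = j
  · subst h; ring
  · simp [h, Ne.symm h]
    ring

/-- `quarterHessian` as a linear map. -/
def hessianLin (M : Matrix (Fin m) (Fin m) ℝ) : Module.End ℝ (MvPolynomial (Fin m) ℝ) :=
  (1 / 4 : ℝ) • ∑ i, ∑ j, M i j •
    ((pderiv i).toLinearMap ∘ₗ (pderiv j).toLinearMap :
      MvPolynomial (Fin m) ℝ →ₗ[ℝ] MvPolynomial (Fin m) ℝ)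

/-- The first-order operator `½ ∑_i M_{ji} ∂_i`, the commutator of `hessianLin M` with `ξ_j`. -/
def gradLin (M : Matrix (Fin m) (Fin m) ℝ) (j : Fin m) : Module.End ℝ (MvPolynomial (Fin m) ℝ) :=
  (1 / 2 : ℝ) • ∑ i, M j i • ((pderiv i).toLinearMap :
    MvPolynomial (Fin m) ℝ →ₗ[ℝ] MvPolynomial (Fin m) ℝ)

theorem hessianLin_apply (M : Matrix (Fin m) (Fin m) ℝ) (p : MvPolynomial (Fin m) ℝ) :
    hessianLin M p = (1 / 4 : ℝ) • ∑ i, ∑ j, M i j • pderiv i (pderiv j p) := by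
  simp [hessianLin, LinearMap.sum_apply]

theorem gradLin_apply (M : Matrix (Fin m) (Fin m) ℝ) (j : Fin m) (p : MvPolynomial (Fin m) ℝ) :
    gradLin M j p = (1 / 2 : ℝ) • ∑ i, M j i • pderiv i p := by
  simp [gradLin, LinearMap.sum_apply]

theorem iterate_quarterHessian (M : Matrix (Fin m) (Fin m) ℝ) (N : ℕ)
    (p : MvPolynomial (Fin m) ℝ) : (quarterHessian M)^[N] p = (hessianLin M ^ N) p := by
  have : quarterHessian M = hessianLin M := funext fun p => (hessianLin_apply M p).symm
  rw [this, Module.End.pow_apply]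

/-- All coefficients of `p` in degrees at least `k` vanish. -/
def VanishFrom (k : ℕ) (p : MvPolynomial (Fin m) ℝ) : Prop :=
  ∀ d : Fin m →₀ ℕ, k ≤ d.degree → coeff d p = 0

theorem VanishFrom.mono {k l : ℕ} (h : k ≤ l) {p : MvPolynomial (Fin m) ℝ} (hp : VanishFrom k p) :
    VanishFrom l p := fun d hd => hp d (h.trans hd)

theorem vanishFrom_monomial (γ : Fin m →₀ ℕ) (c : ℝ) :
    VanishFrom (γ.degree + 1) (monomial γ c) := by
  intro d hd
  rw [coeff_monomial, if_neg]
  rintro rfl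
  omega

theorem exists_vanishFrom (p : MvPolynomial (Fin m) ℝ) : ∃ k, VanishFrom k p :=
  ⟨p.totalDegree + 1, fun _ hd => coeff_eq_zero_of_totalDegree_lt hd⟩

theorem VanishFrom.pderiv {k : ℕ} {p : MvPolynomial (Fin m) ℝ} (hp : VanishFrom (k + 1) p)
    (i : Fin m) : VanishFrom k (MvPolynomial.pderiv i p) := by
  intro d hd
  rw [coeff_pderiv, hp _ (by rw [map_add, Finsupp.degree_single]; omega), zero_mul]

theorem VanishFrom.smul {k : ℕ} {p : MvPolynomial (Fin m) ℝ} (hp : VanishFrom k p) (c : ℝ) :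
    VanishFrom k (c • p) := fun d hd => by rw [coeff_smul, hp d hd, smul_zero]

theorem VanishFrom.sum {k : ℕ} {κ : Type*} {s : Finset κ} {p : κ → MvPolynomial (Fin m) ℝ}
    (hp : ∀ i ∈ s, VanishFrom k (p i)) : VanishFrom k (∑ i ∈ s, p i) := fun d hd => by
  rw [coeff_sum]; exact Finset.sum_eq_zero fun i hi => hp i hi d hd

theorem VanishFrom.gradLin {k : ℕ} {p : MvPolynomial (Fin m) ℝ} (hp : VanishFrom (k + 1) p)
    (M : Matrix (Fin m) (Fin m) ℝ) (j : Fin m) : VanishFrom k (gradLin M j p) := by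
  rw [gradLin_apply]
  exact (VanishFrom.sum fun i _ => (hp.pderiv i).smul _).smul _

theorem VanishFrom.hessianLin {k : ℕ} {p : MvPolynomial (Fin m) ℝ} (hp : VanishFrom (k + 1) p)
    (M : Matrix (Fin m) (Fin m) ℝ) : VanishFrom k (hessianLin M p) := by
  rw [hessianLin_apply]
  exact (VanishFrom.sum fun i _ => VanishFrom.sum fun j _ =>
    (((hp.pderiv j).mono (Nat.le_succ k)).pderiv i).smul _).smul _

theorem VanishFrom.hessianLin_pow {k : ℕ} (M : Matrix (Fin m) (Fin m) ℝ) :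
    ∀ {p : MvPolynomial (Fin m) ℝ}, VanishFrom k p → (Rearrangement.hessianLin M ^ k) p = 0 := by
  induction k with
  | zero =>
    intro p hp
    ext d
    simpa using hp d (Nat.zero_le _)
  | succ k ih =>
    intro p hp
    rw [pow_succ, Module.End.mul_apply]
    exact ih (hp.hessianLin M)

theorem expQuarterHessian_eq_sum (M : Matrix (Fin m) (Fin m) ℝ) {k : ℕ}
    {p : MvPolynomial (Fin m) ℝ} (hp : VanishFrom k p) :
    expQuarterHessian M p = ∑ N ∈ Finset.range k, ((N ! : ℝ))⁻¹ • (hessianLin M ^ N) p := by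
  simp only [expQuarterHessian, iterate_quarterHessian]
  refine finsum_eq_sum_of_support_subset _ fun N hN => ?_
  by_contra hk
  have hk' : k ≤ N := by simpa using hk
  exact hN (by simp only [(hp.mono hk').hessianLin_pow, smul_zero])

/-- The functional `p ↦ (exp(¼ ∑ M_{ij} ∂_i ∂_j) p)(0)`. -/
def hessianFunctional (M : Matrix (Fin m) (Fin m) ℝ) : MvPolynomial (Fin m) ℝ →ₗ[ℝ] ℝ where
  toFun p := eval 0 (expQuarterHessian M p)
  map_add' p r := by
    obtain ⟨k, hk⟩ := exists_vanishFrom p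
    obtain ⟨l, hl⟩ := exists_vanishFrom r
    have hp := hk.mono (le_max_left k l)
    have hr := hl.mono (le_max_right k l)
    have hpr : VanishFrom (max k l) (p + r) := fun d hd => by
      rw [coeff_add, hp d hd, hr d hd, add_zero]
    rw [expQuarterHessian_eq_sum M hp, expQuarterHessian_eq_sum M hr,
      expQuarterHessian_eq_sum M hpr]
    simp [Finset.sum_add_distrib]
  map_smul' c p := by
    obtain ⟨k, hk⟩ := exists_vanishFrom p
    rw [expQuarterHessian_eq_sum M hk, expQuarterHessian_eq_sum M (hk.smul c)]
    simp [Finset.mul_sum, mul_left_comm]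

theorem hessianLin_X_mul {M : Matrix (Fin m) (Fin m) ℝ} (hM : M.IsSymm) (j : Fin m)
    (p : MvPolynomial (Fin m) ℝ) :
    hessianLin M (X j * p) = X j * hessianLin M p + gradLin M j p := by
  have h1 : ∀ a b : Fin m, MvPolynomial.pderiv a (MvPolynomial.pderiv b (X j * p)) =
      X j * MvPolynomial.pderiv a (MvPolynomial.pderiv b p) +
      ((if b = j then MvPolynomial.pderiv a p else 0) +
        if a = j then MvPolynomial.pderiv b p else 0) := by
    intro a b
    rw [pderiv_mul, map_add, pderiv_mul, pderiv_mul, pderiv_X, pderiv_X]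
    by_cases hb : b = j
    · by_cases ha : a = j
      · subst hb ha; simp; ring
      · subst hb; simp [ha, eq_comm, add_comm]
    · by_cases ha : a = j
      · subst ha; simp [hb, add_comm]
      · simp [ha, hb]
  rw [hessianLin_apply, hessianLin_apply, gradLin_apply]
  simp_rw [h1, smul_add, Finset.sum_add_distrib, smul_add]
  congr 1
  · rw [mul_smul_comm]
    simp only [Finset.mul_sum, mul_smul_comm]
  · have e1 : ∑ a, ∑ b, M a b • (if b = j then MvPolynomial.pderiv a p else 0) =
        ∑ i, M j i • MvPolynomial.pderiv i p := by
      refine Finset.sum_congr rfl fun a _ => ?_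
      rw [Finset.sum_eq_single j (fun b _ hb => by rw [if_neg hb, smul_zero]) (by simp),
        if_pos rfl, hM.apply]
    have e2 : ∑ a, ∑ b, M a b • (if a = j then MvPolynomial.pderiv b p else 0) =
        ∑ i, M j i • MvPolynomial.pderiv i p := by
      rw [Finset.sum_eq_single j (fun a _ ha => by simp [ha]) (by simp)]
      simp
    rw [e1, e2, ← add_smul]
    norm_num

theorem commute_hessianLin_gradLin (M : Matrix (Fin m) (Fin m) ℝ) (j : Fin m) :
    Commute (hessianLin M) (gradLin M j) := by
  have h : ∀ a b : Fin m, Commute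
      ((MvPolynomial.pderiv a).toLinearMap : Module.End ℝ (MvPolynomial (Fin m) ℝ))
      (MvPolynomial.pderiv b).toLinearMap := fun a b => LinearMap.ext fun p => pderiv_comm a b p
  refine Commute.smul_left (Commute.smul_right ?_ _) _
  refine Commute.sum_left _ _ _ fun a _ => Commute.sum_left _ _ _ fun b _ =>
    Commute.sum_right _ _ _ fun i _ => Commute.smul_left (Commute.smul_right ?_ _) _
  exact (h a i).mul_left (h b i)

theorem hessianLin_pow_X_mul {M : Matrix (Fin m) (Fin m) ℝ} (hM : M.IsSymm) (j : Fin m) (N : ℕ)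
    (p : MvPolynomial (Fin m) ℝ) :
    (hessianLin M ^ (N + 1)) (X j * p) = X j * (hessianLin M ^ (N + 1)) p +
      ((N : ℝ) + 1) • (hessianLin M ^ N) (gradLin M j p) := by
  induction N generalizing p with
  | zero => simp [hessianLin_X_mul hM]
  | succ N ih =>
    have hc : hessianLin M (gradLin M j p) = gradLin M j (hessianLin M p) :=
      LinearMap.congr_fun (commute_hessianLin_gradLin M j) p
    rw [pow_succ, Module.End.mul_apply, hessianLin_X_mul hM, map_add, ih, ← hc,
      ← Module.End.mul_apply, ← pow_succ, ← Module.End.mul_apply, ← pow_succ, add_assoc]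
    congr 1
    push_cast
    rw [add_smul (_ + 1 : ℝ) 1, one_smul]

/-- The recursion `E(ξ_j p) = E(½ ∑_i M_{ji} ∂_i p)` for `E(p) = (exp(¼ ∑ M_{ij} ∂_i ∂_j) p)(0)`. -/
theorem hessianFunctional_X_mul {M : Matrix (Fin m) (Fin m) ℝ} (hM : M.IsSymm) (j : Fin m)
    (p : MvPolynomial (Fin m) ℝ) :
    hessianFunctional M (X j * p) = hessianFunctional M (gradLin M j p) := by
  obtain ⟨k, hk⟩ := exists_vanishFrom (X j * p)
  obtain ⟨l, hl⟩ := exists_vanishFrom (gradLin M j p)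
  have h1 := hk.mono ((le_max_left k l).trans (Nat.le_succ _))
  have h2 := hl.mono (le_max_right k l)
  change eval 0 _ = eval 0 _
  rw [expQuarterHessian_eq_sum M h1, expQuarterHessian_eq_sum M h2, Finset.sum_range_succ']
  simp only [map_add, map_sum, pow_zero, Module.End.one_apply, smul_eval, map_mul, eval_X,
    Pi.zero_apply, zero_mul, mul_zero, add_zero, hessianLin_pow_X_mul hM, zero_add]
  refine Finset.sum_congr rfl fun N _ => ?_
  rw [Nat.factorial_succ]
  push_cast
  field_simp

theorem hessianFunctional_one (M : Matrix (Fin m) (Fin m) ℝ) : hessianFunctional M 1 = 1 := by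
  have h : VanishFrom 1 (1 : MvPolynomial (Fin m) ℝ) := by
    simpa using! vanishFrom_monomial (0 : Fin m →₀ ℕ) 1
  change eval 0 _ = _
  rw [expQuarterHessian_eq_sum M h]
  simp

/-- The recursion and the value at `1` determine a functional on polynomials. -/
theorem functional_ext {M : Matrix (Fin m) (Fin m) ℝ} {F G : MvPolynomial (Fin m) ℝ →ₗ[ℝ] ℝ}
    (hF : ∀ j p, F (X j * p) = F (gradLin M j p)) (hG : ∀ j p, G (X j * p) = G (gradLin M j p))
    (h1 : F 1 = G 1) : F = G := by
  have key : ∀ k, ∀ p : MvPolynomial (Fin m) ℝ, VanishFrom k p → F p = G p := by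
    intro k
    induction k with
    | zero =>
      intro p hp
      have : p = 0 := by ext d; simpa using hp d (Nat.zero_le _)
      rw [this, map_zero, map_zero]
    | succ k ih =>
      intro p hp
      rw [p.as_sum, map_sum, map_sum]
      refine Finset.sum_congr rfl fun d hd => ?_
      have hdk : d.degree ≤ k := by
        by_contra! h
        exact (mem_support_iff.1 hd) (hp d h)
      by_cases h0 : d = 0
      · subst h0
        rw [← C_apply, C_eq_smul_one, map_smul, map_smul, h1]
      · obtain ⟨j, hj⟩ := Finsupp.ne_iff.1 h0
        obtain ⟨e, rfl⟩ : ∃ e, d = Finsupp.single j 1 + e := by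
          refine ⟨d - Finsupp.single j 1, (add_tsub_cancel_of_le ?_).symm⟩
          rw [Finsupp.single_le_iff]
          exact Nat.one_le_iff_ne_zero.2 hj
        rw [← one_mul (coeff _ p), ← monomial_mul, ← X, hF, hG]
        refine ih _ (((vanishFrom_monomial e _).gradLin M j).mono ?_)
        rw [map_add, Finsupp.degree_single] at hdk
        omega
  refine LinearMap.ext fun p => ?_
  obtain ⟨k, hk⟩ := exists_vanishFrom p
  exact key k p hk

end Hessian

/-! ### Gaussian integrals of polynomials -/

section Gaussian

open MvPolynomial

variable {m : ℕ}

/-- The quadratic form `∑ B_{st} ξ_s ξ_t`. -/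
def quadForm (B : Matrix (Fin m) (Fin m) ℝ) (ξ : Fin m → ℝ) : ℝ := ∑ s, ∑ t, ξ s * ξ t * B s t

/-- The polynomial `∑ B_{st} ξ_s ξ_t`. -/
def quadPoly (B : Matrix (Fin m) (Fin m) ℝ) : MvPolynomial (Fin m) ℝ :=
  ∑ s, ∑ t, B s t • (X s * X t)

theorem eval_quadPoly (B : Matrix (Fin m) (Fin m) ℝ) (ξ : Fin m → ℝ) :
    eval ξ (quadPoly B) = quadForm B ξ := by
  simp [quadPoly, quadForm, smul_eval, mul_comm]

theorem quadForm_eq_dotProduct (B : Matrix (Fin m) (Fin m) ℝ) (ξ : Fin m → ℝ) :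
    quadForm B ξ = dotProduct ξ (B.mulVec ξ) := by
  simp only [quadForm, dotProduct, Matrix.mulVec, Finset.mul_sum]
  exact Finset.sum_congr rfl fun s _ => Finset.sum_congr rfl fun t _ => by ring

theorem continuous_quadForm : Continuous fun p : Matrix (Fin m) (Fin m) ℝ × (Fin m → ℝ) =>
    quadForm p.1 p.2 := by
  unfold quadForm
  refine continuous_finsetSum _ fun s _ => continuous_finsetSum _ fun t _ => ?_
  have := (continuous_fst (X := Matrix (Fin m) (Fin m) ℝ) (Y := Fin m → ℝ)).matrix_elem s t
  fun_prop

theorem quadForm_smul (B : Matrix (Fin m) (Fin m) ℝ) (c : ℝ) (ξ : Fin m → ℝ) :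
    quadForm B (c • ξ) = c ^ 2 * quadForm B ξ := by
  simp only [quadForm, Finset.mul_sum, Pi.smul_apply, smul_eq_mul]
  exact Finset.sum_congr rfl fun s _ => Finset.sum_congr rfl fun t _ => by ring

/-- Coercivity, uniformly over a compact set of positive definite matrices. -/
theorem exists_quadForm_lower_bound {K : Set (Matrix (Fin m) (Fin m) ℝ)} (hK : IsCompact K)
    (hpos : ∀ B ∈ K, B.PosDef) :
    ∃ c > 0, ∀ B ∈ K, ∀ ξ, c * ∑ i, ξ i ^ 2 ≤ quadForm B ξ := by
  have hS : IsCompact {ξ : Fin m → ℝ | ∑ i, ξ i ^ 2 = 1} := by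
    refine (isCompact_Icc (a := (-1 : Fin m → ℝ)) (b := 1)).of_isClosed_subset
      (isClosed_eq (by fun_prop) continuous_const) fun ξ hξ => ?_
    have h1 : ∀ i, |ξ i| ≤ 1 := fun i => by
      rw [← sq_le_one_iff_abs_le_one, ← (show ∑ i, ξ i ^ 2 = 1 from hξ)]
      exact Finset.single_le_sum (fun j _ => sq_nonneg (ξ j)) (Finset.mem_univ i)
    exact ⟨fun i => (abs_le.1 (h1 i)).1, fun i => (abs_le.1 (h1 i)).2⟩
  have hqp : ∀ B ∈ K, ∀ ξ : Fin m → ℝ, ξ ≠ 0 → 0 < quadForm B ξ := fun B hB ξ hξ => by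
    rw [quadForm_eq_dotProduct]
    exact (hpos B hB).dotProduct_mulVec_pos hξ
  obtain ⟨c, hc, hcq⟩ : ∃ c > 0, ∀ B ∈ K, ∀ ξ : Fin m → ℝ, ∑ i, ξ i ^ 2 = 1 →
      c ≤ quadForm B ξ := by
    rcases (K ×ˢ {ξ : Fin m → ℝ | ∑ i, ξ i ^ 2 = 1}).eq_empty_or_nonempty with he | hne
    · refine ⟨1, one_pos, fun B hB ξ hξ => ?_⟩
      have : (B, ξ) ∈ K ×ˢ {ξ : Fin m → ℝ | ∑ i, ξ i ^ 2 = 1} := ⟨hB, hξ⟩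
      simp [he] at this
    · obtain ⟨⟨B₀, ξ₀⟩, ⟨hB₀, hξ₀⟩, hmin⟩ := (hK.prod hS).exists_isMinOn hne
        continuous_quadForm.continuousOn
      refine ⟨quadForm B₀ ξ₀, hqp B₀ hB₀ ξ₀ ?_, fun B hB ξ hξ => hmin (Set.mk_mem_prod hB hξ)⟩
      rintro rfl
      simp at hξ₀
  refine ⟨c, hc, fun B hB ξ => ?_⟩
  by_cases h0 : ξ = 0
  · subst h0; simp [quadForm]
  have hr : 0 < ∑ i, ξ i ^ 2 := by
    obtain ⟨i, hi⟩ := Function.ne_iff.1 h0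
    exact Finset.sum_pos' (fun j _ => sq_nonneg _)
      ⟨i, Finset.mem_univ i, sq_pos_of_ne_zero hi⟩
  set r := ∑ i, ξ i ^ 2 with hrdef
  have h1 : ∑ i, ((Real.sqrt r)⁻¹ • ξ) i ^ 2 = 1 := by
    simp only [Pi.smul_apply, smul_eq_mul, mul_pow, ← Finset.mul_sum, inv_pow, Real.sq_sqrt hr.le]
    exact inv_mul_cancel₀ hr.ne'
  have h2 := hcq B hB _ h1
  rw [quadForm_smul, inv_pow, Real.sq_sqrt hr.le, inv_mul_eq_div, le_div_iff₀ hr] at h2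
  exact h2

theorem integrable_monomial_mul_exp {c : ℝ} (hc : 0 < c) (γ : Fin m → ℕ) :
    Integrable fun ξ : Fin m → ℝ => (∏ i, |ξ i| ^ γ i) * Real.exp (-(c * ∑ i, ξ i ^ 2)) := by
  have h : ∀ i, Integrable fun x : ℝ => |x| ^ γ i * Real.exp (-c * x ^ 2) := fun i => by
    have h1 := (integrable_rpow_mul_exp_neg_mul_sq hc (s := γ i)
      (by linarith [Nat.cast_nonneg (α := ℝ) (γ i)])).norm
    refine h1.congr (ae_of_all _ fun x => ?_)
    simp
  refine (Integrable.fintype_prod h).congr (ae_of_all _ fun ξ => ?_)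
  simp only [Finset.prod_mul_distrib, ← Real.exp_sum, Finset.mul_sum, ← Finset.sum_neg_distrib,
    neg_mul]

theorem integrable_eval_mul_exp {B : Matrix (Fin m) (Fin m) ℝ} (hB : B.PosDef)
    (p : MvPolynomial (Fin m) ℝ) :
    Integrable fun ξ : Fin m → ℝ => eval ξ p * Real.exp (-quadForm B ξ) := by
  obtain ⟨c, hc, hcB⟩ := exists_quadForm_lower_bound (isCompact_singleton (x := B)) (by simpa)
  have hcont : Continuous (quadForm B) := continuous_quadForm.comp (Continuous.prodMk_right B)
  have hmon : ∀ d : Fin m →₀ ℕ,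
      Integrable fun ξ : Fin m → ℝ => coeff d p * ((∏ i, ξ i ^ d i) * Real.exp (-quadForm B ξ)) := by
    intro d
    refine Integrable.const_mul ((integrable_monomial_mul_exp hc d).mono'
      (Continuous.aestronglyMeasurable (by fun_prop)) (ae_of_all _ fun ξ => ?_)) _
    rw [norm_mul, norm_prod, Real.norm_of_nonneg (Real.exp_pos _).le]
    simp only [norm_pow, Real.norm_eq_abs]
    gcongr
    exact hcB B rfl ξ
  refine (integrable_finsetSum p.support fun d _ => hmon d).congr (ae_of_all _ fun ξ => ?_)
  simp only [eval_eq', Finset.sum_mul, mul_assoc]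

/-- The Gaussian functional `p ↦ ∫ p(ξ) e^{-∑ B_{st} ξ_s ξ_t} dξ`. -/
def gaussFunctional {B : Matrix (Fin m) (Fin m) ℝ} (hB : B.PosDef) :
    MvPolynomial (Fin m) ℝ →ₗ[ℝ] ℝ where
  toFun p := ∫ ξ : Fin m → ℝ, eval ξ p * Real.exp (-quadForm B ξ)
  map_add' p r := by
    rw [← integral_add (integrable_eval_mul_exp hB p) (integrable_eval_mul_exp hB r)]
    simp only [map_add, add_mul]
  map_smul' c p := by
    simp only [smul_eval, mul_assoc, integral_const_mul, RingHom.id_apply, smul_eq_mul]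

theorem hasLineDerivAt_eval (p : MvPolynomial (Fin m) ℝ) (i : Fin m) (x : Fin m → ℝ) :
    HasLineDerivAt ℝ (fun ξ => eval ξ p) (eval x (pderiv i p)) x (Pi.single i 1) := by
  induction p using MvPolynomial.induction_on with
  | C a => simpa [HasLineDerivAt] using hasDerivAt_const (0 : ℝ) a
  | add p r hp hr => simpa [HasLineDerivAt] using! HasDerivAt.add hp hr
  | mul_X p j hp =>
    have hX : HasDerivAt (fun t : ℝ => (x + t • (Pi.single i 1 : Fin m → ℝ)) j)
        ((Pi.single i 1 : Fin m → ℝ) j) 0 := by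
      simpa using!
        ((hasDerivAt_id (0 : ℝ)).mul_const ((Pi.single i 1 : Fin m → ℝ) j)).const_add (x j)
    have h := HasDerivAt.mul hp hX
    simp only [HasLineDerivAt, map_mul, eval_X]
    refine HasDerivAt.congr_deriv h ?_
    by_cases hij : j = i
    · subst hij; simp; ring
    · simp [hij, pderiv_X_of_ne hij, mul_comm]

theorem pderiv_quadPoly {B : Matrix (Fin m) (Fin m) ℝ} (hB : B.IsSymm) (i : Fin m) :
    pderiv i (quadPoly B) = (2 : ℝ) • ∑ k, B i k • X k := by
  have h : ∀ s t : Fin m, pderiv i (B s t • (X s * X t) : MvPolynomial (Fin m) ℝ) =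
      (if s = i then B s t • X t else 0) + if t = i then B s t • X s else 0 := by
    intro s t
    rw [Derivation.map_smul, pderiv_mul, pderiv_X, pderiv_X, smul_add]
    by_cases hs : s = i <;> by_cases ht : t = i <;> simp [hs, ht]
  rw [quadPoly, map_sum]
  simp_rw [map_sum, h, Finset.sum_add_distrib]
  rw [two_smul]
  congr 1
  · rw [Finset.sum_eq_single i (fun s _ hs => by simp [hs]) (by simp)]
    simp
  · refine Finset.sum_congr rfl fun s _ => ?_
    rw [Finset.sum_eq_single i (fun t _ ht => by simp [ht]) (by simp), if_pos rfl, hB.apply]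

/-- Integration by parts against the Gaussian weight. -/
theorem gaussFunctional_pderiv {B : Matrix (Fin m) (Fin m) ℝ} (hB : B.PosDef) (i : Fin m)
    (p : MvPolynomial (Fin m) ℝ) :
    gaussFunctional hB (pderiv i p) = gaussFunctional hB (pderiv i (quadPoly B) * p) := by
  have hexp : ∀ x, HasLineDerivAt ℝ (fun ξ => Real.exp (-quadForm B ξ))
      (Real.exp (-quadForm B x) * -eval x (pderiv i (quadPoly B))) x (Pi.single i 1) := by
    intro x
    have h := (HasDerivAt.neg (hasLineDerivAt_eval (quadPoly B) i x)).exp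
    simp only [eval_quadPoly] at h
    refine HasDerivAt.congr_deriv h ?_
    simp
  have h := integral_bilinear_hasLineDerivAt_right_eq_neg_left_of_integrable
    (μ := (volume : Measure (Fin m → ℝ))) (B := ContinuousLinearMap.mul ℝ ℝ)
    (f := fun ξ => Real.exp (-quadForm B ξ))
    (f' := fun ξ => Real.exp (-quadForm B ξ) * -eval ξ (pderiv i (quadPoly B)))
    (g := fun ξ => eval ξ p) (g' := fun ξ => eval ξ (pderiv i p)) (v := Pi.single i 1)
    ?_ ?_ ?_ (fun x _ => hexp x) (fun x _ => hasLineDerivAt_eval p i x)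
  · simp only [ContinuousLinearMap.mul_apply'] at h
    simp only [gaussFunctional, LinearMap.coe_mk, AddHom.coe_mk]
    simp_rw [mul_comm (eval _ _) (Real.exp _)]
    rw [h, ← integral_neg]
    refine integral_congr_ae (ae_of_all _ fun ξ => ?_)
    simp only [map_mul]
    ring
  · refine (integrable_eval_mul_exp hB (-(pderiv i (quadPoly B) * p))).congr
      (ae_of_all _ fun ξ => ?_)
    simp only [map_neg, map_mul, ContinuousLinearMap.mul_apply']
    ring
  · refine (integrable_eval_mul_exp hB (pderiv i p)).congr (ae_of_all _ fun ξ => ?_)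
    simp only [ContinuousLinearMap.mul_apply']
    ring
  · refine (integrable_eval_mul_exp hB p).congr (ae_of_all _ fun ξ => ?_)
    simp only [ContinuousLinearMap.mul_apply']
    ring

/-- The recursion that determines the Gaussian functional: integration by parts against
`∂_i e^{-B ξ·ξ} = -2 (B ξ)_i e^{-B ξ·ξ}`, solved for `ξ_j`. -/
theorem gaussFunctional_X_mul {B : Matrix (Fin m) (Fin m) ℝ} (hB : B.PosDef) (j : Fin m)
    (p : MvPolynomial (Fin m) ℝ) :
    gaussFunctional hB (X j * p) = gaussFunctional hB (gradLin B⁻¹ j p) := by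
  have hs : B.IsSymm := by simpa using hB.isHermitian
  have h1 : ∀ i, gaussFunctional hB (pderiv i p) =
      2 * ∑ k, B i k * gaussFunctional hB (X k * p) := fun i => by
    rw [gaussFunctional_pderiv, pderiv_quadPoly hs, smul_mul_assoc, map_smul, Finset.sum_mul,
      map_sum, smul_eq_mul]
    simp only [smul_mul_assoc, map_smul, smul_eq_mul]
  rw [gradLin_apply, map_smul, map_sum]
  simp only [map_smul, h1, smul_eq_mul]
  have h2 : ∑ i, B⁻¹ j i * (2 * ∑ k, B i k * gaussFunctional hB (X k * p)) =
      2 * ∑ k, (B⁻¹ * B) j k * gaussFunctional hB (X k * p) := by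
    simp only [Matrix.mul_apply, Finset.mul_sum, Finset.sum_mul]
    rw [Finset.sum_comm]
    exact Finset.sum_congr rfl fun _ _ => Finset.sum_congr rfl fun _ _ => by ring
  rw [h2, Matrix.nonsing_inv_mul _ (isUnit_iff_ne_zero.2 hB.det_pos.ne')]
  simp [Matrix.one_apply]

open scoped MatrixOrder Matrix.Norms.L2Operator in
/-- Write `B = SᵀS` and substitute `S ξ`. -/
theorem gaussFunctional_one {B : Matrix (Fin m) (Fin m) ℝ} (hB : B.PosDef) :
    gaussFunctional hB 1 = Real.pi ^ ((m : ℝ) / 2) / Real.sqrt B.det := by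
  obtain ⟨S, rfl⟩ := CStarAlgebra.nonneg_iff_eq_star_mul_self.1 hB.posSemidef.nonneg
  have hdet : (star S * S).det = S.det ^ 2 := by
    rw [Matrix.star_eq_conjTranspose, Matrix.det_mul, Matrix.det_conjTranspose, star_trivial, sq]
  have hS : S.det ≠ 0 := fun h => by
    have := hB.det_pos
    rw [hdet, h] at this
    simp at this
  have hq : ∀ ξ, quadForm (star S * S) ξ = ∑ i, (Matrix.toLin' S ξ) i ^ 2 := fun ξ => by
    rw [quadForm_eq_dotProduct, ← Matrix.mulVec_mulVec, Matrix.dotProduct_mulVec,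
      Matrix.star_eq_conjTranspose, Matrix.conjTranspose_eq_transpose_of_trivial,
      Matrix.vecMul_transpose, Matrix.toLin'_apply]
    simp only [dotProduct, sq]
  have hmain : ∫ ξ : Fin m → ℝ, Real.exp (-∑ i, ξ i ^ 2) = Real.pi ^ ((m : ℝ) / 2) := by
    have h := integral_fintype_prod_volume_eq_pow (ι := Fin m) (fun x : ℝ => Real.exp (-1 * x ^ 2))
    rw [integral_gaussian, div_one, Fintype.card_fin, Real.sqrt_eq_rpow, ← Real.rpow_natCast,
      ← Real.rpow_mul Real.pi_pos.le] at h
    rw [show (m : ℝ) / 2 = 1 / 2 * m by ring, ← h]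
    refine integral_congr_ae (ae_of_all _ fun ξ => ?_)
    simp only [← Real.exp_sum, neg_one_mul, Finset.sum_neg_distrib]
  have hmap := Real.map_matrix_volume_pi_eq_smul_volume_pi hS
  have hemb : Measurable (Matrix.toLin' S) :=
    (LinearMap.continuous_of_finiteDimensional _).measurable
  calc gaussFunctional hB 1 = ∫ ξ : Fin m → ℝ, Real.exp (-∑ i, (Matrix.toLin' S ξ) i ^ 2) := by
        simp [gaussFunctional, hq]
    _ = ∫ ξ, Real.exp (-∑ i, ξ i ^ 2) ∂(Measure.map (Matrix.toLin' S) volume) :=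
        (integral_map (f := fun ξ : Fin m → ℝ => Real.exp (-∑ i, ξ i ^ 2)) hemb.aemeasurable
          (Continuous.aestronglyMeasurable (by fun_prop))).symm
    _ = _ := by
        rw [hmap, integral_smul_measure, hmain, ENNReal.toReal_ofReal (abs_nonneg _), hdet,
          Real.sqrt_sq_eq_abs, abs_inv, smul_eq_mul, inv_mul_eq_div]

/-- Gaussian moments. Both sides are functionals of `p` with the same recursion and the same value at
`p = 1`. -/
theorem integral_eval_mul_exp {B : Matrix (Fin m) (Fin m) ℝ} (hB : B.PosDef)
    (p : MvPolynomial (Fin m) ℝ) :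
    ∫ ξ : Fin m → ℝ, eval ξ p * Real.exp (-quadForm B ξ) =
      Real.pi ^ ((m : ℝ) / 2) / Real.sqrt B.det * eval 0 (expQuarterHessian B⁻¹ p) := by
  have hs : B.IsSymm := by simpa using hB.isHermitian
  have hs' : (B⁻¹).IsSymm := by
    rw [Matrix.IsSymm, Matrix.transpose_nonsing_inv, hs.eq]
  have h := functional_ext (M := B⁻¹) (F := gaussFunctional hB)
    (G := (Real.pi ^ ((m : ℝ) / 2) / Real.sqrt B.det) • hessianFunctional B⁻¹)
    (gaussFunctional_X_mul hB)
    (fun j p => by simp only [LinearMap.smul_apply, hessianFunctional_X_mul hs'])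
    (by rw [gaussFunctional_one, LinearMap.smul_apply, hessianFunctional_one, smul_eq_mul, mul_one])
  exact LinearMap.congr_fun h p

end Gaussian

/-! ### Smoothness of the scalar functions near the joint spectrum -/

section Smoothness

variable {S : Type*} [TopologicalSpace S] {m : ℕ}

theorem isUnit_of_pos {f : C(S, ℝ)} (hf : ∀ u, 0 < f u) : IsUnit f :=
  ContinuousMap.isUnit_iff_forall_ne_zero f |>.2 fun u => (hf u).ne'

theorem inverse_apply {f : C(S, ℝ)} (hf : ∀ u, 0 < f u) (u : S) : Ring.inverse f u = (f u)⁻¹ := by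
  refine eq_inv_of_mul_eq_one_left ?_
  rw [← ContinuousMap.mul_apply, Ring.inverse_mul_cancel _ (isUnit_of_pos hf),
    ContinuousMap.one_apply]

/-- The value at `u` of a matrix of functions on `S`. -/
def evalMatrix (b : Matrix (Fin m) (Fin m) C(S, ℝ)) (u : S) : Matrix (Fin m) (Fin m) ℝ :=
  b.map fun f => f u

theorem det_evalMatrix (b : Matrix (Fin m) (Fin m) C(S, ℝ)) (u : S) :
    (evalMatrix b u).det = b.det u :=
  ((ContinuousMap.evalAlgHom ℝ ℝ u).toRingHom.map_det b).symm

theorem inv_evalMatrix {b : Matrix (Fin m) (Fin m) C(S, ℝ)} (hb : ∀ u, 0 < b.det u) (u : S) :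
    (evalMatrix b u)⁻¹ = evalMatrix b⁻¹ u := by
  have h := (ContinuousMap.evalAlgHom ℝ ℝ u).toRingHom.map_adjugate b
  have h' : (evalMatrix b u).adjugate = evalMatrix b.adjugate u := h.symm
  ext s t
  rw [Matrix.inv_def, h', det_evalMatrix, Ring.inverse_eq_inv']
  simp [evalMatrix, Matrix.inv_def, inverse_apply hb u]

variable [CompactSpace S]

/-- The pointwise square root on `C(S, ℝ)`. -/
def sqrtMap (f : C(S, ℝ)) : C(S, ℝ) := ⟨fun u => Real.sqrt (f u), by fun_prop⟩

theorem isOpen_setOf_pos : IsOpen {f : C(S, ℝ) | ∀ u, 0 < f u} := by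
  have := ContinuousMap.isOpen_setOfPred_mapsTo (X := S) (Y := ℝ) isCompact_univ (isOpen_Ioi (a := 0))
  simpa [Set.MapsTo] using this

/-- The square root is a local inverse of squaring, whose derivative `2a` is invertible at a
positive `a`. -/
theorem contDiffAt_sqrtMap {d : C(S, ℝ)} (hd : ∀ u, 0 < d u) : ContDiffAt ℝ (⊤ : ℕ∞) sqrtMap d := by
  set a := sqrtMap d with ha
  have hapos : ∀ u, 0 < a u := fun u => Real.sqrt_pos.2 (hd u)
  have had : a ^ 2 = d := by
    ext u
    exact Real.sq_sqrt (hd u).le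
  obtain ⟨v, hv⟩ := isUnit_of_pos (f := (2 : ℝ) • a) fun u => by
    have := hapos u
    simp only [ContinuousMap.coe_smul, Pi.smul_apply, smul_eq_mul]; positivity
  let e : C(S, ℝ) ≃L[ℝ] C(S, ℝ) := ContinuousLinearEquiv.equivOfInverse
    (ContinuousLinearMap.mul ℝ C(S, ℝ) v) (ContinuousLinearMap.mul ℝ C(S, ℝ) ↑v⁻¹)
    (fun x => by simp) (fun x => by simp)
  have hf : ContDiffAt ℝ (⊤ : ℕ∞) (fun f : C(S, ℝ) => f ^ 2) a := by fun_prop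
  have hf' : HasFDerivAt (fun f : C(S, ℝ) => f ^ 2) (e : C(S, ℝ) →L[ℝ] C(S, ℝ)) a := by
    refine ((hasFDerivAt_id a).pow 2).congr_fderiv ?_
    ext x u
    simp [e, hv]
    change 2 * a u * x u = _
    ring
  have hn : ((⊤ : ℕ∞) : WithTop ℕ∞) ≠ 0 := by simp
  have h := hf.to_localInverse hf' hn
  rw [had] at h
  refine h.congr_of_eventuallyEq ?_
  have h2 := (hf.hasStrictFDerivAt' hf' hn).localInverse_unique (g := sqrtMap) (by
    filter_upwards [isOpen_setOf_pos.mem_nhds hapos] with f hf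
    ext u
    exact Real.sqrt_sq (hf u).le)
  rw [had] at h2
  exact h2

variable {E : Type*} [NormedAddCommGroup E] [NormedSpace ℝ E] {x₀ : E}

theorem contDiffAt_inverse {f : E → C(S, ℝ)} (hf : ContDiffAt ℝ (⊤ : ℕ∞) f x₀) (hpos : ∀ u, 0 < f x₀ u) :
    ContDiffAt ℝ (⊤ : ℕ∞) (fun x => Ring.inverse (f x)) x₀ := by
  obtain ⟨v, hv⟩ := isUnit_of_pos hpos
  have h := contDiffAt_ringInverse ℝ (n := (⊤ : ℕ∞)) v
  rw [hv] at h
  exact h.comp x₀ hf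

theorem contDiffAt_det {b : E → Matrix (Fin m) (Fin m) C(S, ℝ)}
    (hb : ∀ s t, ContDiffAt ℝ (⊤ : ℕ∞) (fun x => b x s t) x₀) :
    ContDiffAt ℝ (⊤ : ℕ∞) (fun x => (b x).det) x₀ := by
  simp only [Matrix.det_apply]
  refine ContDiffAt.sum fun σ _ => ?_
  refine ContDiffAt.const_smul _ ?_
  exact contDiffAt_prod fun i _ => hb _ _

theorem contDiffAt_nonsingInv {b : E → Matrix (Fin m) (Fin m) C(S, ℝ)}
    (hb : ∀ s t, ContDiffAt ℝ (⊤ : ℕ∞) (fun x => b x s t) x₀) (hpos : ∀ u, 0 < (b x₀).det u) (s t : Fin m) :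
    ContDiffAt ℝ (⊤ : ℕ∞) (fun x => (b x)⁻¹ s t) x₀ := by
  simp only [Matrix.inv_def, Matrix.smul_apply, Matrix.adjugate_apply, smul_eq_mul]
  refine (contDiffAt_inverse (contDiffAt_det hb) hpos).mul (contDiffAt_det fun i j => ?_)
  by_cases h : i = t
  · subst h; simpa using contDiffAt_const
  · simpa [Matrix.updateRow_ne h] using hb i j

open MvPolynomial in
/-- The iterates of the quadratic differential operator have coefficients polynomial in the matrix
entries. -/
theorem exists_contDiffAt_hessianLin {c : E → Matrix (Fin m) (Fin m) C(S, ℝ)}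
    (hc : ∀ s t, ContDiffAt ℝ (⊤ : ℕ∞) (fun x => c x s t) x₀) (N : ℕ) :
    ∀ p : MvPolynomial (Fin m) ℝ, ∃ Q : E → C(S, ℝ), ContDiffAt ℝ (⊤ : ℕ∞) Q x₀ ∧
      ∀ x u, Q x u = eval 0 ((hessianLin (evalMatrix (c x) u) ^ N) p) := by
  induction N with
  | zero =>
    intro p
    exact ⟨fun _ => ContinuousMap.const S (eval 0 p), contDiffAt_const, fun x u => by simp⟩
  | succ N ih =>
    intro p
    choose Q hQ hQe using fun i j : Fin m => ih (pderiv i (pderiv j p))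
    refine ⟨fun x => (1 / 4 : ℝ) • ∑ i, ∑ j, c x i j * Q i j x, ?_, fun x u => ?_⟩
    · exact (ContDiffAt.sum fun i _ => ContDiffAt.sum fun j _ =>
        (hc i j).mul (hQ i j)).const_smul _
    · rw [pow_succ, Module.End.mul_apply, hessianLin_apply]
      simp [hQe, map_sum, evalMatrix]

open MvPolynomial in
theorem exists_contDiffAt_expQuarterHessian {c : E → Matrix (Fin m) (Fin m) C(S, ℝ)}
    (hc : ∀ s t, ContDiffAt ℝ (⊤ : ℕ∞) (fun x => c x s t) x₀) (p : MvPolynomial (Fin m) ℝ) :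
    ∃ Q : E → C(S, ℝ), ContDiffAt ℝ (⊤ : ℕ∞) Q x₀ ∧
      ∀ x u, Q x u = eval 0 (expQuarterHessian (evalMatrix (c x) u) p) := by
  obtain ⟨k, hk⟩ := exists_vanishFrom p
  choose Q hQ hQe using fun N : ℕ => exists_contDiffAt_hessianLin hc N p
  refine ⟨fun x => ∑ N ∈ Finset.range k, ((N ! : ℝ))⁻¹ • Q N x,
    ContDiffAt.sum fun N _ => (hQ N).const_smul _, fun x u => ?_⟩
  rw [expQuarterHessian_eq_sum _ hk]
  simp [ContinuousMap.sum_apply, hQe]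

end Smoothness

/-! ### Schwartz extensions -/

section Extension

open scoped Manifold

variable {m n : ℕ}

theorem coupledMatrix_eq_sum (Abar : Fin (n + 1) → Matrix (Fin m) (Fin m) ℝ) (u : Fin n → ℝ) :
    coupledMatrix Abar u = ∑ j, bary u j • Abar j := by
  simp [coupledMatrix, Fin.sum_univ_succ, bary]

theorem posDef_coupledMatrix {Abar : Fin (n + 1) → Matrix (Fin m) (Fin m) ℝ}
    (hA : ∀ j, (Abar j).PosDef) {u : Fin n → ℝ} (hu : u ∈ simplex n) :
    (coupledMatrix Abar u).PosDef := by
  have hs : ∀ j, (Abar j).IsHermitian := fun j => (hA j).isHermitian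
  rw [coupledMatrix_eq_sum]
  refine Matrix.PosDef.of_dotProduct_mulVec_pos ?_ fun ξ hξ => ?_
  · rw [Matrix.IsHermitian, Matrix.conjTranspose_sum]
    exact Finset.sum_congr rfl fun j _ => by
      rw [Matrix.conjTranspose_smul, (hs j).eq, star_trivial]
  · simp only [Matrix.sum_mulVec, dotProduct_sum, Matrix.smul_mulVec, dotProduct_smul,
      smul_eq_mul]
    have h0 := mem_simplex_iff.1 hu
    have hp : ∀ j, 0 < dotProduct (star ξ) ((Abar j).mulVec ξ) :=
      fun j => (hA j).dotProduct_mulVec_pos hξ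
    obtain ⟨j, hj⟩ : ∃ j, bary u j ≠ 0 := by
      by_contra! h
      have := sum_bary u
      simp [h] at this
    exact Finset.sum_pos' (fun i _ => mul_nonneg (h0 i) (hp i).le)
      ⟨j, Finset.mem_univ j, mul_pos ((h0 j).lt_of_ne' hj) (hp j)⟩

instance instCompactSpaceSimplex (n : ℕ) : CompactSpace (simplex n) := isCompact_iff_compactSpace.1 (isCompact_simplex n)

/-- Integration of a continuous function on the simplex against `ω_α`. -/
def omegaIntegral {α : Fin (n + 1) → ℝ} (hα : ∀ j, 0 < α j) : C(simplex n, ℝ) →L[ℝ] ℝ :=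
  have hi (f : C(simplex n, ℝ)) :
      Integrable (fun u : simplex n => omega α u * f u) (volume.comap Subtype.val) := by
    have h : Integrable (fun u : simplex n => omega α u) (volume.comap Subtype.val) := by
      have h1 : IntegrableOn (fun u => omega α u) (simplex n) := by
        simpa only [IntegrableOn] using! (integrableOn_omega hα).re
      exact (integrableOn_iff_comap_subtypeVal (isClosed_simplex n).measurableSet).1 h1
    refine (h.norm.mul_const ‖f‖).mono'
      (h.aestronglyMeasurable.mul f.continuous.aestronglyMeasurable) (ae_of_all _ fun u => ?_)
    rw [norm_mul]
    gcongr
    exact f.norm_coe_le_norm u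
  LinearMap.mkContinuous
    { toFun := fun f => ∫ u : simplex n, omega α u * f u ∂(volume.comap Subtype.val)
      map_add' := fun f g => by
        rw [← integral_add (hi f) (hi g)]
        simp only [ContinuousMap.add_apply, mul_add]
      map_smul' := fun c f => by
        simp only [ContinuousMap.smul_apply, smul_eq_mul, RingHom.id_apply, mul_left_comm _ c,
          integral_const_mul] }
    (∫ u : simplex n, ‖omega α u‖ ∂(volume.comap Subtype.val)) fun f => by
      rw [← integral_mul_const]
      refine norm_integral_le_of_norm_le ?_ (ae_of_all _ fun u => ?_)
      · have h := (hi 1).norm.mul_const ‖f‖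
        simpa using h
      · rw [norm_mul]
        gcongr
        exact f.norm_coe_le_norm u

theorem omegaIntegral_apply {α : Fin (n + 1) → ℝ} (hα : ∀ j, 0 < α j) (f : C(simplex n, ℝ))
    {F : (Fin n → ℝ) → ℝ} (hF : ∀ u : simplex n, F u = f u) :
    omegaIntegral hα f = ∫ u in simplex n, omega α u * F u := by
  rw [← integral_subtype_comap (isClosed_simplex n).measurableSet]
  simp only [hF]
  rfl

/-- `B_n(x, ·)` as a matrix of continuous functions on the simplex, depending linearly on the
matrix entries `x`. -/
def simplexMatrix (x : EuclideanSpace ℝ (Fin (n + 1) × (Fin m × Fin m))) :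
    Matrix (Fin m) (Fin m) C(simplex n, ℝ) :=
  Matrix.of fun s t => ∑ j, x (j, (s, t)) •
    (⟨fun u => bary (u : Fin n → ℝ) j,
      ((continuous_apply j).comp continuous_bary).comp continuous_subtype_val⟩ : C(simplex n, ℝ))

theorem evalMatrix_simplexMatrix (x : EuclideanSpace ℝ (Fin (n + 1) × (Fin m × Fin m)))
    (u : simplex n) : evalMatrix (simplexMatrix x) u =
      coupledMatrix (fun j => Matrix.of fun s t => x (j, (s, t))) u := by
  ext s t
  simp [coupledMatrix_eq_sum, simplexMatrix, evalMatrix, Matrix.sum_apply, mul_comm]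

theorem contDiff_simplexMatrix (s t : Fin m) :
    ContDiff ℝ (⊤ : ℕ∞) fun x : EuclideanSpace ℝ (Fin (n + 1) × (Fin m × Fin m)) =>
      simplexMatrix x s t := by
  simp only [simplexMatrix, Matrix.of_apply]
  refine ContDiff.sum fun j _ => ContDiff.smul (f := fun x : EuclideanSpace ℝ _ => x (j, (s, t))) ?_
    contDiff_const
  exact (EuclideanSpace.proj (𝕜 := ℝ) (j, (s, t))).contDiff

/-- The scalar function is smooth where `B_n(x, u)` stays nondegenerate: it is a continuous linear
functional of a smooth map into the Banach algebra of functions on the simplex. -/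
theorem contDiffAt_spectralF {α : Fin (n + 1) → ℝ} (hα : ∀ j, 0 < α j) (γ : Fin m →₀ ℕ)
    {x₀ : EuclideanSpace ℝ (Fin (n + 1) × (Fin m × Fin m))}
    (h₀ : ∀ u, 0 < (simplexMatrix x₀).det u) :
    ContDiffAt ℝ (⊤ : ℕ∞) (fun x : EuclideanSpace ℝ (Fin (n + 1) × (Fin m × Fin m)) =>
      spectralF α γ fun j i => x (j, i)) x₀ := by
  have hb := fun s t => (contDiff_simplexMatrix (n := n) (m := m) s t).contDiffAt (x := x₀)
  have hdet := contDiffAt_det hb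
  obtain ⟨Q, hQ, hQe⟩ := exists_contDiffAt_expQuarterHessian (contDiffAt_nonsingInv hb h₀)
    (MvPolynomial.monomial γ 1)
  have hsq : ContDiffAt ℝ (⊤ : ℕ∞) (fun x => sqrtMap (simplexMatrix (m := m) (n := n) x).det) x₀ :=
    ContDiffAt.comp x₀ (contDiffAt_sqrtMap h₀) hdet
  have hH := ((contDiffAt_inverse hsq fun u => Real.sqrt_pos.2 (h₀ u)).mul hQ).const_smul
    (Real.pi ^ ((m : ℝ) / 2))
  have hF := Complex.ofRealCLM.contDiff.contDiffAt.comp x₀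
    ((omegaIntegral hα).contDiff.contDiffAt.comp x₀ hH)
  refine hF.congr_of_eventuallyEq ?_
  filter_upwards [hdet.continuousAt.eventually (isOpen_setOf_pos.mem_nhds h₀)] with x hx
  have hx : ∀ u, 0 < (simplexMatrix x).det u := hx
  simp only [spectralF, scalarF, Function.comp_apply, Complex.ofRealCLM_apply, mul_assoc]
  congr 1
  symm
  refine omegaIntegral_apply hα _ fun u => ?_
  have h1 : ∀ u, 0 < sqrtMap (simplexMatrix x).det u := fun u => Real.sqrt_pos.2 (hx u)
  rw [← evalMatrix_simplexMatrix, det_evalMatrix, inv_evalMatrix hx, ← hQe]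
  simp only [ContinuousMap.smul_apply, ContinuousMap.mul_apply, inverse_apply h1, smul_eq_mul]
  rw [div_eq_mul_inv, mul_assoc]
  rfl

/-- A smooth function on an open set agrees near a compact subset with a Schwartz function: multiply by
a cutoff. -/
theorem exists_schwartz_eventuallyEq {E : Type*} [NormedAddCommGroup E] [NormedSpace ℝ E]
    [FiniteDimensional ℝ E] {K : Set E} (hK : IsCompact K) {F : E → ℂ} {V : Set E} (hV : IsOpen V)
    (hKV : K ⊆ V) (hF : ∀ x ∈ V, ContDiffAt ℝ (⊤ : ℕ∞) F x) :
    ∃ g : 𝓢(E, ℂ), ∀ᶠ x in 𝓝ˢ K, g x = F x := by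
  obtain ⟨T, hT, hKT, hTV⟩ := exists_compact_between hK hV hKV
  obtain ⟨χ, h1, h0, -⟩ := exists_contMDiffMap_one_nhds_of_subset_interior (n := (⊤ : ℕ∞))
    𝓘(ℝ, E) hK.isClosed hKT
  have hsupp : Function.support (fun x => (χ x : ℂ) * F x) ⊆ T := fun x hx => by
    by_contra h
    exact hx (by simp [h0 x h])
  have hts : tsupport (fun x => (χ x : ℂ) * F x) ⊆ T := closure_minimal hsupp hT.isClosed
  have hc : HasCompactSupport fun x => (χ x : ℂ) * F x :=
    HasCompactSupport.of_support_subset_isCompact hT hsupp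
  have hd : ContDiff ℝ (⊤ : ℕ∞) fun x => (χ x : ℂ) * F x := by
    rw [contDiff_iff_contDiffAt]
    intro x
    by_cases hx : x ∈ T
    · have hχ : ContDiffAt ℝ (⊤ : ℕ∞) (fun x => (χ x : ℂ)) x :=
        (Complex.ofRealCLM.contDiff.comp χ.contMDiff.contDiff).contDiffAt
      exact hχ.mul (hF x (hTV hx))
    · refine (contDiffAt_const (c := (0 : ℂ))).congr_of_eventuallyEq ?_
      exact notMem_tsupport_iff_eventuallyEq.1 fun h => hx (hts h)
  refine ⟨hc.toSchwartzMap hd, ?_⟩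
  filter_upwards [h1] with x hx
  simp [hx]

theorem exists_extension_spectralF {M : Set (Fin m × Fin m → ℝ)} (hM : IsCompact M)
    (hpos : ∀ x ∈ M, (Matrix.of fun s t => x (s, t)).PosDef) {α : Fin (n + 1) → ℝ}
    (hα : ∀ j, 0 < α j) (γ : Fin m →₀ ℕ) :
    ∃ g : 𝓢(EuclideanSpace ℝ (Fin (n + 1) × (Fin m × Fin m)), ℂ),
      ∀ᶠ x in 𝓝ˢ {x : EuclideanSpace ℝ (Fin (n + 1) × (Fin m × Fin m)) |
        ∀ j, (fun i => x (j, i)) ∈ M}, g x = spectralF α γ fun j i => x (j, i) := by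
  have hcomp : IsCompact {x : EuclideanSpace ℝ (Fin (n + 1) × (Fin m × Fin m)) |
      ∀ j, (fun i => x (j, i)) ∈ M} := by
    have h1 : IsCompact (Set.univ.pi fun _ : Fin (n + 1) => M) := isCompact_univ_pi fun _ => hM
    have h2 := h1.image (f := fun y : Fin (n + 1) → Fin m × Fin m → ℝ =>
      (WithLp.toLp 2 fun p => y p.1 p.2 : EuclideanSpace ℝ (Fin (n + 1) × (Fin m × Fin m))))
      (by fun_prop)
    convert h2 using 1
    ext x
    constructor
    · intro hx
      exact ⟨fun j i => x (j, i), fun j _ => hx j, rfl⟩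
    · rintro ⟨y, hy, rfl⟩ j
      exact hy j (Set.mem_univ j)
  have hcont : Continuous fun x : EuclideanSpace ℝ (Fin (n + 1) × (Fin m × Fin m)) =>
      (simplexMatrix x).det := by
    rw [continuous_iff_continuousAt]
    exact fun x => (contDiffAt_det fun s t => (contDiff_simplexMatrix s t).contDiffAt).continuousAt
  refine exists_schwartz_eventuallyEq hcomp (isOpen_setOf_pos.preimage hcont) ?_
    fun x hx => contDiffAt_spectralF hα γ hx
  intro x hx u
  rw [← det_evalMatrix, evalMatrix_simplexMatrix]
  exact (posDef_coupledMatrix (fun j => hpos _ (hx j)) u.2).det_pos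

end Extension

/-! ### The Schwartz functional calculus through the joint spectrum -/

section SchwartzCalculus

open scoped CStarAlgebra

variable {A : Type*} [CStarAlgebra A] {X : Type*} [TopologicalSpace X] [CompactSpace X] {n : ℕ}

theorem contraction_eq_prod (c : Fin (n + 1) → A) (r : Fin n → A) :
    contraction c r = (List.ofFn fun j => (Fin.cons 1 r : Fin (n + 1) → A) j * c j).prod := by
  simp [contraction, List.ofFn_succ]

/-- The multilinear map `(e_0, …, e_n) ↦ Θ(e_0) r_1 Θ(e_1) ⋯ r_n Θ(e_n)`. -/
def contractionMap (Θ : C(X, ℂ) →⋆ₐ[ℂ] A) (r : Fin n → A) :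
    ContinuousMultilinearMap ℂ (fun _ : Fin (n + 1) => C(X, ℂ)) A :=
  (ContinuousMultilinearMap.mkPiAlgebraFin ℂ (n + 1) A).compContinuousLinearMap fun j =>
    (ContinuousLinearMap.mul ℂ A ((Fin.cons 1 r : Fin (n + 1) → A) j)).comp
      ⟨Θ.toAlgHom.toLinearMap, map_continuous Θ⟩

theorem contractionMap_apply (Θ : C(X, ℂ) →⋆ₐ[ℂ] A) (r : Fin n → A) (e : Fin (n + 1) → C(X, ℂ)) :
    contractionMap Θ r e = contraction (fun j => Θ (e j)) r := by
  rw [contraction_eq_prod]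
  rfl

variable {ι : Type*}

/-- The `i`-th coordinate as a continuous function on `M ⊆ ℝ^ι`. -/
def coordMap (M : Set (ι → ℝ)) (i : ι) : C(M, ℂ) :=
  ⟨fun x => ((x : ι → ℝ) i : ℂ),
    Complex.continuous_ofReal.comp ((continuous_apply i).comp continuous_subtype_val)⟩

variable [Fintype ι]

/-- The plane wave `x ↦ e^{2π i ⟨ζ^{(j)}, x⟩}` on `M`. -/
def planeWave (M : Set (ι → ℝ)) [CompactSpace M] (j : Fin (n + 1)) (ζ : EuclideanSpace ℝ (Fin (n + 1) × ι)) :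
    C(M, ℂ) :=
  NormedSpace.exp (∑ i, (2 * Real.pi * I * (ζ (j, i) : ℂ)) • coordMap M i)

variable {M : Set (ι → ℝ)} [CompactSpace M]

theorem planeWave_apply (j : Fin (n + 1)) (ζ : EuclideanSpace ℝ (Fin (n + 1) × ι)) (x : M) :
    planeWave M j ζ x = cexp (((2 * Real.pi * ∑ i, ζ (j, i) * (x : ι → ℝ) i : ℝ) : ℂ) * I) := by
  let _ : NormedAlgebra ℚ C(M, ℂ) := NormedAlgebra.restrictScalars ℚ ℂ C(M, ℂ)
  have h := NormedSpace.map_exp (ContinuousMap.evalAlgHom ℂ ℂ x)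
    (ContinuousEvalConst.continuous_eval_const x)
    (∑ i, (2 * Real.pi * I * (ζ (j, i) : ℂ)) • coordMap M i)
  refine h.trans ?_
  rw [← Complex.exp_eq_exp_ℂ, map_sum]
  congr 1
  simp only [map_smul, smul_eq_mul]
  push_cast
  rw [Finset.mul_sum, Finset.sum_mul]
  refine Finset.sum_congr rfl fun i _ => ?_
  change _ * ((x : ι → ℝ) i : ℂ) = _
  ring

theorem norm_planeWave_le (j : Fin (n + 1)) (ζ : EuclideanSpace ℝ (Fin (n + 1) × ι)) :
    ‖planeWave M j ζ‖ ≤ 1 := by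
  rw [ContinuousMap.norm_le _ zero_le_one]
  intro x
  rw [planeWave_apply, Complex.norm_exp_ofReal_mul_I]

theorem continuous_planeWave (j : Fin (n + 1)) :
    Continuous (planeWave M j : EuclideanSpace ℝ (Fin (n + 1) × ι) → C(M, ℂ)) := by
  let _ : NormedAlgebra ℚ C(M, ℂ) := NormedAlgebra.restrictScalars ℚ ℂ C(M, ℂ)
  refine NormedSpace.exp_continuous.comp (continuous_finsetSum _ fun i _ => ?_)
  have : Continuous fun ζ : EuclideanSpace ℝ (Fin (n + 1) × ι) => ζ (j, i) := by fun_prop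
  fun_prop

theorem map_planeWave (Θ : C(M, ℂ) →⋆ₐ[ℂ] A) (j : Fin (n + 1))
    (ζ : EuclideanSpace ℝ (Fin (n + 1) × ι)) :
    Θ (planeWave M j ζ) =
      NormedSpace.exp (∑ i, (2 * Real.pi * I * (ζ (j, i) : ℂ)) • Θ (coordMap M i)) := by
  let _ : NormedAlgebra ℚ C(M, ℂ) := NormedAlgebra.restrictScalars ℚ ℂ C(M, ℂ)
  let _ : NormedAlgebra ℚ A := NormedAlgebra.restrictScalars ℚ ℂ A
  rw [planeWave, NormedSpace.map_exp Θ (map_continuous Θ), map_sum]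
  simp only [map_smul]

/-- The Schwartz functional calculus depends only on the values of `g` on `M^{n+1}`. -/
theorem represents_schwartzFunCalc (Θ : C(M, ℂ) →⋆ₐ[ℂ] A) {a : ι → A}
    (hΘ : ∀ i, Θ (coordMap M i) = a i) (g : 𝓢(EuclideanSpace ℝ (Fin (n + 1) × ι), ℂ))
    (r : Fin n → A) :
    Represents (contractionMap Θ r)
      (fun y => g (WithLp.toLp 2 fun p => (y p.1 : ι → ℝ) p.2)) (schwartzFunCalc a g r) := by
  have h := (represents_integral (L := contractionMap Θ r) (τ := volume) (w := fun ζ => (𝓕 g) ζ)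
    (e := fun j ζ => planeWave M j ζ) (D := fun ζ => ‖(𝓕 g) ζ‖)
    (𝓕 g).continuous.aestronglyMeasurable (fun j => continuous_planeWave j) (𝓕 g).integrable.norm
    (ae_of_all _ fun ζ => ?_)).2
  · convert h using 1
    · funext y
      have h1 : g = 𝓕⁻ (𝓕 g) := (FourierTransform.fourierInv_fourier_eq g).symm
      conv_lhs => rw [h1, SchwartzMap.fourierInv_coe, Real.fourierInv_eq']
      refine integral_congr_ae (ae_of_all _ fun ζ => ?_)
      simp only [planeWave_apply, ← Complex.exp_sum, smul_eq_mul]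
      rw [mul_comm, ← Finset.sum_mul, ← Complex.ofReal_sum, ← Finset.mul_sum]
      congr 5
      simp only [PiLp.inner_apply, RCLike.inner_apply, conj_trivial, Fintype.sum_prod_type]
      exact Finset.sum_congr rfl fun _ _ => Finset.sum_congr rfl fun _ _ => mul_comm _ _
    · simp only [schwartzFunCalc, contractionMap_apply, map_planeWave, hΘ]
  · refine mul_le_of_le_one_right (norm_nonneg _) ?_
    exact Finset.prod_le_one (fun _ _ => norm_nonneg _) fun j _ => norm_planeWave_le j ζ

end SchwartzCalculus

/-! ### Powers of the resolvent -/

section Resolvent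

open scoped CStarAlgebra

variable {A : Type*} [CStarAlgebra A] {X : Type*} [PseudoMetricSpace X]

/-- The inverse of `Θ(q) - i t` is the image of `(q - i t)⁻¹`; the real function `q` enters as the
complex function `Q`. -/
theorem inverse_map_sub (Θ : C(X, ℂ) →⋆ₐ[ℂ] A) {q : C(X, ℝ)} (hq : ∀ x, 0 < q x) (t : ℝ)
    {Q : C(X, ℂ)} (hQ : ∀ x, Q x = q x) :
    Ring.inverse (Θ Q - algebraMap ℂ A (I * t)) = Θ (resPow q hq 1 t) := by
  have h1 : Θ Q - algebraMap ℂ A (I * t) = Θ (Q - algebraMap ℂ _ (I * t)) := by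
    rw [map_sub, AlgHomClass.commutes]
  have h2 : (Q - algebraMap ℂ C(X, ℂ) (I * t)) * resPow q hq 1 t = 1 := by
    ext x
    have : (q x - I * t : ℂ) ≠ 0 := slitPlane_ne_zero (sub_I_mul_mem_slitPlane (hq x) t)
    simp only [ContinuousMap.mul_apply, ContinuousMap.sub_apply, hQ, ContinuousMap.one_apply]
    change (q x - I * t : ℂ) * (q x - I * t : ℂ) ^ (-(1 : ℝ) : ℂ) = 1
    rw [Complex.ofReal_one, Complex.cpow_neg_one, mul_inv_cancel₀ this]
  rw [h1]
  exact Ring.inverse_unit ⟨Θ (Q - algebraMap ℂ _ (I * t)), Θ (resPow q hq 1 t),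
    by rw [← map_mul, h2, map_one], by rw [← map_mul, mul_comm, h2, map_one]⟩

variable [CompactSpace X]

/-- Continuous functional calculus in `C(X, ℂ)` is composition of functions. -/
theorem cfc_apply_of_continuousMap {f : ℂ → ℂ} {g : C(X, ℂ)} (hf : ContinuousOn f (spectrum ℂ g))
    (x : X) : cfc f g x = f (g x) := by
  have h := StarAlgHomClass.map_cfc (S := ℂ) (ContinuousMap.evalStarAlgHom ℂ ℂ x) f g hf
    (ContinuousEvalConst.continuous_eval_const x) (IsStarNormal.mk (Commute.all _ _))
    (IsStarNormal.mk (Commute.all _ _))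
  refine h.trans ?_
  have h2 := cfc_algebraMap (A := ℂ) (g x) f
  simpa using h2

/-- The principal powers of `(q - i t)⁻¹` are those of `q - i t` with the opposite exponent, as the real
part is positive. -/
theorem realPow_map_resPow (Θ : C(X, ℂ) →⋆ₐ[ℂ] A) {q : C(X, ℝ)} (hq : ∀ x, 0 < q x) (a t : ℝ) :
    realPow (Θ (resPow q hq 1 t)) a = Θ (resPow q hq a t) := by
  have hval : ∀ x, resPow q hq 1 t x = (q x - I * t : ℂ)⁻¹ := fun x => by
    simp [resPow, Complex.cpow_neg_one]
  have hslit : ∀ x, (q x - I * t : ℂ)⁻¹ ∈ slitPlane := fun x => by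
    refine Or.inl ?_
    rw [Complex.inv_re]
    exact div_pos (by simpa using hq x)
      (Complex.normSq_pos.2 (slitPlane_ne_zero (sub_I_mul_mem_slitPlane (hq x) t)))
  have hcont : ContinuousOn (fun w : ℂ => w ^ (a : ℂ)) (spectrum ℂ (resPow q hq 1 t)) := by
    rw [ContinuousMap.spectrum_eq_range]
    rintro _ ⟨x, rfl⟩
    refine ContinuousAt.continuousWithinAt ?_
    refine ContinuousAt.cpow continuousAt_id continuousAt_const ?_
    rw [hval]
    exact hslit x
  have hn : IsStarNormal (resPow q hq 1 t) := IsStarNormal.mk (Commute.all _ _)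
  rw [realPow, ← StarAlgHomClass.map_cfc (S := ℂ) Θ _ _ hcont (map_continuous Θ) hn (hn.map Θ)]
  congr 1
  ext x
  rw [cfc_apply_of_continuousMap hcont, hval]
  change _ = (q x - I * t : ℂ) ^ (-a : ℂ)
  rw [Complex.inv_cpow _ _ (Complex.slitPlane_arg_ne_pi (sub_I_mul_mem_slitPlane (hq x) t)),
    Complex.cpow_neg]

end Resolvent

/-! ### The Gaussian integral over `ξ` -/

section GaussianAverage

variable {m : ℕ} (M : Set (Fin m × Fin m → ℝ))

/-- The matrix with the entries `x`. -/
def toMatrix (x : Fin m × Fin m → ℝ) : Matrix (Fin m) (Fin m) ℝ := Matrix.of fun s t => x (s, t)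

theorem continuous_toMatrix : Continuous (toMatrix (m := m)) :=
  continuous_matrix fun s t => continuous_apply (s, t)

/-- The function `x ↦ ∑ x_{st} ξ_s ξ_t` on `M`. -/
def quadMap (ξ : Fin m → ℝ) : C(M, ℝ) where
  toFun x := quadForm (toMatrix x) ξ
  continuous_toFun := continuous_quadForm.comp
    ((continuous_toMatrix.comp continuous_subtype_val).prodMk continuous_const)

variable {M}

theorem exists_quadMap_lower_bound [CompactSpace M] (hpos : ∀ x ∈ M, (toMatrix x).PosDef) :
    ∃ c > 0, ∀ ξ x, c * ∑ i, ξ i ^ 2 ≤ quadMap M ξ x := by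
  have hM : IsCompact M := isCompact_iff_compactSpace.2 inferInstance
  obtain ⟨c, hc, h⟩ := exists_quadForm_lower_bound (hM.image continuous_toMatrix)
    (by rintro _ ⟨x, hx, rfl⟩; exact hpos x hx)
  exact ⟨c, hc, fun ξ x => h _ ⟨x, x.2, rfl⟩ ξ⟩

theorem quadMap_pos (hpos : ∀ x ∈ M, (toMatrix x).PosDef) {ξ : Fin m → ℝ} (hξ : ξ ≠ 0) (x : M) :
    0 < quadMap M ξ x := by
  change 0 < quadForm _ _
  rw [quadForm_eq_dotProduct]
  exact (hpos x x.2).dotProduct_mulVec_pos hξ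

theorem continuous_heatExp_quadMap : Continuous fun p : (Fin m → ℝ) × ℝ =>
    heatExp (quadMap M p.1) p.2 := by
  refine ContinuousMap.continuous_of_continuous_uncurry _ ?_
  have h : Continuous fun p : ((Fin m → ℝ) × ℝ) × M => quadForm (toMatrix p.2) p.1.1 :=
    continuous_quadForm.comp
      (((continuous_toMatrix.comp continuous_subtype_val).comp continuous_snd).prodMk
        (continuous_fst.comp continuous_fst))
  change Continuous fun p : ((Fin m → ℝ) × ℝ) × M =>
    cexp (-(p.1.2 * quadForm (toMatrix p.2) p.1.1 : ℝ))
  fun_prop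

variable {n : ℕ}

theorem quadForm_coupledMatrix (B : Fin (n + 1) → Matrix (Fin m) (Fin m) ℝ) (u : Fin n → ℝ)
    (ξ : Fin m → ℝ) : quadForm (coupledMatrix B u) ξ = ∑ j, bary u j * quadForm (B j) ξ := by
  simp only [coupledMatrix_eq_sum, quadForm_eq_dotProduct, Matrix.sum_mulVec, dotProduct_sum,
    Matrix.smul_mulVec, dotProduct_smul, smul_eq_mul]

variable {A : Type*} [NormedAddCommGroup A] [NormedSpace ℂ A] [CompleteSpace A] [CompactSpace M]
  (L : ContinuousMultilinearMap ℂ (fun _ : Fin (n + 1) => C(M, ℂ)) A)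

/-- Integrating `ξ^γ` times the heat averages over `ξ` gives the value at `spectralF α γ`. -/
theorem represents_integral_heatAverage (hpos : ∀ x ∈ M, (toMatrix x).PosDef)
    {α : Fin (n + 1) → ℝ} (hα : ∀ j, 0 < α j) (γ : Fin m →₀ ℕ) :
    Integrable (fun ξ : Fin m → ℝ =>
      ((∏ i, ξ i ^ γ i : ℝ) : ℂ) • heatAverage L (quadMap M ξ) α) ∧
    Represents L (fun y => spectralF α γ fun j => y j)
      (∫ ξ : Fin m → ℝ, ((∏ i, ξ i ^ γ i : ℝ) : ℂ) • heatAverage L (quadMap M ξ) α) := by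
  obtain ⟨c, hc, hcq⟩ := exists_quadMap_lower_bound hpos
  have hω := integrableOn_omega hα
  set τ : Measure ((Fin m → ℝ) × (Fin n → ℝ)) := volume.prod (volume.restrict (simplex n)) with hτ
  have hτ' : ∀ᵐ p ∂τ, p.2 ∈ simplex n := by
    have : τ = (volume.prod volume).restrict (Set.univ ×ˢ simplex n) := by
      rw [← Measure.prod_restrict, Measure.restrict_univ]
    rw [this]
    exact (ae_restrict_mem (MeasurableSet.univ.prod (isClosed_simplex n).measurableSet)).mono
      fun p hp => hp.2
  have hD : Integrable (fun p : (Fin m → ℝ) × (Fin n → ℝ) =>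
      ((∏ i, |p.1 i| ^ γ i) * Real.exp (-(c * ∑ i, p.1 i ^ 2))) * ‖(omega α p.2 : ℂ)‖) τ :=
    (integrable_monomial_mul_exp hc γ).mul_prod hω.norm
  have hmono : Continuous fun p : (Fin m → ℝ) × (Fin n → ℝ) => ((∏ i, p.1 i ^ γ i : ℝ) : ℂ) := by
    fun_prop
  have hw : AEStronglyMeasurable (fun p : (Fin m → ℝ) × (Fin n → ℝ) =>
      ((∏ i, p.1 i ^ γ i : ℝ) : ℂ) * (omega α p.2 : ℂ)) τ :=
    hmono.aestronglyMeasurable.mul hω.aestronglyMeasurable.comp_snd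
  have hbd : ∀ p : (Fin m → ℝ) × (Fin n → ℝ), p.2 ∈ simplex n →
      ‖((∏ i, p.1 i ^ γ i : ℝ) : ℂ) * (omega α p.2 : ℂ)‖ *
        ∏ j, ‖heatExp (quadMap M p.1) (bary p.2 j)‖ ≤
      ((∏ i, |p.1 i| ^ γ i) * Real.exp (-(c * ∑ i, p.1 i ^ 2))) * ‖(omega α p.2 : ℂ)‖ := by
    intro p hp
    have h1 := prod_norm_heatExp_le (hcq p.1) hp
    rw [norm_mul, Complex.norm_real, norm_prod]
    simp only [norm_pow, Real.norm_eq_abs]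
    calc _ ≤ (∏ i, |p.1 i| ^ γ i) * ‖(omega α p.2 : ℂ)‖ * Real.exp (-(c * ∑ i, p.1 i ^ 2)) := by
          gcongr
      _ = _ := by ring
  obtain ⟨hi, hr⟩ := represents_integral (L := L) (τ := τ) hw
    (e := fun j p => heatExp (quadMap M p.1) (bary p.2 j))
    (fun j => continuous_heatExp_quadMap.comp (continuous_fst.prodMk
      ((continuous_apply j).comp (continuous_bary.comp continuous_snd))))
    hD (hτ'.mono hbd)
  -- The integrand of the double integral, integrated over the simplex first; below, the scalar
  -- version is integrated over `ξ` first.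
  have hfub : ∀ ξ : Fin m → ℝ, ∫ u in simplex n, (((∏ i, ξ i ^ γ i : ℝ) : ℂ) * (omega α u : ℂ)) •
      L (fun j => heatExp (quadMap M ξ) (bary u j)) =
      ((∏ i, ξ i ^ γ i : ℝ) : ℂ) • heatAverage L (quadMap M ξ) α := fun ξ => by
    simp only [mul_smul, integral_smul, heatAverage]
  refine ⟨hi.integral_prod_left.congr (ae_of_all _ hfub), ?_⟩
  rw [integral_prod _ hi] at hr
  simp only [hfub] at hr
  convert hr using 1
  funext y
  have hsc : Integrable (fun p : (Fin m → ℝ) × (Fin n → ℝ) =>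
      ((∏ i, p.1 i ^ γ i : ℝ) : ℂ) * (omega α p.2 : ℂ) *
        ∏ j, heatExp (quadMap M p.1) (bary p.2 j) (y j)) τ := by
    refine hD.mono' (hw.mul (Continuous.aestronglyMeasurable ?_)) (hτ'.mono fun p hp => ?_)
    · exact continuous_finsetProd _ fun j _ =>
        (continuous_eval_const (F := C(M, ℂ)) (y j)).comp
          (continuous_heatExp_quadMap.comp (continuous_fst.prodMk
            ((continuous_apply j).comp (continuous_bary.comp continuous_snd))))
    · refine le_trans ?_ (hbd p hp)
      rw [norm_mul, norm_prod]
      gcongr with j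
      exact ContinuousMap.norm_coe_le_norm _ _
  rw [integral_prod_symm _ hsc, spectralF, scalarF, ← integral_complex_ofReal]
  refine setIntegral_congr_fun (isClosed_simplex n).measurableSet fun u hu => ?_
  have hB := posDef_coupledMatrix (fun j => hpos (y j) (y j).2) hu
  have hG := integral_eval_mul_exp hB (MvPolynomial.monomial γ 1)
  simp only [prod_heatExp]
  have hq : ∀ ξ : Fin m → ℝ, ((∏ i, ξ i ^ γ i : ℝ) : ℂ) * (omega α u : ℂ) *
      cexp (-(∑ j, bary u j * quadMap M ξ (y j) : ℝ)) =
      (omega α u : ℂ) * ((MvPolynomial.eval ξ (MvPolynomial.monomial γ 1) *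
        Real.exp (-quadForm (coupledMatrix (fun j => toMatrix (y j)) u) ξ) : ℝ) : ℂ) := by
    intro ξ
    rw [quadForm_coupledMatrix, MvPolynomial.eval_monomial, one_mul, Finsupp.prod_fintype _ _
      (fun i => pow_zero _)]
    push_cast
    rw [mul_comm (∏ i, _), mul_assoc]
    rfl
  simp only [hq]
  rw [integral_const_mul, integral_complex_ofReal, hG]
  push_cast
  rw [mul_assoc]
  rfl

end GaussianAverage

/-! ### The rearrangement formula -/

section Main

open scoped CStarAlgebra

variable {A : Type*} [CStarAlgebra A] {m n : ℕ}

/-- The contraction as a multilinear map of the factors `r_1, …, r_n`. -/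
def contractionMultilinear (c : Fin (n + 1) → A) : MultilinearMap ℂ (fun _ : Fin n => A) A :=
  (LinearMap.mulLeft ℂ (c 0)).compMultilinearMap
    ((MultilinearMap.mkPiAlgebraFin ℂ n A).compLinearMap fun j => LinearMap.mulRight ℂ (c j.succ))

/-- Expansion of the symbols into monomials in `ξ`. -/
theorem contraction_eval (c : Fin (n + 1) → A) (ρ : Fin n → PolySymbol m A) (ξ : Fin m → ℝ) :
    contraction c (fun j => (ρ j).eval ξ) =
      ∑ β ∈ Fintype.piFinset fun j => (ρ j).support,
        ((∏ i, ξ i ^ (∑ j, β j) i : ℝ) : ℂ) • contraction c fun j => ρ j (β j) := by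
  have h := (contractionMultilinear c).map_sum_finset
    (fun j β => ((∏ i, ξ i ^ β i : ℝ) : ℂ) • ρ j β) (fun j => (ρ j).support)
  refine h.trans (Finset.sum_congr rfl fun β _ => ?_)
  rw [(contractionMultilinear c).map_smul_univ, ← Complex.ofReal_prod, Finset.prod_comm]
  simp only [Finset.prod_pow_eq_pow_sum, Finsupp.coe_finsetSum, Finset.sum_apply]
  rfl

variable {k : Matrix (Fin m) (Fin m) A}

/-- The leading symbol is the image of the quadratic form `q_ξ` under the functional calculus. -/
theorem map_quadMap {M : Set (Fin m × Fin m → ℝ)} (Θ : C(M, ℂ) →⋆ₐ[ℂ] A)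
    (hΘ : ∀ i, Θ (coordMap M i) = entries k i) (ξ : Fin m → ℝ) :
    ∃ Q : C(M, ℂ), (∀ x, Q x = quadMap M ξ x) ∧ Θ Q = leadingSymbol k ξ := by
  refine ⟨∑ s, ∑ t, ((ξ s * ξ t : ℝ) : ℂ) • coordMap M (s, t), fun x => ?_, ?_⟩
  · simp [coordMap, quadMap, quadForm, toMatrix, ContinuousMap.sum_apply]
  · simp only [map_sum, map_smul, hΘ]
    rfl

theorem resolventTerm_eq {M : Set (Fin m × Fin m → ℝ)} [CompactSpace M] (Θ : C(M, ℂ) →⋆ₐ[ℂ] A)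
    (hΘ : ∀ i, Θ (coordMap M i) = entries k i) {ξ : Fin m → ℝ} (hq : ∀ x, 0 < quadMap M ξ x)
    (α : Fin (n + 1) → ℝ) (ρ : Fin n → PolySymbol m A) (t : ℝ) :
    resolventTerm k α ρ ξ (I * t) = ∑ β ∈ Fintype.piFinset fun j => (ρ j).support,
        ((∏ i, ξ i ^ (∑ j, β j) i : ℝ) : ℂ) •
          contractionMap Θ (fun j => ρ j (β j)) fun j => resPow (quadMap M ξ) hq (α j) t := by
  obtain ⟨Q, hQ, hQk⟩ := map_quadMap Θ hΘ ξ
  have hb : b₀ k ξ (I * t) = Θ (resPow (quadMap M ξ) hq 1 t) := by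
    rw [b₀, ← hQk, inverse_map_sub Θ hq t hQ]
  rw [resolventTerm, contraction_eval]
  simp only [hb, realPow_map_resPow, contractionMap_apply]

/-- The value of the Schwartz functional calculus on every Schwartz extension of `spectralF α γ`. -/
theorem schwartzFunCalc_eq [CompactSpace (jointSpectrum (entries k))]
    (hpos : ∀ x ∈ jointSpectrum (entries k), (toMatrix x).PosDef)
    (Θ : C(jointSpectrum (entries k), ℂ) →⋆ₐ[ℂ] A) (hΘ : ∀ i, Θ (coordMap _ i) = entries k i)
    {α : Fin (n + 1) → ℝ} (hα : ∀ j, 0 < α j) {γ : Fin m →₀ ℕ}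
    {g : 𝓢(EuclideanSpace ℝ (Fin (n + 1) × (Fin m × Fin m)), ℂ)}
    (hg : Extends (entries k) (spectralF α γ) g) (r : Fin n → A) :
    schwartzFunCalc (entries k) g r =
      ∫ ξ : Fin m → ℝ, ((∏ i, ξ i ^ γ i : ℝ) : ℂ) •
        heatAverage (contractionMap Θ r) (quadMap (jointSpectrum (entries k)) ξ) α := by
  refine (represents_schwartzFunCalc Θ hΘ g r).unique ?_
  convert (represents_integral_heatAverage (contractionMap Θ r) hpos hα γ).2 using 1
  funext y
  exact hg.self_of_nhdsSet _ fun j => (y j).2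

theorem isSmoothFunCalc_spectralF [CompactSpace (jointSpectrum (entries k))]
    (hpos : ∀ x ∈ jointSpectrum (entries k), (toMatrix x).PosDef)
    (Θ : C(jointSpectrum (entries k), ℂ) →⋆ₐ[ℂ] A) (hΘ : ∀ i, Θ (coordMap _ i) = entries k i)
    {α : Fin (n + 1) → ℝ} (hα : ∀ j, 0 < α j) (γ : Fin m →₀ ℕ) :
    IsSmoothFunCalc (entries k) (spectralF α γ) fun r : Fin n → A =>
      ∫ ξ : Fin m → ℝ, ((∏ i, ξ i ^ γ i : ℝ) : ℂ) •
        heatAverage (contractionMap Θ r) (quadMap (jointSpectrum (entries k)) ξ) α :=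
  ⟨exists_extension_spectralF (isCompact_iff_compactSpace.2 inferInstance) hpos hα γ,
    fun _ hg r => schwartzFunCalc_eq hpos Θ hΘ hα hg r⟩

theorem IsSmoothFunCalc.smoothFunCalc_eq {ι : Type*} [Fintype ι] {a : ι → A}
    {f : (Fin (n + 1) → ι → ℝ) → ℂ} {Φ : (Fin n → A) → A} (h : IsSmoothFunCalc a f Φ) :
    smoothFunCalc a f = Φ := by
  have hex : ∃ Φ, IsSmoothFunCalc a f Φ := ⟨Φ, h⟩
  obtain ⟨g, hg⟩ := h.1
  rw [smoothFunCalc, dif_pos hex]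
  funext r
  rw [← hex.choose_spec.2 g hg, h.2 g hg]

/-- The rearrangement formula in a general `C*`-algebra, for a matrix with commuting self-adjoint
entries whose joint spectrum consists of positive definite matrices. -/
theorem rearrangement (hsa : ∀ i, IsSelfAdjoint (entries k i))
    (hc : ∀ i j, Commute (entries k i) (entries k j))
    (hpos : ∀ x ∈ jointSpectrum (entries k), (toMatrix x).PosDef)
    {α : Fin (n + 1) → ℝ} (hα : ∀ j, 0 < α j) (ρ : Fin n → PolySymbol m A) :
    (∀ γ : Fin m →₀ ℕ, ∃ Φ : (Fin n → A) → A, IsSmoothFunCalc (entries k) (spectralF α γ) Φ) ∧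
    ∃ G : (Fin m → ℝ) → A,
      (∀ ξ, ξ ≠ 0 → HasImaginaryAxisIntegral
        (fun z => cexp (-z) • resolventTerm k α ρ ξ z) (G ξ)) ∧
      Integrable G volume ∧
      (1 / (2 * (Real.pi : ℂ) * I)) • ∫ ξ, G ξ = FAtZero α k ρ := by
  obtain ⟨hcpt, Θ, hΘ⟩ := jointSpectrum_calculus (entries k) hsa hc
  have : CompactSpace (jointSpectrum (entries k)) := isCompact_iff_compactSpace.1 hcpt
  have hcalc := fun γ => isSmoothFunCalc_spectralF hpos Θ hΘ hα γ
  refine ⟨fun γ => ⟨_, hcalc γ⟩, ?_⟩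
  let M := jointSpectrum (entries k)
  let B := Fintype.piFinset fun j => (ρ j).support
  let L : (Fin n → (Fin m →₀ ℕ)) → ContinuousMultilinearMap ℂ (fun _ : Fin (n + 1) => C(M, ℂ)) A :=
    fun β => contractionMap Θ fun j => ρ j (β j)
  have hint := fun β => (represents_integral_heatAverage (L β) hpos hα (∑ j, β j)).1
  refine ⟨fun ξ => (2 * Real.pi * I : ℂ) • ∑ β ∈ B, ((∏ i, ξ i ^ (∑ j, β j) i : ℝ) : ℂ) •
    heatAverage (L β) (quadMap M ξ) α, fun ξ hξ => ?_,
    (integrable_finsetSum B fun β _ => hint β).fun_smul (2 * Real.pi * I : ℂ), ?_⟩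
  · obtain ⟨c, hc0, hcq⟩ := exists_quadMap_lower_bound hpos
    have hq := quadMap_pos hpos hξ
    have hcpos : 0 < c * ∑ i, ξ i ^ 2 := by
      obtain ⟨i, hi⟩ := Function.ne_iff.1 hξ
      exact mul_pos hc0 (Finset.sum_pos' (fun _ _ => sq_nonneg _)
        ⟨i, Finset.mem_univ i, sq_pos_of_ne_zero hi⟩)
    have hterm : ∀ t : ℝ, I • cexp (-(I * t)) • resolventTerm k α ρ ξ (I * t) =
        ∑ β ∈ B, ((∏ i, ξ i ^ (∑ j, β j) i : ℝ) : ℂ) •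
          (I • cexp (-(I * t)) • L β fun j => resPow (quadMap M ξ) hq (α j) t) := fun t => by
      rw [resolventTerm_eq Θ hΘ hq, Finset.smul_sum, Finset.smul_sum]
      refine Finset.sum_congr rfl fun β _ => ?_
      rw [smul_comm _ ((∏ i, ξ i ^ (∑ j, β j) i : ℝ) : ℂ), smul_comm I]
    have hii : ∀ (β) (a b : ℝ), IntervalIntegrable (fun t : ℝ =>
        ((∏ i, ξ i ^ (∑ j, β j) i : ℝ) : ℂ) • (I • cexp (-(I * t)) •
          L β fun j => resPow (quadMap M ξ) hq (α j) t)) volume a b := fun β a b =>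
      ((continuous_smul_resPow (L β) hq α).const_smul _).intervalIntegrable a b
    refine ⟨fun a b => ?_, ?_⟩
    · simp only [hterm]
      have h := IntervalIntegrable.sum B fun β _ => hii β a b
      simpa only [Finset.sum_fn] using h
    · simp only [hterm]
      have h := tendsto_finsetSum B fun β _ =>
        (tendsto_intervalIntegral_resPow (L β) hq hcpos (hcq ξ) hα).const_smul
          ((∏ i, ξ i ^ (∑ j, β j) i : ℝ) : ℂ)
      rw [Finset.smul_sum]
      simp only [smul_comm (2 * Real.pi * I : ℂ)]
      refine h.congr fun p => ?_
      rw [intervalIntegral.integral_finsetSum fun β _ => hii β _ _]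
      simp only [intervalIntegral.integral_smul]
      rfl
  · have h2 : (2 * Real.pi * I : ℂ) ≠ 0 := Complex.two_pi_I_ne_zero
    rw [integral_smul, smul_smul, one_div, inv_mul_cancel₀ h2, one_smul,
      integral_finsetSum _ fun β _ => hint β, FAtZero]
    refine Finset.sum_congr rfl fun β _ => ?_
    rw [(hcalc (∑ j, β j)).smoothFunCalc_eq]

end Main

end Rearrangement

end

theorem mainTheorem2 (m n : ℕ) (hm : 0 < m)
    (θ : Matrix (Fin m) (Fin m) ℝ) (hθ : θ.transpose = -θ)
    (k : Matrix (Fin m) (Fin m) (NCTorus θ)) (hk : NCTorus.IsElliptic θ k)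
    (α : Fin (n + 1) → ℝ) (hα : ∀ j, 0 < α j)
    (ρ : Fin n → Rearrangement.PolySymbol m (NCTorus θ))
    (hρ : ∀ j β, ρ j β ∈ NCTorus.Smooth θ) :
    (∀ γ : Fin m →₀ ℕ, ∃ Φ : (Fin n → NCTorus θ) → NCTorus θ,
      Rearrangement.IsSmoothFunCalc (Rearrangement.entries k)
        (Rearrangement.spectralF α γ) Φ) ∧
    ∃ G : (Fin m → ℝ) → NCTorus θ,
      (∀ ξ, ξ ≠ 0 → Rearrangement.HasImaginaryAxisIntegral
        (fun z => Complex.exp (-z) • Rearrangement.resolventTerm k α ρ ξ z) (G ξ)) ∧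
      Integrable G volume ∧
      (1 / (2 * (Real.pi : ℂ) * Complex.I)) • ∫ ξ, G ξ = Rearrangement.FAtZero α k ρ := by
  obtain ⟨-, h, -, hsym, hsa, hc, rfl⟩ := hk
  obtain ⟨h1, h2, h3⟩ := Rearrangement.exp_matrix_spec h hsym hsa hc
  exact Rearrangement.rearrangement (fun _ => h1 _ _) (fun _ _ => h2 _ _ _ _) h3 hα ρ
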